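/- Let $X$ be a quasi-compact scheme and let $\mathcal{P}(X)$ be the exact category of locally free $\mathcal{O}_X$-modules of finite rank. For an idempotent complete exact category $\mathcal{M}$, let $C\mathcal{M}$ be the exact category of bounded chain complexes in $\mathcal{M}$ supported in non-negative degrees. A complex in $\mathcal{M}$ is acyclic if it is obtained by splicing short exact sequences of $\mathcal{M}$, and a morphism in $C\mathcal{M}$ is a quasi-isomorphism if its mapping cone is acyclic. A binary complex $(V_\bullet,d,\tilde d)$ in $\mathcal{M}$ is a graded object with two differentials $d,\tilde d$ of degree $-1$; morphisms are degree-$0$ maps commuting with both differentials. Let $B^q\mathcal{M}$ be the exact category of binary complexes such that both $(V_\bullet,d)$ and $(V_\bullet,\tilde d)$ are acyclic complexes in $C\mathcal{M}$ (short exact sequences are taken degreewise). Iterating, one gets the exact categories $(B^q)^s\mathcal{P}(X)$ and $C(B^q)^s\mathcal{P}(X)$, $s\ge 0$. Let $k\ge 1$. The $k$-th exterior power $\bigwedge^k$ is defined inductively as follows. On $\mathcal{P}(X)$ it is the usual $k$-th exterior power of $\mathcal{O}_X$-modules, that is, the operation $V\mapsto V\wedge\dots\wedge V$ ($k$ factors)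 of the standard assembly of power operations, in which $V_1\wedge\dots\wedge V_k$ is the image of $V_1\otimes\dots\otimes V_k$ in $\bigwedge^kV_k$. If $\bigwedge^k$ is defined on a category $\mathcal{M}$, then for chain complexes in $\mathcal{M}$ supported in non-negative degrees it is defined by the Dold–Puppe construction $\bigwedge^k(V_\bullet)=N\bigl(\bigwedge^k(\Gamma V_\bullet)\bigr)$, where $\Gamma$ and $N$ are the functors of the Dold–Kan correspondence, and for binary complexes it is defined by applying this construction to each of the two differentials (the resulting graded objects are canonically identified). Then for every $s\ge 0$, every $k\ge1$ and every quasi-isomorphism $f_\bullet\colon V_\bullet\to W_\bullet$ in $C(B^q)^s\mathcal{P}(X)$, the complexes $\bigwedge^k(V_\bullet)$ and $\bigwedge^k(W_\bullet)$ again belong to $C(B^q)^s\mathcal{P}(X)$, and $\bigwedge^k(f_\bullet)\colon\bigwedge^k(V_\bullet)\to\bigwedge^k(W_\bullet)$ is a quasi-isomorphism in $C(B^q)^s\mathcal{P}(X)$. In particular ($s=0$), if $f_\bullet$ is a quasi-isomorphism between bounded complexes, supported in non-negative degrees, of locally free $\mathcal{O}_X$-modules of finite rank (i.e. $f_\bullet$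 induces isomorphisms on the homology sheaves), then so is $\bigwedge^k(f_\bullet)$ for every $k\ge1$. -/

import Mathlib

universe v u

noncomputable section

open CategoryTheory CategoryTheory.Limits AlgebraicTopology AlgebraicGeometry Opposite

namespace PresheafOfModules
variable {C : Type*} [Category* C] {R : Cᵒᵖ ⥤ CommRingCat.{u}}

/-- The restriction map `⋀ᵏ M(X) ⟶ ⋀ᵏ M(Y)`, `m₁ ∧ … ∧ m_k ↦ m₁|_Y ∧ … ∧ m_k|_Y`. -/
def exteriorPowerMap (M : PresheafOfModules.{u} (R ⋙ forget₂ _ RingCat)) (k : ℕ) {X Y : Cᵒᵖ}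
    (f : X ⟶ Y) :
    ModuleCat.exteriorPower (R := R.obj X) (M.obj X) k ⟶
      (ModuleCat.restrictScalars (R.map f).hom).obj
        (ModuleCat.exteriorPower (R := R.obj Y) (M.obj Y) k) :=
  ModuleCat.exteriorPower.desc (R := R.obj X) (M := M.obj X)
    { toFun := fun m => exteriorPower.ιMulti (R.obj Y) k (M := M.obj Y)
        (fun i => M.map f (m i))
      map_update_add' := fun m i x y => by
        have h (z : M.obj X) : (fun j => M.map f (Function.update m i z j)) =
            Function.update (fun j => (M.map f (m j) : M.obj Y)) i (M.map f z) := by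
          ext j; by_cases hj : j = i
          · subst hj; simp
          · simp [hj]
        have e : ‹DecidableEq (Fin k)› = instDecidableEqFin k := Subsingleton.elim _ _
        subst e
        simp only [h]
        erw [map_add]
        exact (exteriorPower.ιMulti (R.obj Y) k (M := M.obj Y)).map_update_add _ _ _ _
      map_update_smul' := fun m i c x => by
        have h (z : M.obj X) : (fun j => M.map f (Function.update m i z j)) =
            Function.update (fun j => (M.map f (m j) : M.obj Y)) i (M.map f z) := by
          ext j; by_cases hj : j = i
          · subst hj; simp
          · simp [hj]
        have e : ‹DecidableEq (Fin k)› = instDecidableEqFin k := Subsingleton.elim _ _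
        subst e
        simp only [h]
        erw [M.map_smul]
        exact (exteriorPower.ιMulti (R.obj Y) k (M := M.obj Y)).map_update_smul _ _ _ _
      map_eq_zero_of_eq' := fun m i j h hij => 
        (exteriorPower.ιMulti (R.obj Y) k (M := M.obj Y)).map_eq_zero_of_eq _
          (congrArg (fun z => (M.map f z : M.obj Y)) h) hij }

lemma exteriorPowerMap_mk (M : PresheafOfModules.{u} (R ⋙ forget₂ _ RingCat)) (k : ℕ) {X Y : Cᵒᵖ}
    (f : X ⟶ Y) (m : Fin k → M.obj X) :
    exteriorPowerMap M k f (ModuleCat.exteriorPower.mk (R := R.obj X) (M := M.obj X) m) =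
      ModuleCat.exteriorPower.mk (R := R.obj Y) (M := M.obj Y) (fun i => M.map f (m i)) :=
  ModuleCat.exteriorPower.desc_mk (R := R.obj X) (M := M.obj X) _ m

/-- The exterior power presheaf `U ↦ ⋀ᵏ M(U)`. -/
def exteriorPowerObj (M : PresheafOfModules.{u} (R ⋙ forget₂ _ RingCat)) (k : ℕ) :
    PresheafOfModules.{u} (R ⋙ forget₂ _ RingCat) where
  obj X := ModuleCat.exteriorPower (R := R.obj X) (M.obj X) k
  map f := exteriorPowerMap M k f
  map_id X := ModuleCat.exteriorPower.hom_ext (R := R.obj X) (M := M.obj X) (by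
    refine ModuleCat.AlternatingMap.ext fun m => ?_
    refine (exteriorPowerMap_mk M k (𝟙 X) m).trans ?_
    exact congrArg (ModuleCat.exteriorPower.mk (R := R.obj X) (M := M.obj X))
      (funext fun i => by simp only [M.map_id]; rfl))
  map_comp {X Y Z} f g := ModuleCat.exteriorPower.hom_ext (R := R.obj X) (M := M.obj X) (by
    refine ModuleCat.AlternatingMap.ext fun m => ?_
    refine (exteriorPowerMap_mk M k (f ≫ g) m).trans ?_
    refine Eq.trans ?_ (congrArg (exteriorPowerMap M k g) (exteriorPowerMap_mk M k f m)).symm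
    refine Eq.trans ?_ (exteriorPowerMap_mk M k g _).symm
    exact congrArg (ModuleCat.exteriorPower.mk (R := R.obj Z) (M := M.obj Z))
      (funext fun i => M.map_comp_apply f g (m i)))

/-- The `k`-th exterior power functor on presheaves of modules. -/
def exteriorPower (k : ℕ) :
    PresheafOfModules.{u} (R ⋙ forget₂ _ RingCat) ⥤
      PresheafOfModules.{u} (R ⋙ forget₂ _ RingCat) where
  obj M := exteriorPowerObj M k
  map {M N} φ :=
    { app := fun X => ModuleCat.exteriorPower.map (R := R.obj X) (φ.app X) k
      naturality := fun {X Y} f => ModuleCat.exteriorPower.hom_ext (R := R.obj X) (M := M.obj X) (by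
        refine ModuleCat.AlternatingMap.ext fun m => ?_
        refine (congrArg (ModuleCat.exteriorPower.map (R := R.obj Y) (φ.app Y) k)
          (exteriorPowerMap_mk M k f m)).trans ?_
        refine (ModuleCat.exteriorPower.map_mk (R := R.obj Y) (φ.app Y) _).trans ?_
        refine Eq.trans ?_ (congrArg (exteriorPowerMap N k f)
          (ModuleCat.exteriorPower.map_mk (R := R.obj X) (φ.app X) m)).symm
        refine Eq.trans ?_ (exteriorPowerMap_mk N k f _).symm
        exact congrArg (ModuleCat.exteriorPower.mk (R := R.obj Y) (M := N.obj Y))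
          (funext fun i => PresheafOfModules.naturality_apply φ f (m i))) }
  map_id M := by
    ext1 X
    exact (ModuleCat.exteriorPower.functor (R.obj X) k).map_id (M.obj X)
  map_comp φ ψ := by
    ext1 X
    exact (ModuleCat.exteriorPower.functor (R.obj X) k).map_comp (φ.app X) (ψ.app X)

end PresheafOfModules

namespace DoldPuppe

open Simplicial
variable {C : Type u} [Category.{v} C] [Preadditive C]

lemma mapMono_comm {K L : ChainComplex C ℕ} (a : ∀ n, K.X n ⟶ L.X n) {Δ Δ' : SimplexCategory} (i : Δ' ⟶ Δ) [Mono i]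
    (hi : i.toOrderHom 0 = 0) :
    DoldKan.Γ₀.Obj.Termwise.mapMono K i ≫ a Δ'.len =
      a Δ.len ≫ DoldKan.Γ₀.Obj.Termwise.mapMono L i := by
  by_cases h : Δ = Δ'
  · subst h
    obtain rfl := SimplexCategory.eq_id_of_mono i
    simp [DoldKan.Γ₀.Obj.Termwise.mapMono_id]
  · have h' : ¬ DoldKan.Isδ₀ i := fun h' => h'.2 hi
    simp [DoldKan.Γ₀.Obj.Termwise.mapMono_eq_zero _ i h h']

/-- A degreewise map of simplicial objects that is compatible with all structure maps fixing the
vertex 0 is compatible with the projectors onto the normalized complexes. -/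
lemma PInfty_naturality {X Y : SimplicialObject C} (φ : ∀ Δ, X.obj Δ ⟶ Y.obj Δ)
    (h : ∀ {Δ Δ' : SimplexCategoryᵒᵖ} (θ : Δ ⟶ Δ'), θ.unop.toOrderHom 0 = 0 →
      X.map θ ≫ φ Δ' = φ Δ ≫ Y.map θ) (n : ℕ) :
    (DoldKan.PInfty (X := X)).f n ≫ φ (op ⦋n⦌) = φ (op ⦋n⦌) ≫ (DoldKan.PInfty (X := Y)).f n := by
  obtain _ | n := n
  · simp
  have hδ : ∀ j : Fin (n + 1), X.δ j.succ ≫ φ _ = φ _ ≫ Y.δ j.succ := fun j =>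
    h (SimplexCategory.δ j.succ).op (Fin.succAbove_ne_zero_zero (Fin.succ_ne_zero j))
  have hσ : ∀ j : Fin (n + 1), X.σ j ≫ φ _ = φ _ ≫ Y.σ j := fun j =>
    h (SimplexCategory.σ j).op (by simp [SimplexCategory.σ])
  have h1 : (DoldKan.PInfty (X := X)).f (n+1) ≫ φ (op ⦋n+1⦌) =
      (DoldKan.PInfty (X := X)).f (n+1) ≫ φ (op ⦋n+1⦌) ≫ (DoldKan.PInfty (X := Y)).f (n+1) := by
    have hv : DoldKan.HigherFacesVanish (n+1)
        ((DoldKan.PInfty (X := X)).f (n+1) ≫ φ (op ⦋n+1⦌)) := fun j hj => by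
      have h0 : (DoldKan.PInfty (X := X)).f (n+1) ≫ X.δ j.succ = 0 :=
        DoldKan.HigherFacesVanish.of_P (n+1) n j hj
      rw [Category.assoc, ← hδ, ← Category.assoc, h0, zero_comp]
    have := hv.comp_P_eq_self
    rw [Category.assoc] at this
    exact this.symm
  have h2 : (DoldKan.QInfty (X := X)).f (n+1) ≫ φ (op ⦋n+1⦌) ≫ (DoldKan.PInfty (X := Y)).f (n+1) = 0 := by
    rw [DoldKan.QInfty_f, DoldKan.decomposition_Q, Preadditive.sum_comp]
    refine Finset.sum_eq_zero fun i _ => ?_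
    simp only [Category.assoc]
    rw [reassoc_of% (hσ i.rev), DoldKan.σ_comp_PInfty]
    simp
  rw [h1]
  have h3 := DoldKan.PInfty_f_add_QInfty_f (X := X) (n+1)
  have h4 := congrArg (fun z => z ≫ φ (op ⦋n+1⦌) ≫ (DoldKan.PInfty (X := Y)).f (n+1)) h3
  simp only [Preadditive.add_comp, h2, add_zero] at h4
  exact h4.trans (Category.id_comp _)

variable [HasFiniteCoproducts C] [IsIdempotentComplete C]

section
variable (K L M : ChainComplex C ℕ)

/-- The map in simplicial degree `Δ` between the simplicial objects of two chain complexes that is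
induced by a graded map, which need not commute with the differentials. -/
def gammaMap {K L : ChainComplex C ℕ} (a : ∀ n, K.X n ⟶ L.X n) (Δ : SimplexCategoryᵒᵖ) :
    (Idempotents.DoldKan.Γ.obj K).obj Δ ⟶ (Idempotents.DoldKan.Γ.obj L).obj Δ :=
  (DoldKan.Γ₀.splitting K).desc Δ fun A =>
    a A.1.unop.len ≫ ((DoldKan.Γ₀.splitting L).cofan Δ).inj A

variable {K L M}

lemma gammaMap_hom (f : K ⟶ L) (Δ : SimplexCategoryᵒᵖ) :
    gammaMap (fun n => f.f n) Δ = (Idempotents.DoldKan.Γ.map f).app Δ := rfl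

lemma gammaMap_id (Δ : SimplexCategoryᵒᵖ) :
    gammaMap (fun n => 𝟙 (K.X n)) Δ = 𝟙 _ := by
  apply (DoldKan.Γ₀.splitting K).hom_ext'
  intro A
  exact ((DoldKan.Γ₀.splitting K).ι_desc Δ _ A).trans
    ((Category.id_comp _).trans (Category.comp_id _).symm)

lemma gammaMap_comp (a : ∀ n, K.X n ⟶ L.X n) (b : ∀ n, L.X n ⟶ M.X n) (Δ : SimplexCategoryᵒᵖ) :
    gammaMap (fun n => a n ≫ b n) Δ = gammaMap a Δ ≫ gammaMap b Δ := by
  apply (DoldKan.Γ₀.splitting K).hom_ext'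
  intro A
  refine ((DoldKan.Γ₀.splitting K).ι_desc Δ _ A).trans (Eq.symm ?_)
  refine ((DoldKan.Γ₀.splitting K).ι_desc_assoc Δ _ A _).trans ?_
  exact (Category.assoc _ _ _).trans ((congrArg (fun z => a _ ≫ z)
    ((DoldKan.Γ₀.splitting L).ι_desc Δ _ A)).trans (Category.assoc _ _ _).symm)

lemma gammaMap_naturality (a : ∀ n, K.X n ⟶ L.X n) {Δ Δ' : SimplexCategoryᵒᵖ} (θ : Δ ⟶ Δ')
    (hθ : θ.unop.toOrderHom 0 = 0) :
    (Idempotents.DoldKan.Γ.obj K).map θ ≫ gammaMap a Δ' =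
      gammaMap a Δ ≫ (Idempotents.DoldKan.Γ.obj L).map θ := by
  apply (DoldKan.Γ₀.splitting K).hom_ext'
  intro A
  have hA : ∀ {D D' : SimplexCategory} (e : D ⟶ D') [Epi e], e.toOrderHom 0 = 0 := by
    intro D D' e he
    obtain ⟨x, hx⟩ := SimplexCategory.epi_iff_surjective.1 he 0
    exact le_antisymm ((e.toOrderHom.monotone (Fin.zero_le x)).trans hx.le) (Fin.zero_le _)
  have hi : (image.ι (θ.unop ≫ A.e)).toOrderHom 0 = 0 := by
    have h1 := hA (factorThruImage (θ.unop ≫ A.e))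
    have h2 : (factorThruImage (θ.unop ≫ A.e) ≫ image.ι (θ.unop ≫ A.e)).toOrderHom 0 = 0 := by
      rw [image.fac]
      change A.e.toOrderHom (θ.unop.toOrderHom 0) = 0
      rw [hθ, hA]
    rw [← h1]
    exact h2
  have key := mapMono_comm a (image.ι (θ.unop ≫ A.e)) hi
  refine (DoldKan.Γ₀.Obj.map_on_summand'_assoc K A θ _).trans ?_
  refine (Category.assoc _ _ _).trans ?_
  refine (congrArg (fun z => DoldKan.Γ₀.Obj.Termwise.mapMono K (image.ι (θ.unop ≫ A.e)) ≫ z)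
    ((DoldKan.Γ₀.splitting K).ι_desc Δ' _ (A.pull θ))).trans ?_
  refine Eq.trans ?_ ((DoldKan.Γ₀.splitting K).ι_desc_assoc Δ _ A _).symm
  refine Eq.trans ?_ ((congrArg (fun z => a _ ≫ z)
    (DoldKan.Γ₀.Obj.map_on_summand' L A θ)).symm.trans (Category.assoc _ _ _).symm)
  exact (reassoc_of% key) _

end

/-- The Dold–Puppe extension `N F Γ` of a functor `F` to chain complexes in non-negative degrees,
where `Γ` and `N` are the two functors of the Dold–Kan correspondence. -/
def functor (F : C ⥤ C) : ChainComplex C ℕ ⥤ ChainComplex C ℕ :=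
  Idempotents.DoldKan.Γ ⋙ (SimplicialObject.whiskering C C).obj F ⋙ Idempotents.DoldKan.N

/-- The inclusion of the normalized chain complex. -/
def incl (X : SimplicialObject C) (n : ℕ) :
    (Idempotents.DoldKan.N.obj X).X n ⟶ X.obj (op ⦋n⦌) :=
  (((Idempotents.toKaroubiEquivalence (ChainComplex C ℕ)).counitIso.hom.app
    (DoldKan.N₁.obj X)).f).f n

/-- The projection onto the normalized chain complex. -/
def proj (X : SimplicialObject C) (n : ℕ) :
    X.obj (op ⦋n⦌) ⟶ (Idempotents.DoldKan.N.obj X).X n :=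
  (((Idempotents.toKaroubiEquivalence (ChainComplex C ℕ)).counitIso.inv.app
    (DoldKan.N₁.obj X)).f).f n

lemma incl_proj (X : SimplicialObject C) (n : ℕ) : incl X n ≫ proj X n = 𝟙 _ := by
  have := (Idempotents.toKaroubiEquivalence (ChainComplex C ℕ)).counitIso.hom_inv_id_app
    (DoldKan.N₁.obj X)
  have := congrArg (fun f => HomologicalComplex.Hom.f (Idempotents.Karoubi.Hom.f f) n) this
  exact this

lemma proj_incl (X : SimplicialObject C) (n : ℕ) :
    proj X n ≫ incl X n = (DoldKan.PInfty (X := X)).f n := by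
  have := (Idempotents.toKaroubiEquivalence (ChainComplex C ℕ)).counitIso.inv_hom_id_app
    (DoldKan.N₁.obj X)
  have := congrArg (fun f => HomologicalComplex.Hom.f (Idempotents.Karoubi.Hom.f f) n) this
  exact this

lemma incl_naturality {X Y : SimplicialObject C} (f : X ⟶ Y) (n : ℕ) :
    (Idempotents.DoldKan.N.map f).f n ≫ incl Y n =
      incl X n ≫ (DoldKan.PInfty (X := X)).f n ≫ f.app (op ⦋n⦌) := by
  have := (Idempotents.toKaroubiEquivalence (ChainComplex C ℕ)).counitIso.hom.naturality
    (DoldKan.N₁.map f)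
  have := congrArg (fun f => HomologicalComplex.Hom.f (Idempotents.Karoubi.Hom.f f) n) this
  exact this

lemma incl_PInfty (X : SimplicialObject C) (n : ℕ) :
    incl X n ≫ (DoldKan.PInfty (X := X)).f n = incl X n := by
  rw [← proj_incl, ← Category.assoc, incl_proj, Category.id_comp]

lemma PInfty_proj (X : SimplicialObject C) (n : ℕ) :
    (DoldKan.PInfty (X := X)).f n ≫ proj X n = proj X n := by
  rw [← proj_incl, Category.assoc, incl_proj, Category.comp_id]

variable (F : C ⥤ C) {K L M : ChainComplex C ℕ}

/-- The simplicial object obtained by applying `F` to the simplicial object of `K`. -/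
abbrev gammaF (K : ChainComplex C ℕ) : SimplicialObject C :=
  ((SimplicialObject.whiskering C C).obj F).obj (Idempotents.DoldKan.Γ.obj K)

/-- The map in simplicial degree `Δ` induced by a graded map. -/
def gammaFMap (a : ∀ n, K.X n ⟶ L.X n) (Δ : SimplexCategoryᵒᵖ) :
    (gammaF F K).obj Δ ⟶ (gammaF F L).obj Δ :=
  F.map (gammaMap a Δ)

lemma gammaFMap_id (Δ : SimplexCategoryᵒᵖ) : gammaFMap F (fun n => 𝟙 (K.X n)) Δ = 𝟙 _ := by
  rw [gammaFMap, gammaMap_id, F.map_id]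
  rfl

lemma gammaFMap_comp (a : ∀ n, K.X n ⟶ L.X n) (b : ∀ n, L.X n ⟶ M.X n) (Δ : SimplexCategoryᵒᵖ) :
    gammaFMap F (fun n => a n ≫ b n) Δ = gammaFMap F a Δ ≫ gammaFMap F b Δ := by
  rw [gammaFMap, gammaMap_comp, F.map_comp]
  rfl

lemma gammaFMap_PInfty (a : ∀ n, K.X n ⟶ L.X n) (n : ℕ) :
    (DoldKan.PInfty (X := gammaF F K)).f n ≫ gammaFMap F a (op ⦋n⦌) =
      gammaFMap F a (op ⦋n⦌) ≫ (DoldKan.PInfty (X := gammaF F L)).f n :=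
  PInfty_naturality (X := gammaF F K) (Y := gammaF F L) (fun Δ => gammaFMap F a Δ) (fun θ hθ => by
    have := congrArg F.map (gammaMap_naturality a θ hθ)
    rw [F.map_comp, F.map_comp] at this
    exact this) n

/-- The graded map between the Dold–Puppe extensions that is induced by a graded map, which need
not commute with the differentials. -/
def grMap (a : ∀ n, K.X n ⟶ L.X n) (n : ℕ) :
    (Idempotents.DoldKan.N.obj (gammaF F K)).X n ⟶ (Idempotents.DoldKan.N.obj (gammaF F L)).X n :=
  incl (gammaF F K) n ≫ gammaFMap F a (op ⦋n⦌) ≫ proj (gammaF F L) n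

lemma grMap_hom (f : K ⟶ L) (n : ℕ) :
    grMap F (fun n => f.f n) n = ((functor F).map f).f n := by
  have h := incl_naturality (((SimplicialObject.whiskering C C).obj F).map
    (Idempotents.DoldKan.Γ.map f)) n
  rw [← Category.assoc, incl_PInfty] at h
  have h' := congrArg (fun z => z ≫ proj (gammaF F L) n) h
  simp only [Category.assoc, incl_proj, Category.comp_id] at h'
  exact h'.symm

lemma grMap_id (n : ℕ) : grMap F (fun n => 𝟙 (K.X n)) n = 𝟙 _ := by
  rw [grMap, gammaFMap_id, Category.id_comp, incl_proj]

lemma grMap_comp (a : ∀ n, K.X n ⟶ L.X n) (b : ∀ n, L.X n ⟶ M.X n) (n : ℕ) :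
    grMap F (fun n => a n ≫ b n) n = grMap F a n ≫ grMap F b n := by
  have h := gammaFMap_PInfty F b n
  have hp := PInfty_proj (gammaF F M) n
  simp only [grMap, gammaFMap_comp, Category.assoc]
  rw [← Category.assoc (proj _ _), proj_incl]
  congr 2
  have h' := congrArg (fun z => z ≫ proj (gammaF F M) n) h
  simp only [Category.assoc] at h'
  exact (h'.trans (congrArg (fun z => gammaFMap F b (op ⦋n⦌) ≫ z) hp)).symm

end DoldPuppe

/-- A binary complex: a graded object with two differentials of degree `-1`. The components
`d i j` and `d' i j` vanish unless `i = j + 1`. -/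
structure BinaryComplex (C : Type u) [Category.{v} C] [Preadditive C] where
  X : ℕ → C
  d (i j : ℕ) : X i ⟶ X j
  d' (i j : ℕ) : X i ⟶ X j
  shape (i j : ℕ) (h : ¬ (ComplexShape.down ℕ).Rel i j) : d i j = 0
  shape' (i j : ℕ) (h : ¬ (ComplexShape.down ℕ).Rel i j) : d' i j = 0
  d_comp_d (i j k : ℕ) : d i j ≫ d j k = 0
  d'_comp_d' (i j k : ℕ) : d' i j ≫ d' j k = 0

namespace BinaryComplex

section
variable {C : Type u} [Category.{v} C] [Preadditive C]

/-- Morphisms: degree-zero maps that are chain maps for both differentials. -/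
@[ext]
structure Hom (V W : BinaryComplex C) where
  f (n : ℕ) : V.X n ⟶ W.X n
  comm (i j : ℕ) : f i ≫ W.d i j = V.d i j ≫ f j
  comm' (i j : ℕ) : f i ≫ W.d' i j = V.d' i j ≫ f j

instance : Category (BinaryComplex C) where
  Hom := Hom
  id V := ⟨fun n => 𝟙 _, by simp, by simp⟩
  comp f g := ⟨fun n => f.f n ≫ g.f n,
    fun i j => by rw [Category.assoc, g.comm, ← Category.assoc, f.comm, Category.assoc],
    fun i j => by rw [Category.assoc, g.comm', ← Category.assoc, f.comm', Category.assoc]⟩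
  id_comp f := Hom.ext (funext fun n => Category.id_comp _)
  comp_id f := Hom.ext (funext fun n => Category.comp_id _)
  assoc f g h := Hom.ext (funext fun n => Category.assoc _ _ _)

@[ext]
lemma hom_ext {V W : BinaryComplex C} {f g : V ⟶ W} (h : ∀ n, Hom.f f n = Hom.f g n) : f = g :=
  Hom.ext (funext h)

@[simp] lemma id_f (V : BinaryComplex C) (n : ℕ) : Hom.f (𝟙 V) n = 𝟙 (V.X n) := rfl

@[simp] lemma comp_f {U V W : BinaryComplex C} (f : U ⟶ V) (g : V ⟶ W) (n : ℕ) :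
    Hom.f (f ≫ g) n = Hom.f f n ≫ Hom.f g n := rfl

instance (V W : BinaryComplex C) : Add (V ⟶ W) where
  add f g := ⟨fun n => Hom.f f n + Hom.f g n,
    fun i j => by rw [Preadditive.add_comp, Preadditive.comp_add, f.comm, g.comm],
    fun i j => by rw [Preadditive.add_comp, Preadditive.comp_add, f.comm', g.comm']⟩

instance (V W : BinaryComplex C) : Zero (V ⟶ W) where
  zero := ⟨fun n => 0, by simp, by simp⟩

instance (V W : BinaryComplex C) : Neg (V ⟶ W) where
  neg f := ⟨fun n => -Hom.f f n,
    fun i j => by rw [Preadditive.neg_comp, Preadditive.comp_neg, f.comm],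
    fun i j => by rw [Preadditive.neg_comp, Preadditive.comp_neg, f.comm']⟩

instance (V W : BinaryComplex C) : AddCommGroup (V ⟶ W) where
  add_assoc f g h := Hom.ext (funext fun n => add_assoc _ _ _)
  zero_add f := Hom.ext (funext fun n => zero_add _)
  add_zero f := Hom.ext (funext fun n => add_zero _)
  neg_add_cancel f := Hom.ext (funext fun n => neg_add_cancel _)
  add_comm f g := Hom.ext (funext fun n => add_comm _ _)
  nsmul := nsmulRec
  zsmul := zsmulRec

@[simp] lemma zero_f (V W : BinaryComplex C) (n : ℕ) : Hom.f (0 : V ⟶ W) n = 0 := rfl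

@[simp] lemma add_f {V W : BinaryComplex C} (f g : V ⟶ W) (n : ℕ) :
    Hom.f (f + g) n = Hom.f f n + Hom.f g n := rfl

instance : Preadditive (BinaryComplex C) where
  add_comp U V W f g h := Hom.ext (funext fun n => Preadditive.add_comp _ _ _ _ _ _)
  comp_add U V W f g h := Hom.ext (funext fun n => Preadditive.comp_add _ _ _ _ _ _)

/-- The degree `n` part, as a functor. -/
def eval (n : ℕ) : BinaryComplex C ⥤ C where
  obj V := V.X n
  map f := Hom.f f n

instance (n : ℕ) : (eval (C := C) n).PreservesZeroMorphisms where
  map_zero _ _ := rfl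

/-- The chain complex given by the first differential. -/
def top (V : BinaryComplex C) : ChainComplex C ℕ where
  X := V.X
  d := V.d
  shape := V.shape
  d_comp_d' i j k _ _ := V.d_comp_d i j k

/-- The chain complex given by the second differential. -/
def bot (V : BinaryComplex C) : ChainComplex C ℕ where
  X := V.X
  d := V.d'
  shape := V.shape'
  d_comp_d' i j k _ _ := V.d'_comp_d' i j k

/-- A morphism of binary complexes as a chain map for the first differentials. -/
def topMap {V W : BinaryComplex C} (f : V ⟶ W) : V.top ⟶ W.top where
  f n := Hom.f f n
  comm' i j _ := Hom.comm f i j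

/-- A morphism of binary complexes as a chain map for the second differentials. -/
def botMap {V W : BinaryComplex C} (f : V ⟶ W) : V.bot ⟶ W.bot where
  f n := Hom.f f n
  comm' i j _ := Hom.comm' f i j

open ZeroObject in
instance [HasFiniteBiproducts C] : HasFiniteBiproducts (BinaryComplex C) := by
  have := hasBinaryBiproducts_of_finite_biproducts C
  have : HasZeroObject (BinaryComplex C) := by
    refine ⟨⟨⟨fun _ => (0 : C), fun _ _ => 0, fun _ _ => 0, by simp, by simp, by simp, by simp⟩, ?_⟩⟩
    rw [IsZero.iff_id_eq_zero]
    exact hom_ext fun n => (isZero_zero C).eq_of_src _ _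
  have : HasBinaryBiproducts (BinaryComplex C) := ⟨fun V W => by
    let b : BinaryBicone V W :=
      { pt :=
          { X n := V.X n ⊞ W.X n
            d i j := biprod.map (V.d i j) (W.d i j)
            d' i j := biprod.map (V.d' i j) (W.d' i j)
            shape i j h := by rw [V.shape i j h, W.shape i j h]; ext <;> simp
            shape' i j h := by rw [V.shape' i j h, W.shape' i j h]; ext <;> simp
            d_comp_d i j k := by ext <;> simp [V.d_comp_d, W.d_comp_d]
            d'_comp_d' i j k := by ext <;> simp [V.d'_comp_d', W.d'_comp_d'] }
        fst := ⟨fun n => biprod.fst, by simp, by simp⟩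
        snd := ⟨fun n => biprod.snd, by simp, by simp⟩
        inl := ⟨fun n => biprod.inl, by simp, by simp⟩
        inr := ⟨fun n => biprod.inr, by simp, by simp⟩
        inl_fst := hom_ext fun n => biprod.inl_fst
        inl_snd := hom_ext fun n => biprod.inl_snd
        inr_fst := hom_ext fun n => biprod.inr_fst
        inr_snd := hom_ext fun n => biprod.inr_snd }
    exact hasBinaryBiproduct_of_total b (hom_ext fun n => biprod.total)⟩
  have : HasBinaryProducts (BinaryComplex C) := inferInstance
  have : HasTerminal (BinaryComplex C) := inferInstance
  have : HasFiniteProducts (BinaryComplex C) := hasFiniteProducts_of_has_binary_and_terminal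
  exact HasFiniteBiproducts.of_hasFiniteProducts

instance [IsIdempotentComplete C] : IsIdempotentComplete (BinaryComplex C) where
  idempotents_split V p hp := by
    have hp' : ∀ n, Hom.f p n ≫ Hom.f p n = Hom.f p n := fun n =>
      congrArg (fun g => Hom.f g n) hp
    choose Y i e h₁ h₂ using fun n =>
      IsIdempotentComplete.idempotents_split (V.X n) (Hom.f p n) (hp' n)
    have hi : ∀ n, i n ≫ Hom.f p n = i n := fun n => by
      rw [← h₂, ← Category.assoc, h₁, Category.id_comp]
    have he : ∀ n, Hom.f p n ≫ e n = e n := fun n => by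
      rw [← h₂, Category.assoc, h₁, Category.comp_id]
    have hc : ∀ m n, Hom.f p m ≫ V.d m n = V.d m n ≫ Hom.f p n := Hom.comm p
    have hc' : ∀ m n, Hom.f p m ≫ V.d' m n = V.d' m n ≫ Hom.f p n := Hom.comm' p
    have key : ∀ k m n, (i k ≫ V.d k m ≫ e m) ≫ i m ≫ V.d m n ≫ e n = 0 := fun k m n => by
      simp only [Category.assoc]
      rw [reassoc_of% (h₂ m), reassoc_of% (hc m n), he, reassoc_of% (V.d_comp_d k m n)]
      simp
    have key' : ∀ k m n, (i k ≫ V.d' k m ≫ e m) ≫ i m ≫ V.d' m n ≫ e n = 0 := fun k m n => by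
      simp only [Category.assoc]
      rw [reassoc_of% (h₂ m), reassoc_of% (hc' m n), he, reassoc_of% (V.d'_comp_d' k m n)]
      simp
    refine ⟨⟨Y, fun m n => i m ≫ V.d m n ≫ e n, fun m n => i m ≫ V.d' m n ≫ e n,
      fun m n h => by rw [V.shape m n h]; simp, fun m n h => by rw [V.shape' m n h]; simp,
      key, key'⟩,
      ⟨i, fun m n => ?_, fun m n => ?_⟩, ⟨e, fun m n => ?_, fun m n => ?_⟩, ?_, ?_⟩
    · simp only [Category.assoc]
      rw [h₂, ← hc, ← Category.assoc, hi]
    · simp only [Category.assoc]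
      rw [h₂, ← hc', ← Category.assoc, hi]
    · rw [reassoc_of% (h₂ m), reassoc_of% (hc m n), he]
    · rw [reassoc_of% (h₂ m), reassoc_of% (hc' m n), he]
    · ext n; exact h₁ n
    · ext n; exact h₂ n

end

variable {C : Type u} [Category.{v} C] [Preadditive C] [HasFiniteCoproducts C]
  [IsIdempotentComplete C] (F : C ⥤ C)

/-- The objects of the Dold–Puppe extension do not depend on the differential: the canonical
isomorphism from the objects for the first differential to those for the second one. -/
def compare (V : BinaryComplex C) (n : ℕ) :
    ((DoldPuppe.functor F).obj V.top).X n ⟶ ((DoldPuppe.functor F).obj V.bot).X n :=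
  DoldPuppe.grMap F (K := V.top) (L := V.bot) (fun n => 𝟙 (V.X n)) n

/-- The inverse of the canonical isomorphism. -/
def compareInv (V : BinaryComplex C) (n : ℕ) :
    ((DoldPuppe.functor F).obj V.bot).X n ⟶ ((DoldPuppe.functor F).obj V.top).X n :=
  DoldPuppe.grMap F (K := V.bot) (L := V.top) (fun n => 𝟙 (V.X n)) n

lemma compareInv_compare (V : BinaryComplex C) (n : ℕ) :
    compareInv F V n ≫ compare F V n = 𝟙 _ := by
  have h := DoldPuppe.grMap_comp F (K := V.bot) (L := V.top) (M := V.bot)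
    (fun n => 𝟙 (V.X n)) (fun n => 𝟙 (V.X n)) n
  have e : (fun n => 𝟙 (V.X n) ≫ 𝟙 (V.X n)) = fun n => 𝟙 (V.bot.X n) :=
    funext fun n => Category.comp_id _
  exact h.symm.trans ((congrArg (fun a => DoldPuppe.grMap F (K := V.bot) (L := V.bot) a n) e).trans
    (DoldPuppe.grMap_id F (K := V.bot) n))

lemma compare_compareInv (V : BinaryComplex C) (n : ℕ) :
    compare F V n ≫ compareInv F V n = 𝟙 _ := by
  have h := DoldPuppe.grMap_comp F (K := V.top) (L := V.bot) (M := V.top)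
    (fun n => 𝟙 (V.X n)) (fun n => 𝟙 (V.X n)) n
  have e : (fun n => 𝟙 (V.X n) ≫ 𝟙 (V.X n)) = fun n => 𝟙 (V.top.X n) :=
    funext fun n => Category.comp_id _
  exact h.symm.trans ((congrArg (fun a => DoldPuppe.grMap F (K := V.top) (L := V.top) a n) e).trans
    (DoldPuppe.grMap_id F (K := V.top) n))

lemma compare_naturality {V W : BinaryComplex C} (f : V ⟶ W) (n : ℕ) :
    ((DoldPuppe.functor F).map (topMap f)).f n ≫ compare F W n =
      compare F V n ≫ ((DoldPuppe.functor F).map (botMap f)).f n := by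
  rw [← DoldPuppe.grMap_hom, ← DoldPuppe.grMap_hom]
  have h₁ := DoldPuppe.grMap_comp F (K := V.top) (L := W.top) (M := W.bot)
    (fun n => Hom.f f n) (fun n => 𝟙 (W.X n)) n
  have h₂ := DoldPuppe.grMap_comp F (K := V.top) (L := V.bot) (M := W.bot)
    (fun n => 𝟙 (V.X n)) (fun n => Hom.f f n) n
  have e : (fun n => Hom.f f n ≫ 𝟙 (W.X n)) = fun n => 𝟙 (V.X n) ≫ Hom.f f n :=
    funext fun n => by rw [Category.comp_id, Category.id_comp]
  exact h₁.symm.trans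
    ((congrArg (fun a => DoldPuppe.grMap F (K := V.top) (L := W.bot) a n) e).trans h₂)

/-- The Dold–Puppe extension of `F` to binary complexes, on objects: apply the Dold–Puppe extension
to both differentials, and identify the underlying graded objects canonically. -/
def doldPuppeObj (V : BinaryComplex C) : BinaryComplex C where
  X := ((DoldPuppe.functor F).obj V.top).X
  d := ((DoldPuppe.functor F).obj V.top).d
  d' i j := compare F V i ≫ ((DoldPuppe.functor F).obj V.bot).d i j ≫ compareInv F V j
  shape := ((DoldPuppe.functor F).obj V.top).shape
  shape' i j h := by rw [((DoldPuppe.functor F).obj V.bot).shape i j h]; simp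
  d_comp_d i j k := ((DoldPuppe.functor F).obj V.top).d_comp_d i j k
  d'_comp_d' i j k := by
    simp only [Category.assoc]
    rw [reassoc_of% (compareInv_compare F V j), HomologicalComplex.d_comp_d_assoc]
    simp

/-- The Dold–Puppe extension of `F` to binary complexes. -/
def doldPuppe : BinaryComplex C ⥤ BinaryComplex C where
  obj V := doldPuppeObj F V
  map {V W} f :=
    { f n := ((DoldPuppe.functor F).map (topMap f)).f n
      comm i j := HomologicalComplex.Hom.comm _ i j
      comm' i j := by
        have h := compare_naturality F f
        have hj : ((DoldPuppe.functor F).map (botMap f)).f j ≫ compareInv F W j =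
            compareInv F V j ≫ ((DoldPuppe.functor F).map (topMap f)).f j := by
          have := congrArg (fun z => compareInv F V j ≫ z ≫ compareInv F W j) (h j)
          simp only [Category.assoc] at this
          rw [compare_compareInv, Category.comp_id,
            reassoc_of% (compareInv_compare F V j)] at this
          exact this.symm
        have hd := ((DoldPuppe.functor F).map (botMap f)).comm i j
        dsimp only [doldPuppeObj]
        rw [reassoc_of% (h i), reassoc_of% hd, hj]
        simp only [Category.assoc] }
  map_id V := by
    ext n
    exact congrArg (fun z => HomologicalComplex.Hom.f z n) ((DoldPuppe.functor F).map_id V.top)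
  map_comp f g := by
    ext n
    exact congrArg (fun z => HomologicalComplex.Hom.f z n)
      ((DoldPuppe.functor F).map_comp (topMap f) (topMap g))

end BinaryComplex

/-- The `k`-th exterior power functor on the category of `𝒪_X`-modules: the sheafification of `U ↦ ⋀ᵏ M(U)`. -/
def modulesExteriorPower (X : Scheme.{u}) (k : ℕ) : X.Modules ⥤ X.Modules :=
  Scheme.Modules.toPresheafOfModules X ⋙
    (PresheafOfModules.exteriorPower (R := X.presheaf) k :
      X.PresheafOfModules ⥤ X.PresheafOfModules) ⋙
    (PresheafOfModules.sheafification (𝟙 X.ringCatSheaf.obj) : X.PresheafOfModules ⥤ X.Modules)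

/-- Locally free `𝒪_X`-modules of finite rank: every point has an open neighbourhood `U` such that
`M|_U ≅ 𝒪_U ^ n` for some natural number `n`. -/
def IsVectorBundle (X : Scheme.{u}) : ObjectProperty X.Modules := fun M =>
  ∀ x : X, ∃ (U : X.Opens) (n : ℕ), x ∈ U ∧
    Nonempty (M.restrict U.ι ≅
      (SheafOfModules.free (R := (U : Scheme.{u}).ringCatSheaf) (ULift.{u} (Fin n)) :
        (U : Scheme.{u}).Modules))

/-- An exact category, presented as the full subcategory (on the objects satisfying `mem`) of an
ambient idempotent complete additive category `C`. A short sequence of objects satisfying `mem` is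
a short exact sequence of the exact category if it satisfies `conflation`. -/
structure ExactDatum where
  /-- the ambient category -/
  C : Type u
  [category : Category.{v} C]
  [preadditive : Preadditive C]
  [hasFiniteBiproducts : HasFiniteBiproducts C]
  [isIdempotentComplete : IsIdempotentComplete C]
  /-- the objects of the exact category -/
  mem : ObjectProperty C
  /-- the short exact sequences -/
  conflation : ShortComplex C → Prop

namespace ExactDatum

attribute [instance] category preadditive hasFiniteBiproducts isIdempotentComplete

instance (E : ExactDatum.{v, u}) : HasBinaryBiproducts E.C :=
  hasBinaryBiproducts_of_finite_biproducts E.C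

variable (E : ExactDatum.{v, u})

/-- The objects of the category of bounded chain complexes, supported in non-negative degrees, in
the exact category `E`. -/
def boundedComplexes : ObjectProperty (ChainComplex E.C ℕ) := fun V =>
  (∃ N : ℕ, ∀ n, N ≤ n → IsZero (V.X n)) ∧ ∀ n, E.mem (V.X n)

/-- A chain complex in `E` is acyclic if it is spliced together from short exact sequences
`0 ⟶ Z (n + 1) ⟶ V (n + 1) ⟶ Z n ⟶ 0` of `E`, where `Z 0 = V 0`. -/
def IsAcyclic (V : ChainComplex E.C ℕ) : Prop :=
  ∃ (Z : ℕ → E.C) (i : ∀ n, Z n ⟶ V.X n) (p : ∀ n, V.X (n + 1) ⟶ Z n)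
    (w : ∀ n, i (n + 1) ≫ p n = 0),
    (∀ n, E.mem (Z n)) ∧ IsIso (i 0) ∧ (∀ n, p n ≫ i n = V.d (n + 1) n) ∧
      ∀ n, E.conflation (ShortComplex.mk (i (n + 1)) (p n) (w n))

/-- A chain map is a quasi-isomorphism if its mapping cone is acyclic in `E`. -/
def IsQuasiIso {V W : ChainComplex E.C ℕ} (f : V ⟶ W) : Prop :=
  E.IsAcyclic (HomologicalComplex.homotopyCofiber f)

/-- The exact category `B^q E` of bounded acyclic binary complexes in `E` (supported in
non-negative degrees), inside the category of all binary complexes in the ambient category of `E`.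
Short exact sequences are defined degreewise. -/
def binary : ExactDatum.{v, max u v} where
  C := BinaryComplex E.C
  mem V := E.boundedComplexes V.top ∧ E.boundedComplexes V.bot ∧
    E.IsAcyclic V.top ∧ E.IsAcyclic V.bot
  conflation S := ∀ n, E.conflation (S.map (BinaryComplex.eval n))

end ExactDatum

/-- The exact category of locally free `𝒪_X`-modules of finite rank, inside the category of all
`𝒪_X`-modules. -/
def vectorBundles (X : Scheme.{u}) : ExactDatum.{u, u + 1} :=
  have : HasFiniteBiproducts X.Modules := Abelian.hasFiniteBiproducts
  { C := X.Modules
    mem := IsVectorBundle X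
    conflation := fun S => S.ShortExact }

/-- The exact category `(B^q)^s P(X)` of `s`-dimensional bounded acyclic binary multi-complexes of
locally free `𝒪_X`-modules of finite rank. -/
def binaryMultiComplexes (X : Scheme.{u}) : ℕ → ExactDatum.{u, u + 1}
  | 0 => vectorBundles X
  | s + 1 => (binaryMultiComplexes X s).binary

/-- The `k`-th exterior power functor on (the ambient category of) `(B^q)^s P(X)`, defined by
iterating the Dold–Puppe construction. -/
def multiExteriorPower (X : Scheme.{u}) (k : ℕ) :
    ∀ s : ℕ, (binaryMultiComplexes X s).C ⥤ (binaryMultiComplexes X s).C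
  | 0 => modulesExteriorPower X k
  | s + 1 => BinaryComplex.doldPuppe (multiExteriorPower X k s)

/-- The `k`-th exterior power functor on complexes in (the ambient category of) `(B^q)^s P(X)`. -/
def complexExteriorPower (X : Scheme.{u}) (k s : ℕ) :
    ChainComplex (binaryMultiComplexes X s).C ℕ ⥤ ChainComplex (binaryMultiComplexes X s).C ℕ :=
  DoldPuppe.functor (multiExteriorPower X k s)

end

/-! The Dold–Puppe extension of any functor, additive or not, respects chain homotopies: `Γ` turns a
chain homotopy into a simplicial homotopy, every functor preserves simplicial homotopies, and these
yield chain homotopies again (`gammaHomotopy`, `unnormalizedHomotopyEquiv`). Locally this is enough.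
The cone of a quasi-isomorphism of bounded complexes of vector bundles is spliced from short exact
sequences of vector bundles, only finitely many of them nontrivial, so near a given point it stays
exact on sections. There the sections are free modules, and a quasi-isomorphism of non-negative
complexes of projectives is a homotopy equivalence. Exterior powers of presheaves are formed section
by section and sheafification is exact, which settles `s = 0` (`quasiIso_modulesExteriorPower`).

For larger `s` one inducts on the package `Admissible`. An `Evaluation` is a family of additive
functors to an abelian category that detects short exact sequences, hence acyclicity and
quasi-isomorphisms (`isAcyclic_iff`, `isQuasiIso_iff`); for binary complexes one first takes the
part of some degree. The degree `n` part of `N F Γ` is a retract of `F` applied to `Γ` in degree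
`n`, and the latter is a finite sum of degree parts of the complex. A quasi-isomorphism of complexes
of binary complexes therefore becomes a quasi-isomorphism one level down, where the induction
hypothesis applies (`binary_quasiIso`). Preservation of acyclicity of the two differentials is the
case of the zero endomorphism, because `F` sends zero maps to zero when `k ≥ 1`.

Boundedness comes from the polynomial degree: `⋀ᵏ` of an identity that is a sum of projectors is an
integral combination of values on sums of at most `k` of them, and in degrees above `k * N` each
such partial sum factors through a degeneracy (`isZero_functor_X`). The normalized part is a
retract, so it stays a vector bundle: locally, a retract of a free module is the image of an
idempotent matrix (`isLocallyFreeAt_of_matrix`). -/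

noncomputable section

open CategoryTheory CategoryTheory.Limits AlgebraicTopology AlgebraicGeometry Opposite

/-! ### Combinatorics of adjoining an initial vertex -/

namespace SimplexCategory

open Simplicial

/-- The map `⦋m + 1⦌ ⟶ ⦋n + 1⦌` that extends `θ` by sending the new initial vertex to the new
initial vertex. -/
def cone {m n : ℕ} (θ : ⦋m⦌ ⟶ ⦋n⦌) : ⦋m + 1⦌ ⟶ ⦋n + 1⦌ :=
  mkHom
    { toFun := Fin.cases 0 fun j => (θ.toOrderHom j).succ
      monotone' := by
        intro a b hab
        induction a using Fin.cases with
        | zero => exact Fin.zero_le _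
        | succ a =>
          induction b using Fin.cases with
          | zero => exact absurd hab (by simp)
          | succ b =>
            simp only [Fin.cases_succ, Fin.succ_le_succ_iff] at hab ⊢
            exact θ.toOrderHom.monotone hab }

@[simp] lemma cone_zero {m n : ℕ} (θ : ⦋m⦌ ⟶ ⦋n⦌) : (cone θ).toOrderHom 0 = 0 := rfl

@[simp] lemma cone_succ {m n : ℕ} (θ : ⦋m⦌ ⟶ ⦋n⦌) (j : Fin (m + 1)) :
    (cone θ).toOrderHom j.succ = (θ.toOrderHom j).succ := rfl

lemma hom_ext_cases {m : ℕ} {Δ : SimplexCategory} {f g : ⦋m + 1⦌ ⟶ Δ}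
    (h₀ : f.toOrderHom 0 = g.toOrderHom 0)
    (h : ∀ j : Fin (m + 1), f.toOrderHom j.succ = g.toOrderHom j.succ) : f = g := by
  apply Hom.ext
  apply OrderHom.ext
  funext j
  induction j using Fin.cases with
  | zero => exact h₀
  | succ j => exact h j

lemma hom_ext_apply {Δ Δ' : SimplexCategory} {f g : Δ ⟶ Δ'}
    (h : ∀ j, f.toOrderHom j = g.toOrderHom j) : f = g :=
  Hom.ext _ _ (OrderHom.ext _ _ (funext h))

lemma cone_comp {l m n : ℕ} (θ : ⦋l⦌ ⟶ ⦋m⦌) (φ : ⦋m⦌ ⟶ ⦋n⦌) :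
    cone (θ ≫ φ) = cone θ ≫ cone φ :=
  hom_ext_cases rfl fun _ => rfl

lemma δ_zero_apply {n : ℕ} (j : Fin (n + 1)) : (δ (0 : Fin (n + 2))).toOrderHom j = j.succ := rfl

lemma σ_zero_succ {n : ℕ} (j : Fin (n + 1)) : (σ (0 : Fin (n + 1))).toOrderHom j.succ = j := by
  change Fin.predAbove 0 j.succ = j
  simp [Fin.predAbove]

instance epi_cone {m n : ℕ} (θ : ⦋m⦌ ⟶ ⦋n⦌) [Epi θ] : Epi (cone θ) := by
  rw [epi_iff_surjective]
  intro j
  induction j using Fin.cases with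
  | zero => exact ⟨0, rfl⟩
  | succ j =>
    obtain ⟨x, hx⟩ := epi_iff_surjective.1 ‹Epi θ› j
    exact ⟨x.succ, congrArg Fin.succ hx⟩

instance mono_cone {m n : ℕ} (θ : ⦋m⦌ ⟶ ⦋n⦌) [Mono θ] : Mono (cone θ) := by
  rw [mono_iff_injective]
  have h := mono_iff_injective.1 ‹Mono θ›
  intro a b
  induction a using Fin.cases with
  | zero =>
    induction b using Fin.cases with
    | zero => simp
    | succ b => intro hab; exact absurd hab (Fin.succ_ne_zero _).symm
  | succ a =>
    induction b using Fin.cases with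
    | zero => intro hab; exact absurd hab (Fin.succ_ne_zero _)
    | succ b => intro hab; exact congrArg Fin.succ (h (Fin.succ_injective _ hab))

lemma δ_zero_cone {m n : ℕ} (θ : ⦋m⦌ ⟶ ⦋n⦌) : δ 0 ≫ cone θ = θ ≫ δ 0 := rfl

/-- The map `⦋m + 1⦌ ⟶ ⦋n⦌` that extends `θ` by sending the new initial vertex to `0`. -/
def coneZero {m n : ℕ} (θ : ⦋m⦌ ⟶ ⦋n⦌) : ⦋m + 1⦌ ⟶ ⦋n⦌ :=
  cone θ ≫ σ 0

@[simp] lemma coneZero_zero {m n : ℕ} (θ : ⦋m⦌ ⟶ ⦋n⦌) : (coneZero θ).toOrderHom 0 = 0 := rfl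

@[simp] lemma coneZero_succ {m n : ℕ} (θ : ⦋m⦌ ⟶ ⦋n⦌) (j : Fin (m + 1)) :
    (coneZero θ).toOrderHom j.succ = θ.toOrderHom j :=
  σ_zero_succ _

/-- By monotonicity, if `θ` does not send `0` to `0` then it never takes the value `0`, so the new
vertex causes no collision. -/
lemma mono_coneZero {m n : ℕ} (θ : ⦋m⦌ ⟶ ⦋n⦌) [Mono θ] (h₀ : θ.toOrderHom 0 ≠ 0) :
    Mono (coneZero θ) := by
  rw [mono_iff_injective]
  have h := mono_iff_injective.1 ‹Mono θ›
  have h₁ : ∀ a, θ.toOrderHom a ≠ 0 := fun a ha =>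
    h₀ (le_antisymm ((θ.toOrderHom.monotone (Fin.zero_le a)).trans ha.le) (Fin.zero_le _))
  intro a b
  induction a using Fin.cases with
  | zero =>
    induction b using Fin.cases with
    | zero => simp
    | succ b =>
      intro hab
      exact absurd (hab.symm.trans (coneZero_zero θ)) (by
        erw [coneZero_succ]; exact h₁ b)
  | succ a =>
    induction b using Fin.cases with
    | zero => intro hab; exact absurd (hab.trans (coneZero_zero θ)) (by
        erw [coneZero_succ]; exact h₁ a)
    | succ b =>
      intro hab
      exact congrArg Fin.succ (h ((coneZero_succ θ a).symm.trans (hab.trans (coneZero_succ θ b))))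

lemma epi_apply_zero {Δ Δ' : SimplexCategory} (e : Δ ⟶ Δ') [Epi e] : e.toOrderHom 0 = 0 := by
  obtain ⟨x, hx⟩ := epi_iff_surjective.1 ‹Epi e› 0
  exact le_antisymm ((e.toOrderHom.monotone (Fin.zero_le x)).trans hx.le) (Fin.zero_le _)

/-- The map `⦋n⦌ ⟶ ⦋n + 1⦌` which is `δ 0` where `α` takes the value `1`, and zero elsewhere. -/
def coneSection {n : ℕ} (α : ⦋n⦌ ⟶ ⦋1⦌) : ⦋n⦌ ⟶ ⦋n + 1⦌ :=
  mkHom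
    { toFun := fun j => if α.toOrderHom j = 0 then 0 else j.succ
      monotone' := by
        intro a b hab
        have h := α.toOrderHom.monotone hab
        dsimp only
        split_ifs with h₁ h₂ h₂
        · exact le_rfl
        · exact Fin.zero_le _
        · rw [h₂] at h
          exact absurd (le_antisymm h (Fin.zero_le _)) h₁
        · exact Fin.succ_le_succ_iff.2 hab }

/-- With the simplex `α` of the interval as parameter, this is the naturality that turns an extra
degeneracy into a homotopy in the sense of `Homotopy.ofInterval`. -/
lemma coneSection_comp {m n : ℕ} (θ : ⦋m⦌ ⟶ ⦋n⦌) (α : ⦋n⦌ ⟶ ⦋1⦌) :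
    coneSection (θ ≫ α) ≫ cone θ = θ ≫ coneSection α := by
  apply hom_ext_apply
  intro j
  change (cone θ).toOrderHom (if α.toOrderHom (θ.toOrderHom j) = 0 then 0 else j.succ) =
    if α.toOrderHom (θ.toOrderHom j) = 0 then 0 else (θ.toOrderHom j).succ
  split_ifs <;> rfl

/-- The map `⦋n⦌ ⟶ ⦋1⦌` that sends `0, …, i` to `0` and the other vertices to `1`. -/
def cut (n i : ℕ) : ⦋n⦌ ⟶ ⦋1⦌ :=
  mkHom
    { toFun := fun j => if (j : ℕ) ≤ i then 0 else 1
      monotone' := by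
        intro a b hab
        have : (a : ℕ) ≤ b := hab
        dsimp only
        split_ifs
        · exact le_rfl
        · exact Fin.zero_le _
        · omega
        · exact le_rfl }

lemma comp_cut {m n i k : ℕ} (θ : ⦋m⦌ ⟶ ⦋n⦌)
    (h : ∀ j, ((θ.toOrderHom j : Fin (n + 1)) : ℕ) ≤ i ↔ (j : ℕ) ≤ k) :
    θ ≫ cut n i = cut m k := by
  apply hom_ext_apply
  intro j
  change (if ((θ.toOrderHom j : Fin (n + 1)) : ℕ) ≤ i then (0 : Fin 2) else 1) =
    if (j : ℕ) ≤ k then 0 else 1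
  simp only [h]

end SimplexCategory

/-! ### Simplicial homotopies indexed by the simplices of the interval -/

namespace CategoryTheory.SimplicialObject.Homotopy

open Simplicial SimplexCategory

variable {C : Type u} [Category.{v} C] {X Y : SimplicialObject C}

/-- A simplicial homotopy from a family of maps indexed by the simplices of the interval. -/
def ofInterval {f g : X ⟶ Y} (H : ∀ n : ℕ, (⦋n⦌ ⟶ ⦋1⦌) → (X _⦋n⦌ ⟶ Y _⦋n⦌))
    (nat : ∀ {m n : ℕ} (θ : ⦋m⦌ ⟶ ⦋n⦌) (α : ⦋n⦌ ⟶ ⦋1⦌),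
      H n α ≫ Y.map θ.op = X.map θ.op ≫ H m (θ ≫ α))
    (hf : ∀ (n : ℕ) (α : ⦋n⦌ ⟶ ⦋1⦌), (∀ j, α.toOrderHom j = 0) → H n α = f.app _)
    (hg : ∀ (n : ℕ) (α : ⦋n⦌ ⟶ ⦋1⦌), (∀ j, α.toOrderHom j = 1) → H n α = g.app _) :
    Homotopy f g where
  -- This is the prism decomposition: the `i`-th nondegenerate top simplex of `Δⁿ × Δ¹` has
  -- components `σ i` and the cut after `i`. All identities reduce to comparing thresholds of pulled
  -- back cuts; the two extreme faces give constant cuts.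
  h {n} i := X.σ i ≫ H (n + 1) (cut (n + 1) i)
  h_zero_comp_δ_zero n := by
    rw [SimplicialObject.δ, Category.assoc, nat, ← SimplicialObject.δ, hg]
    · exact (X.δ_comp_σ_self_assoc (i := 0) _)
    · intro j
      change (if (((SimplexCategory.δ (0 : Fin (n + 2))).toOrderHom j : Fin (n + 2)) : ℕ) ≤ 0
        then (0 : Fin 2) else 1) = 1
      rw [δ_zero_apply]
      simp
  h_last_comp_δ_last n := by
    rw [SimplicialObject.δ, Category.assoc, nat, ← SimplicialObject.δ, hf]
    · exact (X.δ_comp_σ_succ_assoc (i := Fin.last n) _)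
    · intro j
      change (if (((SimplexCategory.δ (Fin.last (n + 1))).toOrderHom j : Fin (n + 2)) : ℕ) ≤ n
        then (0 : Fin 2) else 1) = 0
      rw [if_pos]
      change (((Fin.last (n + 1)).succAbove j : Fin (n + 2)) : ℕ) ≤ n
      simp
      omega
  h_succ_comp_δ_castSucc_of_lt {n} i j hij := by
    have h1 : X.σ j.succ ≫ X.δ i.castSucc = X.δ i ≫ X.σ j :=
      X.δ_comp_σ_of_le hij
    rw [SimplicialObject.δ, Category.assoc, nat, ← SimplicialObject.δ, reassoc_of% h1,
      comp_cut (k := j)]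
    intro l
    change ((i.castSucc.succAbove l : Fin (n + 3)) : ℕ) ≤ j + 1 ↔ _
    have : (i : ℕ) ≤ j := hij
    simp only [Fin.succAbove, Fin.lt_def, Fin.val_castSucc]
    split_ifs <;> simp <;> omega
  h_succ_comp_δ_castSucc_succ {n} j := by
    have h1 : X.σ j.succ ≫ X.δ j.castSucc.succ = 𝟙 _ := by
      have := X.δ_comp_σ_self (i := j.succ)
      exact this
    have h2 : X.σ j.castSucc ≫ X.δ j.castSucc.succ = 𝟙 _ := X.δ_comp_σ_succ
    rw [SimplicialObject.δ, Category.assoc, nat, ← SimplicialObject.δ, reassoc_of% h1,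
      comp_cut (k := j), Category.assoc, nat, ← SimplicialObject.δ, reassoc_of% h2,
      comp_cut (k := j)]
    all_goals
      intro l
      change ((j.castSucc.succ.succAbove l : Fin (n + 3)) : ℕ) ≤ _ ↔ _
      simp only [Fin.succAbove, Fin.lt_def, Fin.val_castSucc, Fin.val_succ]
      split_ifs <;> simp <;> omega
  h_castSucc_comp_δ_succ_of_lt {n} i j hij := by
    have h1 : X.σ j.castSucc ≫ X.δ i.succ = X.δ i ≫ X.σ j :=
      X.δ_comp_σ_of_gt hij
    rw [SimplicialObject.δ, Category.assoc, nat, ← SimplicialObject.δ, reassoc_of% h1,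
      comp_cut (k := j)]
    intro l
    change ((i.succ.succAbove l : Fin (n + 3)) : ℕ) ≤ j ↔ _
    have : (j : ℕ) < i := hij
    simp only [Fin.succAbove, Fin.lt_def, Fin.val_castSucc, Fin.val_succ]
    split_ifs <;> simp <;> omega
  h_comp_σ_castSucc_of_le {n} i j hij := by
    have h1 : X.σ j ≫ X.σ i.castSucc = X.σ i ≫ X.σ j.succ :=
      (X.σ_comp_σ hij)
    have h2 : H (n + 1) (cut (n + 1) j) ≫ Y.σ i.castSucc = X.σ i.castSucc ≫ H (n + 2) _ :=
      nat (SimplexCategory.σ i.castSucc) _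
    rw [Category.assoc, h2, reassoc_of% h1, comp_cut (k := j + 1)]
    · rfl
    intro l
    change ((Fin.predAbove i.castSucc l : Fin (n + 2)) : ℕ) ≤ j ↔ _
    have : (i : ℕ) ≤ j := hij
    simp only [Fin.predAbove, Fin.lt_def, Fin.val_castSucc]
    split_ifs <;> simp <;> omega
  h_comp_σ_succ_of_lt {n} i j hij := by
    have h1 : X.σ i ≫ X.σ j.castSucc = X.σ j ≫ X.σ i.succ :=
      (X.σ_comp_σ hij)
    have h2 : H (n + 1) (cut (n + 1) j) ≫ Y.σ i.succ = X.σ i.succ ≫ H (n + 2) _ :=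
      nat (SimplexCategory.σ i.succ) _
    rw [Category.assoc, h2, ← reassoc_of% h1, comp_cut (k := j)]
    · rfl
    intro l
    change ((Fin.predAbove i.succ l : Fin (n + 2)) : ℕ) ≤ j ↔ _
    have : (j : ℕ) ≤ i := hij
    simp only [Fin.predAbove, Fin.lt_def, Fin.val_castSucc, Fin.val_succ]
    split_ifs <;> simp <;> omega

end CategoryTheory.SimplicialObject.Homotopy

/-! ### From chain homotopies to simplicial homotopies -/

namespace DoldPuppe

open Simplicial DoldKan SimplexCategory

section

variable {C : Type u} [Category.{v} C] [Preadditive C] [HasFiniteCoproducts C]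
  (K L : ChainComplex C ℕ)

/-- The inclusion of the summand of `Γ₀ K` in degree `n` that belongs to `e`. -/
def ι {n p : ℕ} (e : ⦋n⦌ ⟶ ⦋p⦌) [Epi e] : K.X p ⟶ (Γ₀.obj K) _⦋n⦌ :=
  ((Γ₀.splitting K).cofan (op ⦋n⦌)).inj (SimplicialObject.Splitting.IndexSet.mk e)

variable {K L}

@[ext]
lemma gamma_hom_ext {n : ℕ} {Z : C} {f g : (Γ₀.obj K) _⦋n⦌ ⟶ Z}
    (h : ∀ (p : ℕ) (e : ⦋n⦌ ⟶ ⦋p⦌) [Epi e], ι K e ≫ f = ι K e ≫ g) : f = g := by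
  apply (Γ₀.splitting K).hom_ext'
  rintro ⟨⟨Δ⟩, e, he⟩
  exact @h Δ.len e he

/-- A morphism out of `Γ₀ K` in degree `n`, given on each summand. -/
def gammaDesc {n : ℕ} {Z : C} (φ : ∀ (p : ℕ) (e : ⦋n⦌ ⟶ ⦋p⦌) [Epi e], K.X p ⟶ Z) :
    (Γ₀.obj K) _⦋n⦌ ⟶ Z :=
  (Γ₀.splitting K).desc (op ⦋n⦌) fun A => φ A.1.unop.len A.e

lemma ι_gammaDesc {n p : ℕ} {Z : C} (φ : ∀ (p : ℕ) (e : ⦋n⦌ ⟶ ⦋p⦌) [Epi e], K.X p ⟶ Z)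
    (e : ⦋n⦌ ⟶ ⦋p⦌) [Epi e] : ι K e ≫ gammaDesc φ = φ p e :=
  (Γ₀.splitting K).ι_desc (op ⦋n⦌) _ (SimplicialObject.Splitting.IndexSet.mk e)

/-- The structure map of the chain complex `K` that belongs to a monomorphism. -/
abbrev monoMap (K : ChainComplex C ℕ) {p q : ℕ} (i : ⦋p⦌ ⟶ ⦋q⦌) [Mono i] : K.X q ⟶ K.X p :=
  Γ₀.Obj.Termwise.mapMono K i

/-- Any epi–mono factorization is allowed, not only the chosen image. The explicit factorizations
through `cone` and `coneZero` below rely on this. -/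
lemma ι_map {m n p q : ℕ} (θ : ⦋m⦌ ⟶ ⦋n⦌) (e : ⦋n⦌ ⟶ ⦋p⦌) [Epi e] (e' : ⦋m⦌ ⟶ ⦋q⦌) [Epi e']
    (i : ⦋q⦌ ⟶ ⦋p⦌) [Mono i] (fac : e' ≫ i = θ ≫ e) :
    ι K e ≫ (Γ₀.obj K).map θ.op = monoMap K i ≫ ι K e' :=
  @Γ₀.Obj.map_on_summand C _ _ K _ (op ⦋n⦌) (op ⦋m⦌) (SimplicialObject.Splitting.IndexSet.mk e)
    θ.op ⦋q⦌ e' i _ ‹Mono i› fac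

lemma ι_map_id {m n p : ℕ} (θ : ⦋m⦌ ⟶ ⦋n⦌) (e : ⦋n⦌ ⟶ ⦋p⦌) [Epi e] (e' : ⦋m⦌ ⟶ ⦋p⦌) [Epi e']
    (fac : e' = θ ≫ e) : ι K e ≫ (Γ₀.obj K).map θ.op = ι K e' := by
  rw [ι_map θ e e' (𝟙 _) (by rw [Category.comp_id, fac])]
  exact (congrArg (· ≫ ι K e') (Γ₀.Obj.Termwise.mapMono_id K _)).trans (Category.id_comp _)

lemma ι_gamma_map {n p : ℕ} (f : K ⟶ L) (e : ⦋n⦌ ⟶ ⦋p⦌) [Epi e] :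
    ι K e ≫ (Γ₀.map f).app (op ⦋n⦌) = f.f p ≫ ι L e :=
  (Γ₀.splitting K).ι_desc (op ⦋n⦌) _ (SimplicialObject.Splitting.IndexSet.mk e)

omit [HasFiniteCoproducts C] in
-- Apart from identities, only the face that omits the vertex `0` carries the differential. Maps
-- that fix `0`, cones among them, are therefore invisible unless they are identities.
lemma monoMap_eq_zero {p q : ℕ} (i : ⦋p⦌ ⟶ ⦋q⦌) [Mono i] (hpq : q ≠ p)
    (h₀ : i.toOrderHom 0 = 0) : monoMap K i = 0 :=
  Γ₀.Obj.Termwise.mapMono_eq_zero K i (fun h => hpq (congrArg SimplexCategory.len h))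
    fun h => h.2 h₀

omit [HasFiniteCoproducts C] in
lemma monoMap_eq_zero' {p q : ℕ} (i : ⦋p⦌ ⟶ ⦋q⦌) [Mono i] (hpq : q ≠ p) (hpq' : q ≠ p + 1) :
    monoMap K i = 0 :=
  Γ₀.Obj.Termwise.mapMono_eq_zero K i (fun h => hpq (congrArg SimplexCategory.len h))
    fun h => hpq' h.1

omit [HasFiniteCoproducts C] in
lemma monoMap_id {p : ℕ} (i : ⦋p⦌ ⟶ ⦋p⦌) [Mono i] : monoMap K i = 𝟙 _ := by
  obtain rfl := SimplexCategory.eq_id_of_mono i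
  exact Γ₀.Obj.Termwise.mapMono_id K _

omit [HasFiniteCoproducts C] in
lemma monoMap_d {p q : ℕ} (i : ⦋p⦌ ⟶ ⦋q⦌) [Mono i] (hpq : q = p + 1) (h₀ : i.toOrderHom 0 ≠ 0) :
    monoMap K i = K.d q p :=
  Γ₀.Obj.Termwise.mapMono_δ₀' K i ⟨hpq, h₀⟩

lemma exists_fac {m p : ℕ} (θ : ⦋m⦌ ⟶ ⦋p⦌) :
    ∃ (q : ℕ) (e : ⦋m⦌ ⟶ ⦋q⦌) (i : ⦋q⦌ ⟶ ⦋p⦌), Epi e ∧ Mono i ∧ e ≫ i = θ :=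
  ⟨(image θ).len, factorThruImage θ, image.ι θ, inferInstance, inferInstance, image.fac θ⟩

/-- The extra degeneracy in degree `n` that is given by a family of maps of degree one. -/
def extraDegeneracy (h : ∀ i j, K.X i ⟶ L.X j) (n : ℕ) :
    (Γ₀.obj K) _⦋n⦌ ⟶ (Γ₀.obj L) _⦋n + 1⦌ :=
  gammaDesc fun p e _ =>
    have : Epi (SimplexCategory.σ (0 : Fin (n + 1)) ≫ e) := epi_comp _ _
    -- Restricted along `δ 0`, the first term becomes `h` followed by the differential of `L`, and
    -- the second becomes the differential of `K` followed by `h`. Their sum is the right-hand side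
    -- of the homotopy relation.
    h p (p + 1) ≫ ι L (cone e) + dNext p h ≫ ι L (SimplexCategory.σ 0 ≫ e)

instance epi_σ_zero_comp {n p : ℕ} (e : ⦋n⦌ ⟶ ⦋p⦌) [Epi e] :
    Epi (SimplexCategory.σ (0 : Fin (n + 1)) ≫ e) := epi_comp _ _

lemma ι_extraDegeneracy (h : ∀ i j, K.X i ⟶ L.X j) {n p : ℕ} (e : ⦋n⦌ ⟶ ⦋p⦌) [Epi e] :
    ι K e ≫ extraDegeneracy h n =
      h p (p + 1) ≫ ι L (cone e) + dNext p h ≫ ι L (SimplexCategory.σ 0 ≫ e) :=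
  ι_gammaDesc _ e

/-- Together the extra degeneracies form a simplicial map from `Γ₀ K` to the décalage of `Γ₀ L`. On
the summand of `e`, factor `θ ≫ e` as `e' ≫ i`: what happens depends on whether `i` fixes the vertex
`0`. The family `h` need not satisfy any homotopy relation here; only `d ≫ d = 0` in `K` enters. -/
lemma extraDegeneracy_naturality (h : ∀ i j, K.X i ⟶ L.X j) {m n : ℕ} (θ : ⦋m⦌ ⟶ ⦋n⦌) :
    extraDegeneracy h n ≫ (Γ₀.obj L).map (cone θ).op =
      (Γ₀.obj K).map θ.op ≫ extraDegeneracy h m := by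
  apply gamma_hom_ext
  intro p e he
  obtain ⟨q, e', i, he', hi, fac⟩ := exists_fac (θ ≫ e)
  rw [reassoc_of% @ι_extraDegeneracy, Preadditive.add_comp, Category.assoc, Category.assoc,
    reassoc_of% (ι_map (K := K) θ e e' i fac), ι_extraDegeneracy,
    ι_map (cone θ) (cone e) (cone e') (cone i) (by rw [← cone_comp, fac, cone_comp])]
  have hcone : q ≠ p → monoMap L (cone i) = 0 := fun hqp =>
    monoMap_eq_zero _ (by omega) (cone_zero i)
  by_cases h₀ : i.toOrderHom 0 = 0
  · rw [ι_map (cone θ) (SimplexCategory.σ 0 ≫ e) (SimplexCategory.σ 0 ≫ e') i]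
    · by_cases hqp : q = p
      · subst hqp
        rw [monoMap_id, monoMap_id, monoMap_id]
        simp
      · rw [monoMap_eq_zero i (Ne.symm hqp) h₀, monoMap_eq_zero i (Ne.symm hqp) h₀, hcone hqp]
        simp
    · rw [Category.assoc, fac]
      apply hom_ext_cases
      · change e.toOrderHom (θ.toOrderHom 0) = e.toOrderHom 0
        have h1 : i.toOrderHom (e'.toOrderHom 0) = e.toOrderHom (θ.toOrderHom 0) :=
          congrArg (fun z => z.toOrderHom 0) fac
        rw [← h1, epi_apply_zero e', h₀, epi_apply_zero e]
      · intro j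
        change e.toOrderHom (θ.toOrderHom _) = e.toOrderHom ((SimplexCategory.σ 0).toOrderHom _)
        rw [σ_zero_succ, cone_succ]
        exact congrArg (fun z => e.toOrderHom (θ.toOrderHom z)) (σ_zero_succ j)
  · have hqp : q ≠ p := by
      rintro rfl
      obtain rfl := SimplexCategory.eq_id_of_mono i
      exact h₀ rfl
    -- Now the second term on the left is carried by the factorization of `cone θ ≫ σ 0 ≫ e` through
    -- `cone e'`. For `p = q + 1` it equals `d ≫ h` on that summand, matching the first term on the
    -- right; the second term on the right contains `d ≫ d`. For other `p` both sides vanish.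
    have := mono_coneZero i h₀
    rw [hcone hqp, ι_map (cone θ) (SimplexCategory.σ 0 ≫ e) (cone e') (coneZero i)]
    · by_cases hqp' : p = q + 1
      · subst hqp'
        rw [monoMap_id, monoMap_d i rfl h₀, dNext_eq h (i' := q) rfl]
        have : K.d (q + 1) q ≫ dNext q h = 0 := by
          cases q with
          | zero => rw [Homotopy.dNext_zero_chainComplex, comp_zero]
          | succ q => rw [Homotopy.dNext_succ_chainComplex, K.d_comp_d_assoc, zero_comp]
        rw [Preadditive.comp_add, reassoc_of% this]
        simp
      · rw [monoMap_eq_zero' i hqp.symm hqp', monoMap_eq_zero _ hqp' (coneZero_zero i)]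
        simp
    · apply hom_ext_cases
      · change 0 = e.toOrderHom 0
        rw [epi_apply_zero]
      · intro j
        change (coneZero i).toOrderHom (e'.toOrderHom j).succ =
          e.toOrderHom ((SimplexCategory.σ 0).toOrderHom _)
        rw [cone_succ, coneZero_succ, σ_zero_succ]
        exact congrArg (fun z => z.toOrderHom j) fac

/-- `Γ₀` sends chain homotopic maps to simplicially homotopic ones. -/
def gammaHomotopy {f g : K ⟶ L} (h : Homotopy f g) :
    SimplicialObject.Homotopy (Γ₀.map g) (Γ₀.map f) :=
  .ofInterval
    -- Over the constant simplex `0` the map `coneSection α` is constant with value the new vertex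
    -- and the correction dies, leaving `g`. Over the constant simplex `1` it is `δ 0`, and the
    -- correction is `f - g`.
    (fun n α => (Γ₀.map g).app _ + extraDegeneracy h.hom n ≫ (Γ₀.obj L).map (coneSection α).op)
    (fun {m n} θ α => by
      rw [Preadditive.add_comp, Preadditive.comp_add, Category.assoc, ← Functor.map_comp,
        ← op_comp, ← coneSection_comp, op_comp, Functor.map_comp,
        ← Category.assoc, extraDegeneracy_naturality, Category.assoc]
      congr 1
      exact ((Γ₀.map g).naturality θ.op).symm)
    (fun n α hα => by
      rw [add_eq_left]
      apply gamma_hom_ext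
      intro p e he
      have hc : ∀ j, (coneSection α).toOrderHom j = 0 := fun j => if_pos (hα j)
      have hv : ∀ {q : ℕ} (φ : ⦋n + 1⦌ ⟶ ⦋q⦌) [Epi φ],
          SimplexCategory.const ⦋n⦌ ⦋0⦌ 0 ≫ SimplexCategory.const ⦋0⦌ ⦋q⦌ 0 =
            coneSection α ≫ φ := by
        intro q φ _
        apply hom_ext_apply
        intro j
        change 0 = φ.toOrderHom ((coneSection α).toOrderHom j)
        rw [hc, epi_apply_zero]
      have : Epi (SimplexCategory.const ⦋n⦌ ⦋0⦌ 0) :=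
        SimplexCategory.epi_iff_surjective.2 fun j => ⟨0, Subsingleton.elim (α := Fin 1) _ _⟩
      have : ∀ q, Mono (SimplexCategory.const ⦋0⦌ ⦋q⦌ 0) := fun q =>
        SimplexCategory.mono_iff_injective.2 fun j j' _ => Subsingleton.elim (α := Fin 1) _ _
      rw [reassoc_of% @ι_extraDegeneracy, Preadditive.add_comp, Category.assoc, Category.assoc,
        ι_map _ _ _ _ (hv _), ι_map _ _ _ _ (hv _),
        monoMap_eq_zero (SimplexCategory.const ⦋0⦌ ⦋p + 1⦌ 0) (by omega) rfl]
      cases p with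
      | zero => rw [Homotopy.dNext_zero_chainComplex]; simp
      | succ p =>
        rw [monoMap_eq_zero (SimplexCategory.const ⦋0⦌ ⦋p + 1⦌ 0) (by omega) rfl]; simp)
    (fun n α hα => by
      apply gamma_hom_ext
      intro p e he
      have hc : coneSection α = SimplexCategory.δ 0 := hom_ext_apply fun j =>
        (if_neg (by rw [hα]; exact one_ne_zero)).trans (δ_zero_apply j).symm
      rw [Preadditive.comp_add, reassoc_of% @ι_extraDegeneracy, Preadditive.add_comp, Category.assoc,
        Category.assoc, ι_gamma_map, ι_gamma_map, hc,
        ι_map (SimplexCategory.δ 0) (cone e) e (SimplexCategory.δ 0) (δ_zero_cone e).symm,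
        ι_map_id (SimplexCategory.δ 0) (SimplexCategory.σ 0 ≫ e) e
          (((Category.assoc _ _ _).symm.trans (congrArg (· ≫ e)
            (SimplexCategory.δ_comp_σ_self (i := 0)))).trans (Category.id_comp e)).symm,
        monoMap_d (SimplexCategory.δ 0) rfl (by rw [δ_zero_apply]; exact Fin.succ_ne_zero _), h.comm p, Homotopy.prevD_chainComplex]
      simp only [Preadditive.add_comp, Category.assoc]
      abel)

end

section

variable {C : Type u} [Category.{v} C] [Preadditive C] [HasFiniteCoproducts C]
  {D : Type*} [Category* D] [Preadditive D] {K L : ChainComplex C ℕ}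

/-- The unnormalized complex of the simplicial object obtained from `Γ₀ K` by applying `F`. -/
def unnormalized (F : C ⥤ D) : ChainComplex C ℕ ⥤ ChainComplex D ℕ :=
  Γ₀ ⋙ (SimplicialObject.whiskering C D).obj F ⋙ alternatingFaceMapComplex D

/-- The unnormalized Dold–Puppe extension preserves chain homotopies. -/
def unnormalizedHomotopy (F : C ⥤ D) {f g : K ⟶ L} (h : Homotopy f g) :
    Homotopy ((unnormalized F).map f) ((unnormalized F).map g) :=
  -- A simplicial homotopy consists of maps and composition identities only, so it survives a
  -- functor that is not additive.
  ((gammaHomotopy h).whiskerRight F).toChainHomotopy.symm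

/-- The unnormalized Dold–Puppe extension preserves homotopy equivalences. -/
def unnormalizedHomotopyEquiv (F : C ⥤ D) (e : HomotopyEquiv K L) :
    HomotopyEquiv ((unnormalized F).obj K) ((unnormalized F).obj L) where
  hom := (unnormalized F).map e.hom
  inv := (unnormalized F).map e.inv
  homotopyHomInvId := ((Homotopy.ofEq ((unnormalized F).map_comp _ _).symm).trans
    (unnormalizedHomotopy F e.homotopyHomInvId)).trans (Homotopy.ofEq ((unnormalized F).map_id _))
  homotopyInvHomId := ((Homotopy.ofEq ((unnormalized F).map_comp _ _).symm).trans
    (unnormalizedHomotopy F e.homotopyInvHomId)).trans (Homotopy.ofEq ((unnormalized F).map_id _))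

end

end DoldPuppe

/-! ### Normalized versus unnormalized extension, and additive functors -/

namespace CategoryTheory

/-- A morphism between values of a retract of a functor is a retract. -/
def Retract.retractArrow {C D : Type*} [Category* C] [Category* D] {F G : C ⥤ D}
    (h : Retract F G) {X Y : C} (f : X ⟶ Y) : RetractArrow (F.map f) (G.map f) where
  i := Arrow.homMk (h.i.app X) (h.i.app Y) (h.i.naturality f).symm
  r := Arrow.homMk (h.r.app X) (h.r.app Y) (h.r.naturality f).symm
  retract := by
    ext
    · exact congrArg (fun z => z.app X) h.retract
    · exact congrArg (fun z => z.app Y) h.retract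

/-- The arrows that two isomorphic functors assign to a morphism are isomorphic. -/
def arrowIsoOfNatIso {C D : Type*} [Category* C] [Category* D] {F G : C ⥤ D}
    (e : F ≅ G) {X Y : C} (f : X ⟶ Y) : Arrow.mk (F.map f) ≅ Arrow.mk (G.map f) :=
  Arrow.isoMk (e.app X) (e.app Y) (e.hom.naturality f).symm

end CategoryTheory

namespace DoldPuppe

open Simplicial DoldKan

section

variable {C : Type u} [Category.{v} C] [Preadditive C] [HasFiniteCoproducts C]
  (K : ChainComplex C ℕ)

/-- The indexing set of the summands of `Γ₀ K` in degree `n`. -/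
abbrev Index (n : ℕ) : Type := SimplicialObject.Splitting.IndexSet (op ⦋n⦌)

/-- The degree of the summand of `Γ₀ K` that belongs to `A`. -/
def Index.deg {n : ℕ} (A : Index n) : ℕ := A.1.unop.len

/-- The surjection that belongs to the index `A`. -/
def Index.hom {n : ℕ} (A : Index n) : ⦋n⦌ ⟶ ⦋A.deg⦌ := A.e

/-- The inclusion of a summand of `Γ₀ K`. -/
def inj {n : ℕ} (A : Index n) : K.X A.deg ⟶ (Γ₀.obj K) _⦋n⦌ :=
  ((Γ₀.splitting K).cofan (op ⦋n⦌)).inj A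

variable {K}

lemma gamma_hom_ext' {n : ℕ} {Z : C} {f g : (Γ₀.obj K) _⦋n⦌ ⟶ Z}
    (h : ∀ A : Index n, inj K A ≫ f = inj K A ≫ g) : f = g :=
  (Γ₀.splitting K).hom_ext' _ _ h

/-- A morphism out of `Γ₀ K` in degree `n`, given on each summand. -/
def gammaDesc' {n : ℕ} {Z : C} (φ : ∀ A : Index n, K.X A.deg ⟶ Z) : (Γ₀.obj K) _⦋n⦌ ⟶ Z :=
  (Γ₀.splitting K).desc (op ⦋n⦌) φ

lemma inj_gammaDesc' {n : ℕ} {Z : C} (φ : ∀ A : Index n, K.X A.deg ⟶ Z) (A : Index n) :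
    inj K A ≫ gammaDesc' φ = φ A :=
  (Γ₀.splitting K).ι_desc (op ⦋n⦌) _ A

lemma inj_gamma_map {L : ChainComplex C ℕ} {n : ℕ} (f : K ⟶ L) (A : Index n) :
    inj K A ≫ (Γ₀.map f).app (op ⦋n⦌) = f.f A.deg ≫ inj L A :=
  (Γ₀.splitting K).ι_desc (op ⦋n⦌) _ A

open Classical in
variable (K) in
/-- The projection onto a summand of `Γ₀ K`. -/
def π {n : ℕ} (A : Index n) : (Γ₀.obj K) _⦋n⦌ ⟶ K.X A.deg :=
  gammaDesc' fun B => if h : B = A then eqToHom (by rw [h]) else 0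

lemma inj_π_self {n : ℕ} (A : Index n) : inj K A ≫ π K A = 𝟙 _ := by
  rw [π, inj_gammaDesc', dif_pos rfl]
  rfl

lemma inj_π_ne {n : ℕ} {A B : Index n} (h : B ≠ A) : inj K B ≫ π K A = 0 := by
  rw [π, inj_gammaDesc', dif_neg h]

lemma gamma_map_π {L : ChainComplex C ℕ} {n : ℕ} (f : K ⟶ L) (A : Index n) :
    (Γ₀.map f).app (op ⦋n⦌) ≫ π L A = π K A ≫ f.f A.deg := by
  apply gamma_hom_ext'
  intro B
  rw [reassoc_of% @inj_gamma_map]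
  by_cases h : B = A
  · subst h
    rw [inj_π_self, reassoc_of% @inj_π_self, Category.comp_id]
  · rw [inj_π_ne h, reassoc_of% (inj_π_ne (K := K) h), comp_zero, zero_comp]

lemma sum_π_inj (n : ℕ) : ∑ A : Index n, π K A ≫ inj K A = 𝟙 ((Γ₀.obj K) _⦋n⦌) := by
  apply gamma_hom_ext'
  intro B
  rw [Preadditive.comp_sum, Finset.sum_eq_single B]
  · rw [reassoc_of% @inj_π_self, Category.comp_id]
  · intro A _ h
    rw [reassoc_of% (inj_π_ne (K := K) h.symm), zero_comp]
  · simp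

section additive

variable {D : Type*} [Category* D] [Preadditive D] [HasFiniteCoproducts D]
  (Φ : C ⥤ D) [Φ.Additive]

omit [HasFiniteCoproducts C] [HasFiniteCoproducts D] in
lemma map_monoMap {Δ Δ' : SimplexCategory} (i : Δ' ⟶ Δ) [Mono i] :
    Γ₀.Obj.Termwise.mapMono ((Φ.mapHomologicalComplex _).obj K) i =
      Φ.map (Γ₀.Obj.Termwise.mapMono K i) := by
  unfold Γ₀.Obj.Termwise.mapMono
  split_ifs
  · subst_vars
    exact (Φ.map_id _).symm
  · rfl
  · exact (Φ.map_zero _ _).symm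

variable (K)

/-- The inclusion of a summand of `Γ₀` of the image of `K` under an additive functor. -/
def injMap {n : ℕ} (A : Index n) :
    Φ.obj (K.X A.deg) ⟶ (Γ₀.obj ((Φ.mapHomologicalComplex _).obj K)) _⦋n⦌ :=
  inj ((Φ.mapHomologicalComplex _).obj K) A

/-- The canonical map from `Γ₀ (Φ K)` to `Φ (Γ₀ K)`. -/
def gammaMapHom (n : ℕ) :
    (Γ₀.obj ((Φ.mapHomologicalComplex _).obj K)) _⦋n⦌ ⟶ Φ.obj ((Γ₀.obj K) _⦋n⦌) :=
  gammaDesc' fun A => Φ.map (inj K A)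

lemma injMap_gammaMapHom {n : ℕ} (A : Index n) :
    injMap K Φ A ≫ gammaMapHom K Φ n = Φ.map (inj K A) :=
  inj_gammaDesc' _ A

/-- `Γ₀` commutes with additive functors, in each simplicial degree. -/
def gammaMapIsoApp (n : ℕ) :
    (Γ₀.obj ((Φ.mapHomologicalComplex _).obj K)) _⦋n⦌ ≅ Φ.obj ((Γ₀.obj K) _⦋n⦌) where
  hom := gammaMapHom K Φ n
  inv := ∑ A : Index n, Φ.map (π K A) ≫ injMap K Φ A
  hom_inv_id := by
    apply gamma_hom_ext'
    intro B
    change injMap K Φ B ≫ _ = injMap K Φ B ≫ _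
    rw [reassoc_of% @injMap_gammaMapHom, Preadditive.comp_sum, Finset.sum_eq_single B]
    · rw [← Category.assoc, ← Φ.map_comp, inj_π_self, Φ.map_id, Category.comp_id,
        Category.id_comp]
    · intro A _ h
      rw [← Category.assoc, ← Φ.map_comp, inj_π_ne h.symm, Φ.map_zero, zero_comp]
    · simp
  inv_hom_id := by
    rw [Preadditive.sum_comp, ← Φ.map_id, ← sum_π_inj, Φ.map_sum]
    refine Finset.sum_congr rfl fun A _ => ?_
    rw [Category.assoc, Φ.map_comp, injMap_gammaMapHom]

lemma inj_gammaMapIsoApp_hom {n : ℕ} (A : Index n) :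
    inj ((Φ.mapHomologicalComplex _).obj K) A ≫ (gammaMapIsoApp K Φ n).hom =
      Φ.map (inj K A) :=
  inj_gammaDesc' _ A

/-- `Γ₀` commutes with additive functors. -/
def gammaMapIso :
    Φ.mapHomologicalComplex (ComplexShape.down ℕ) ⋙ Γ₀ ≅
      Γ₀ ⋙ (SimplicialObject.whiskering C D).obj Φ :=
  NatIso.ofComponents
    (fun K => NatIso.ofComponents (fun Δ => gammaMapIsoApp K Φ Δ.unop.len) (by
      intro Δ Δ' θ
      apply (Γ₀.splitting ((Φ.mapHomologicalComplex _).obj K)).hom_ext'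
      intro A
      refine (Γ₀.Obj.map_on_summand'_assoc _ A θ _).trans ?_
      refine (Category.assoc _ _ _).trans ?_
      refine (congrArg (CategoryStruct.comp _)
        (inj_gammaMapIsoApp_hom K Φ (n := Δ'.unop.len) (A.pull θ))).trans ?_
      refine Eq.trans ?_ ((reassoc_of% (inj_gammaMapIsoApp_hom K Φ (n := Δ.unop.len) A)) _).symm
      rw [map_monoMap]
      refine (Φ.map_comp _ _).symm.trans (Eq.trans ?_ (Φ.map_comp _ _))
      exact congrArg (fun z => Φ.map z) (Γ₀.Obj.map_on_summand' K A θ).symm))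
    (by
      intro K L f
      apply NatTrans.ext
      funext Δ
      apply gamma_hom_ext' (n := Δ.unop.len)
      intro A
      refine ((reassoc_of% (inj_gamma_map ((Φ.mapHomologicalComplex _).map f) A)) _).trans ?_
      refine (congrArg (CategoryStruct.comp _)
        (inj_gammaMapIsoApp_hom L Φ (n := Δ.unop.len) A)).trans ?_
      refine Eq.trans ?_ ((reassoc_of% (inj_gammaMapIsoApp_hom K Φ (n := Δ.unop.len) A)) _).symm
      refine (Φ.map_comp _ _).symm.trans (Eq.trans ?_ (Φ.map_comp _ _))
      exact congrArg (fun z => Φ.map z) (inj_gamma_map f A).symm)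

variable {E : Type*} [Category* E] [Preadditive E]

/-- Precomposing with an additive functor commutes with the unnormalized Dold–Puppe extension. -/
def unnormalizedPrecompIso (F : D ⥤ E) :
    unnormalized (Φ ⋙ F) ≅ Φ.mapHomologicalComplex (ComplexShape.down ℕ) ⋙ unnormalized F :=
  (Functor.isoWhiskerRight (gammaMapIso Φ)
    ((SimplicialObject.whiskering D E).obj F ⋙ alternatingFaceMapComplex E)).symm

end additive

section

variable {D E : Type*} [Category* D] [Preadditive D] [Category* E] [Preadditive E]

/-- Composing with an additive functor commutes with the unnormalized Dold–Puppe extension. -/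
def unnormalizedCompIso (F : C ⥤ D) (G : D ⥤ E) [G.Additive] :
    unnormalized (F ⋙ G) ≅ unnormalized F ⋙ G.mapHomologicalComplex (ComplexShape.down ℕ) :=
  Functor.isoWhiskerLeft (Γ₀ ⋙ (SimplicialObject.whiskering C D).obj F)
    (eqToIso (map_alternatingFaceMapComplex G).symm)

/-- The functoriality of the unnormalized Dold–Puppe extension in the functor. -/
def unnormalizedMap {F G : C ⥤ D} (τ : F ⟶ G) : unnormalized F ⟶ unnormalized G :=
  Functor.whiskerLeft Γ₀ (Functor.whiskerRight ((SimplicialObject.whiskering C D).map τ)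
    (alternatingFaceMapComplex D))

/-- The unnormalized Dold–Puppe extension of a retract. -/
def unnormalizedRetract {F G : C ⥤ D} (h : Retract F G) :
    Retract (unnormalized F) (unnormalized G) where
  i := unnormalizedMap h.i
  r := unnormalizedMap h.r
  retract := by
    ext K n
    exact congrArg (fun z => z.app ((Γ₀.obj K) _⦋n⦌)) h.retract

end

variable [IsIdempotentComplete C]

/-- The normalized Dold–Puppe extension is a retract of the unnormalized one. -/
def functorRetract (F : C ⥤ C) : Retract (functor F) (unnormalized F) where
  i :=
    { app := fun K => (((Idempotents.toKaroubiEquivalence (ChainComplex C ℕ)).counitIso.hom.app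
        (DoldKan.N₁.obj (gammaF F K))).f)
      naturality := fun K L f => by
        ext n
        refine (incl_naturality (((SimplicialObject.whiskering C C).obj F).map
          (Idempotents.DoldKan.Γ.map f)) n).trans ?_
        rw [← Category.assoc, incl_PInfty]
        rfl }
  r :=
    { app := fun K => (((Idempotents.toKaroubiEquivalence (ChainComplex C ℕ)).counitIso.inv.app
        (DoldKan.N₁.obj (gammaF F K))).f)
      naturality := fun K L f => by
        ext n
        -- The naturality available from the Karoubi envelope carries an extra `PInfty`, the
        -- identity of the object there. It commutes with simplicial maps and is absorbed by the
        -- projection.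
        have h := congrArg (fun z => HomologicalComplex.Hom.f (Idempotents.Karoubi.Hom.f z) n)
          ((Idempotents.toKaroubiEquivalence (ChainComplex C ℕ)).counitIso.inv.naturality
            (DoldKan.N₁.map (((SimplicialObject.whiskering C C).obj F).map
              (Idempotents.DoldKan.Γ.map f))))
        refine Eq.trans ?_ h
        change (((SimplicialObject.whiskering C C).obj F).map
              (Idempotents.DoldKan.Γ.map f)).app (op ⦋n⦌) ≫ proj (gammaF F L) n =
          ((DoldKan.PInfty (X := gammaF F K)).f n ≫ (((SimplicialObject.whiskering C C).obj F).map
              (Idempotents.DoldKan.Γ.map f)).app (op ⦋n⦌)) ≫ proj (gammaF F L) n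
        have h' := DoldKan.PInfty_f_naturality n (((SimplicialObject.whiskering C C).obj F).map
              (Idempotents.DoldKan.Γ.map f))
        refine Eq.trans ?_ (congrArg (· ≫ proj (gammaF F L) n) h')
        rw [Category.assoc]
        exact congrArg (CategoryStruct.comp _) (PInfty_proj (gammaF F L) n).symm }
  retract := by
    ext K n
    exact incl_proj (gammaF F K) n

end

/-! ### Polynomial degree and boundedness -/

section degree

variable {C : Type u} [Category.{v} C] [Preadditive C] {D : Type*} [Category* D] [Preadditive D]

/-- A functor has degree at most `k` if its deviations on `k + 1` morphisms vanish. -/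
def HasDegreeLE (F : C ⥤ D) (k : ℕ) : Prop :=
  ∀ {A B : C} (f : Fin (k + 1) → (A ⟶ B)),
    ∑ T : Finset (Fin (k + 1)), (-1 : ℤ) ^ T.card • F.map (∑ j ∈ T, f j) = 0

lemma HasDegreeLE.comp {F : C ⥤ D} {k : ℕ} (h : HasDegreeLE F k) {E : Type*} [Category* E]
    [Preadditive E] (G : D ⥤ E) [G.Additive] : HasDegreeLE (F ⋙ G) k := fun f => by
  have := congrArg G.map (h f)
  simpa [Functor.map_sum, Functor.map_zsmul] using this

lemma HasDegreeLE.precomp {F : C ⥤ D} {k : ℕ} (h : HasDegreeLE F k) {E : Type*} [Category* E]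
    [Preadditive E] (G : E ⥤ C) [G.Additive] : HasDegreeLE (G ⋙ F) k := fun f => by
  have := h (fun j => G.map (f j))
  simp only [← Functor.map_sum] at this
  exact this

lemma HasDegreeLE.retract {F G : C ⥤ D} {k : ℕ} (h : HasDegreeLE F k) (r : Retract G F) :
    HasDegreeLE G k := fun {A B} f => by
  have e : ∀ φ : A ⟶ B, G.map φ = r.i.app A ≫ F.map φ ≫ r.r.app B := fun φ => by
    rw [r.r.naturality, ← Category.assoc, ← NatTrans.comp_app, r.retract]
    exact (Category.id_comp _).symm
  have := congrArg (fun z => r.i.app A ≫ z ≫ r.r.app B) (h f)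
  simp only [Preadditive.comp_sum, Preadditive.sum_comp, Preadditive.comp_zsmul,
    Preadditive.zsmul_comp, zero_comp, comp_zero] at this
  simp only [e]
  exact this

/-- Induction on the size of `J`. If `J` has more than `k` elements, split it into `k + 1` nonempty
blocks; the vanishing deviation of the block sums expresses the value at the full sum by values at
sums over proper subsets. -/
lemma HasDegreeLE.mem_closure {F : C ⥤ D} {k : ℕ} (h : HasDegreeLE F k) {ι : Type*}
    {A B : C} (f : ι → (A ⟶ B)) (J : Finset ι) :
    F.map (∑ j ∈ J, f j) ∈ AddSubgroup.closure
      {x | ∃ T ⊆ J, T.card ≤ k ∧ x = F.map (∑ j ∈ T, f j)} := by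
  classical
  induction J using Finset.strongInduction with
  | H J ih =>
  by_cases hJ : J.card ≤ k
  · exact AddSubgroup.subset_closure ⟨J, subset_rfl, hJ, rfl⟩
  · obtain ⟨σ⟩ : Nonempty (Fin (k + 1) ↪ J) :=
      Function.Embedding.nonempty_of_card_le (by simp; omega)
    -- The blocks are the fibres of `c` on `J`. The embedding `σ` guarantees that each colour
    -- occurs; which colour the remaining elements receive is irrelevant.
    let c : ι → Fin (k + 1) := fun j => if hj : j ∈ J then Function.invFun σ ⟨j, hj⟩ else 0
    have hc : ∀ i, c (σ i) = i := fun i => by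
      simp only [c, dif_pos (σ i).2]
      exact Function.leftInverse_invFun σ.injective i
    have hs : ∀ T : Finset (Fin (k + 1)), ∑ i ∈ T, ∑ j ∈ J with c j = i, f j =
        ∑ j ∈ J with c j ∈ T, f j := fun T => by
      rw [← Finset.sum_fiberwise_of_maps_to (s := J.filter fun j => c j ∈ T) (t := T) (g := c)
        (fun j hj => (Finset.mem_filter.1 hj).2)]
      refine Finset.sum_congr rfl fun i hi => Finset.sum_congr ?_ fun _ _ => rfl
      ext j
      simp only [Finset.mem_filter]
      constructor
      · rintro ⟨h1, h2⟩
        exact ⟨⟨h1, h2 ▸ hi⟩, h2⟩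
      · rintro ⟨⟨h1, _⟩, h2⟩
        exact ⟨h1, h2⟩
    have h0 := h fun i => ∑ j ∈ J with c j = i, f j
    simp only [hs] at h0
    rw [← Finset.add_sum_erase _ _ (Finset.mem_univ Finset.univ)] at h0
    have hu : (J.filter fun j => c j ∈ (Finset.univ : Finset (Fin (k + 1)))) = J := by simp
    rw [hu] at h0
    have h1 : (-1 : ℤ) ^ (Finset.univ : Finset (Fin (k + 1))).card • F.map (∑ j ∈ J, f j) ∈
        AddSubgroup.closure {x | ∃ T ⊆ J, T.card ≤ k ∧ x = F.map (∑ j ∈ T, f j)} := by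
      rw [eq_neg_of_add_eq_zero_left h0]
      refine neg_mem (sum_mem fun T hT => zsmul_mem ?_ _)
      have hsub : (J.filter fun j => c j ∈ T) ⊂ J := by
        refine (Finset.filter_subset _ _).ssubset_of_ne fun heq => ?_
        refine (Finset.mem_erase.1 hT).1 (Finset.eq_univ_of_forall fun i => ?_)
        have hi : (σ i : ι) ∈ J.filter fun j => c j ∈ T := by
          rw [heq]
          exact (σ i).2
        have := (Finset.mem_filter.1 hi).2
        rwa [hc] at this
      refine AddSubgroup.closure_mono ?_ (ih _ hsub)
      rintro x ⟨T', hT', hT'', rfl⟩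
      exact ⟨T', hT'.trans hsub.subset, hT'', rfl⟩
    -- Multiplying by the sign once more removes it.
    have h2 := zsmul_mem h1 ((-1 : ℤ) ^ (Finset.univ : Finset (Fin (k + 1))).card)
    rw [← mul_smul, ← mul_pow] at h2
    simpa using h2

/-- A jump of a monotone map is determined by the value right after it. The bound is not sharp, but
for `p < N` it gives at most `N` jumps, which is all that is needed. -/
lemma card_strict_le {n p : ℕ} (e : ⦋n + 1⦌ ⟶ ⦋p⦌) :
    (Finset.univ.filter fun j : Fin (n + 1) =>
      e.toOrderHom j.castSucc ≠ e.toOrderHom j.succ).card ≤ p + 1 := by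
  have h := Finset.card_le_card_of_injOn (t := (Finset.univ : Finset (Fin (p + 1))))
    (s := Finset.univ.filter fun j : Fin (n + 1) =>
      e.toOrderHom j.castSucc ≠ e.toOrderHom j.succ)
    (fun j => e.toOrderHom j.succ) (fun _ _ => Finset.mem_univ _) (by
      have key : ∀ i j : Fin (n + 1), e.toOrderHom j.castSucc ≠ e.toOrderHom j.succ → i < j →
          e.toOrderHom i.succ ≠ e.toOrderHom j.succ := fun i j hj hij heq => by
        have h1 : e.toOrderHom i.succ ≤ e.toOrderHom j.castSucc := e.toOrderHom.monotone hij
        have h2 : e.toOrderHom j.castSucc ≤ e.toOrderHom j.succ :=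
          e.toOrderHom.monotone (Fin.castSucc_le_succ j)
        exact hj (le_antisymm h2 (heq ▸ h1))
      intro i hi j hj heq
      rcases lt_trichotomy i j with h | h | h
      · exact absurd heq (key i j (Finset.mem_filter.1 hj).2 h)
      · exact h
      · exact absurd heq.symm (key j i (Finset.mem_filter.1 hi).2 h))
  simpa using h

/-- The identity of `Γ₀ K` in one degree is the sum of the projectors onto its summands. By the
degree bound it suffices that `F` of a sum of at most `k` projectors is killed by normalization, and
such a sum factors through a single degeneracy. -/
lemma isZero_functor_X [HasFiniteCoproducts C] [IsIdempotentComplete C] {F : C ⥤ C} {k : ℕ}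
    (h : HasDegreeLE F k) (K : ChainComplex C ℕ) {N : ℕ} (hK : ∀ n, N ≤ n → IsZero (K.X n))
    {n : ℕ} (hn : k * N < n) : IsZero (((functor F).obj K).X n) := by
  classical
  obtain _ | n := n
  · omega
  suffices hp : proj (gammaF F K) (n + 1) = 0 by
    rw [IsZero.iff_id_eq_zero]
    refine (incl_proj (gammaF F K) (n + 1)).symm.trans ?_
    exact (congrArg _ hp).trans comp_zero
  let φ : (F.obj ((Γ₀.obj K) _⦋n + 1⦌) ⟶ F.obj ((Γ₀.obj K) _⦋n + 1⦌)) →+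
      (F.obj ((Γ₀.obj K) _⦋n + 1⦌) ⟶ (Idempotents.DoldKan.N.obj (gammaF F K)).X (n + 1)) :=
    Preadditive.rightComp _ (proj (gammaF F K) (n + 1))
  have hle : AddSubgroup.closure {x | ∃ T ⊆ (Finset.univ : Finset (Index (n + 1))), T.card ≤ k ∧
      x = F.map (∑ A ∈ T, π K A ≫ inj K A)} ≤ φ.ker := by
    rw [AddSubgroup.closure_le]
    rintro _ ⟨T, -, hT, rfl⟩
    change F.map _ ≫ proj (gammaF F K) (n + 1) = 0
    -- Pigeonhole: at most `k` surjections with at most `N` jumps each have at most `k * N` jumps,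
    -- fewer than the `n + 1` available positions. Some position `j` is a jump of none of them.
    -- Indices of degree at least `N` are left out because their summands are zero.
    obtain ⟨j, hj⟩ : ∃ j : Fin (n + 1), ∀ A ∈ T, A.deg < N →
        A.hom.toOrderHom j.castSucc = A.hom.toOrderHom j.succ := by
      by_contra! hcon
      have hcov : (Finset.univ : Finset (Fin (n + 1))) ⊆ (T.filter fun A => A.deg < N).biUnion
          fun A => Finset.univ.filter fun j : Fin (n + 1) =>
            A.hom.toOrderHom j.castSucc ≠ A.hom.toOrderHom j.succ := fun j _ => by
        obtain ⟨A, hA, hAN, hne⟩ := hcon j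
        exact Finset.mem_biUnion.2 ⟨A, Finset.mem_filter.2 ⟨hA, hAN⟩,
          Finset.mem_filter.2 ⟨Finset.mem_univ _, hne⟩⟩
      have h1 := (Finset.card_le_card hcov).trans (Finset.card_biUnion_le_card_mul _ _ N
        fun A hA => (card_strict_le A.hom).trans (Finset.mem_filter.1 hA).2)
      have h2 : (T.filter fun A => A.deg < N).card ≤ k :=
        (Finset.card_le_card (Finset.filter_subset _ _)).trans hT
      have h3 := Nat.mul_le_mul_right N h2
      simp only [Finset.card_univ, Fintype.card_fin] at h1
      omega
    have hfac : ∀ A ∈ T, ∃ g : (Γ₀.obj K) _⦋n + 1⦌ ⟶ (Γ₀.obj K) _⦋n⦌,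
        π K A ≫ inj K A = g ≫ (Γ₀.obj K).σ j := fun A hA => by
      by_cases hAN : A.deg < N
      · obtain ⟨θ, hθ⟩ := SimplexCategory.eq_σ_comp_of_not_injective' A.hom j (hj A hA hAN)
        refine ⟨π K A ≫ (Γ₀.splitting K).ι _ ≫ (Γ₀.obj K).map θ.op, ?_⟩
        have : inj K A = (Γ₀.splitting K).ι A.deg ≫ (Γ₀.obj K).map A.hom.op := rfl
        rw [this, hθ, op_comp, Functor.map_comp]
        exact (congrArg (π K A ≫ ·) (Category.assoc _ _ _).symm).trans
          (Category.assoc _ _ _).symm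
      · exact ⟨0, by rw [(hK _ (not_lt.1 hAN)).eq_of_tgt (π K A) 0, zero_comp, zero_comp]⟩
    have hsum : ∃ g : (Γ₀.obj K) _⦋n + 1⦌ ⟶ (Γ₀.obj K) _⦋n⦌,
        ∑ A ∈ T, π K A ≫ inj K A = g ≫ (Γ₀.obj K).σ j := by
      choose! g hg using hfac
      exact ⟨∑ A ∈ T, g A, by rw [Preadditive.sum_comp]; exact Finset.sum_congr rfl hg⟩
    obtain ⟨g, hg⟩ := hsum
    have h1 : (gammaF F K).σ j ≫ proj (gammaF F K) (n + 1) = 0 := by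
      rw [← PInfty_proj, ← Category.assoc]
      refine (congrArg (· ≫ _) (σ_comp_PInfty (gammaF F K) j)).trans zero_comp
    refine (congrArg (fun z => F.map z ≫ proj (gammaF F K) (n + 1)) hg).trans ?_
    refine (congrArg (· ≫ proj (gammaF F K) (n + 1)) (F.map_comp _ _)).trans ?_
    exact (Category.assoc _ _ _).trans ((congrArg (F.map g ≫ ·) h1).trans comp_zero)
  have h2 := hle (h.mem_closure (fun A : Index (n + 1) => π K A ≫ inj K A) Finset.univ)
  rw [sum_π_inj, F.map_id] at h2
  exact (Category.id_comp _).symm.trans h2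

end degree

end DoldPuppe

/-! ### Mapping cones in abelian categories -/

namespace ChainComplex

section cone

open HomologicalComplex HomologicalComplex.homotopyCofiber

section

variable {A : Type*} [Category* A] [Preadditive A] {K L : ChainComplex A ℕ} (f : K ⟶ L)
  [HasHomotopyCofiber f]

lemma comp_d_next_zero {K : ChainComplex A ℕ} {T : A} (x : T ⟶ K.X 0) :
    x ≫ K.d 0 ((ComplexShape.down ℕ).next 0) = 0 := by
  rw [K.shape _ _ (by simp), comp_zero]

/-- The first projection of the mapping cone. -/
def coneFst (n : ℕ) : (homotopyCofiber f).X (n + 1) ⟶ K.X n := fstX f (n + 1) n rfl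

/-- The second projection of the mapping cone. -/
def coneSnd (n : ℕ) : (homotopyCofiber f).X n ⟶ L.X n := sndX f n

/-- The first inclusion into the mapping cone. -/
def coneInl (n : ℕ) : K.X n ⟶ (homotopyCofiber f).X (n + 1) := inlX f n (n + 1) rfl

/-- The second inclusion into the mapping cone. -/
def coneInr (n : ℕ) : L.X n ⟶ (homotopyCofiber f).X n := inrX f n

@[simp]
lemma coneInl_coneFst (n : ℕ) : coneInl f n ≫ coneFst f n = 𝟙 _ := inlX_fstX f n (n + 1) rfl

@[simp]
lemma coneInl_coneSnd (n : ℕ) : coneInl f n ≫ coneSnd f (n + 1) = 0 := inlX_sndX f n (n + 1) rfl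

@[simp]
lemma coneInr_coneFst (n : ℕ) : coneInr f (n + 1) ≫ coneFst f n = 0 := inrX_fstX f (n + 1) n rfl

@[simp]
lemma coneInr_coneSnd (n : ℕ) : coneInr f n ≫ coneSnd f n = 𝟙 _ := inrX_sndX f n

lemma cone_hom_ext {n : ℕ} {T : A} {x y : T ⟶ (homotopyCofiber f).X (n + 1)}
    (h₁ : x ≫ coneFst f n = y ≫ coneFst f n)
    (h₂ : x ≫ coneSnd f (n + 1) = y ≫ coneSnd f (n + 1)) : x = y :=
  ext_to_X f (n + 1) n rfl h₁ h₂

lemma cone_hom_ext_zero {T : A} {x y : T ⟶ (homotopyCofiber f).X 0}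
    (h : x ≫ coneSnd f 0 = y ≫ coneSnd f 0) : x = y :=
  ext_to_X' f 0 (by simp) h

lemma comp_cone_d_fst {n : ℕ} {T : A} (x : T ⟶ (homotopyCofiber f).X (n + 1 + 1)) :
    (x ≫ (homotopyCofiber f).d (n + 1 + 1) (n + 1)) ≫ coneFst f n =
      -(x ≫ coneFst f (n + 1)) ≫ K.d (n + 1) n := by
  rw [Category.assoc, Category.assoc, ← Preadditive.comp_neg]
  exact congrArg (x ≫ ·) ((d_fstX f (n + 1 + 1) (n + 1) n rfl rfl))

lemma comp_cone_d_snd {n : ℕ} {T : A} (x : T ⟶ (homotopyCofiber f).X (n + 1)) :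
    (x ≫ (homotopyCofiber f).d (n + 1) n) ≫ coneSnd f n =
      (x ≫ coneFst f n) ≫ f.f n + (x ≫ coneSnd f (n + 1)) ≫ L.d (n + 1) n := by
  rw [Category.assoc, Category.assoc, Category.assoc, ← Preadditive.comp_add]
  exact congrArg (x ≫ ·) (d_sndX f (n + 1) n rfl)

lemma comp_cone_d_eq_zero_iff {n : ℕ} {T : A} (x : T ⟶ (homotopyCofiber f).X (n + 1)) :
    x ≫ (homotopyCofiber f).d (n + 1) n = 0 ↔
      (x ≫ coneFst f n) ≫ K.d n ((ComplexShape.down ℕ).next n) = 0 ∧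
      (x ≫ coneFst f n) ≫ f.f n + (x ≫ coneSnd f (n + 1)) ≫ L.d (n + 1) n = 0 := by
  rw [← comp_cone_d_snd]
  cases n with
  | zero =>
    refine ⟨fun h => ⟨comp_d_next_zero _, by rw [h, zero_comp]⟩, fun h => ?_⟩
    exact cone_hom_ext_zero f (h.2.trans zero_comp.symm)
  | succ n =>
    rw [ChainComplex.next_nat_succ, ← neg_eq_zero (a := (x ≫ _) ≫ _), ← comp_cone_d_fst]
    refine ⟨fun h => ⟨by rw [h, zero_comp], by rw [h, zero_comp]⟩, fun h => ?_⟩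
    exact cone_hom_ext f (h.1.trans zero_comp.symm) (h.2.trans zero_comp.symm)

/-- A morphism to the mapping cone, given by its two components. -/
def coneLift {n : ℕ} {T : A} (a : T ⟶ K.X n) (b : T ⟶ L.X (n + 1)) :
    T ⟶ (homotopyCofiber f).X (n + 1) :=
  a ≫ coneInl f n + b ≫ coneInr f (n + 1)

lemma coneLift_fst {n : ℕ} {T : A} (a : T ⟶ K.X n) (b : T ⟶ L.X (n + 1)) :
    coneLift f a b ≫ coneFst f n = a := by
  simp [coneLift]

lemma coneLift_snd {n : ℕ} {T : A} (a : T ⟶ K.X n) (b : T ⟶ L.X (n + 1)) :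
    coneLift f a b ≫ coneSnd f (n + 1) = b := by
  simp [coneLift]

@[simp]
lemma cone_total_zero : coneSnd f 0 ≫ coneInr f 0 = 𝟙 _ :=
  cone_hom_ext_zero f (by simp)

@[simp]
lemma cone_total_succ (n : ℕ) :
    coneFst f n ≫ coneInl f n + coneSnd f (n + 1) ≫ coneInr f (n + 1) = 𝟙 _ :=
  cone_hom_ext f (by simp) (by simp)

end

variable {A : Type*} [Category* A] [Abelian A] {K L : ChainComplex A ℕ} (f : K ⟶ L)

/-- Chase with generalized elements. For a cycle `(a, b)` of the cone, `a` is a cycle whose image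
bounds, so `a = d a₁` by injectivity on homology; then `b + f a₁` is a cycle, equal to `f a₂ + d b₂`
by surjectivity, and `(a₂ - a₁, b₂)` bounds `(a, b)`. In degree `0` the cone has only the component
from `L`, and surjectivity suffices. -/
lemma acyclic_homotopyCofiber_of_quasiIso [QuasiIso f] : (homotopyCofiber f).Acyclic := by
  have hm : ∀ n, Mono (homologyMap f n) := fun n => inferInstance
  have he : ∀ n, Epi (homologyMap f n) := fun n => inferInstance
  simp only [mono_homologyMap_iff_up_to_refinements f _ _ _ (ChainComplex.prev ℕ _) rfl] at hm
  simp only [epi_homologyMap_iff_up_to_refinements f _ _ _ (ChainComplex.prev ℕ _) rfl] at he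
  intro n
  rw [exactAt_iff_exact_up_to_refinements _ (n + 1) n _ (ChainComplex.prev ℕ _) rfl]
  intro T x hx
  cases n with
  | zero =>
    obtain ⟨T', π, hπ, a, -, b, h⟩ := he 0 (x ≫ coneSnd f 0) (comp_d_next_zero _)
    refine ⟨T', π, hπ, coneLift f a b, cone_hom_ext_zero f ?_⟩
    rw [comp_cone_d_snd, coneLift_fst, coneLift_snd, ← h, Category.assoc]
  | succ n =>
    have hx : x ≫ (homotopyCofiber f).d (n + 1) n = 0 := by
      rwa [ChainComplex.next_nat_succ] at hx
    rw [comp_cone_d_eq_zero_iff] at hx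
    obtain ⟨h₁, h₂⟩ := hx
    obtain ⟨T', π, hπ, a₁, ha₁⟩ := hm n (x ≫ coneFst f n) h₁
      (-(x ≫ coneSnd f (n + 1))) (by rw [Preadditive.neg_comp]; exact eq_neg_of_add_eq_zero_left h₂)
    obtain ⟨T'', π', hπ', a₂, ha₂, b₂, h⟩ := he (n + 1) (π ≫ x ≫ coneSnd f (n + 1) + a₁ ≫ f.f (n + 1))
      (by
        rw [ChainComplex.next_nat_succ, Preadditive.add_comp, Category.assoc a₁, f.comm,
          ← reassoc_of% ha₁]
        have := congrArg (π ≫ ·) h₂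
        simp only [Preadditive.comp_add, comp_zero, Category.assoc] at this
        rw [add_comm] at this
        simpa using this)
    rw [ChainComplex.next_nat_succ] at ha₂
    refine ⟨T'', π' ≫ π, epi_comp _ _, coneLift f (a₂ - π' ≫ a₁) b₂, cone_hom_ext f ?_ ?_⟩
    · rw [comp_cone_d_fst, coneLift_fst, Preadditive.sub_comp, ha₂,
        Category.assoc, Category.assoc, Category.assoc, ← ha₁]
      simp
    · rw [comp_cone_d_snd, coneLift_fst, coneLift_snd, Preadditive.sub_comp]
      simp only [Preadditive.comp_add, Category.assoc] at h ⊢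
      rw [eq_sub_iff_add_eq.2 h]
      abel

/-- If `f a = d y`, then `(a, -y)` is a cycle of the cone and a bounding chain shows that `a`
bounds. If `y` is a cycle of `L`, then so is `(0, y)`, and a bounding chain gives a cycle of `K`
that maps to the class of `y`. -/
lemma quasiIso_of_acyclic_homotopyCofiber (h : (homotopyCofiber f).Acyclic) : QuasiIso f := by
  have h' : ∀ n, _ := fun n => (exactAt_iff_exact_up_to_refinements _ (n + 1) n _
    (ChainComplex.prev ℕ _) rfl).1 (h n)
  rw [quasiIso_iff]
  intro n
  rw [quasiIsoAt_iff_isIso_homologyMap]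
  have : Mono (homologyMap f n) := by
    rw [mono_homologyMap_iff_up_to_refinements f _ _ _ (ChainComplex.prev ℕ _) rfl]
    intro T a ha y hy
    obtain ⟨T', π, hπ, x, hx⟩ := h' (n + 1) (coneLift f a (-y)) (by
      rw [ChainComplex.next_nat_succ, comp_cone_d_eq_zero_iff, coneLift_fst, coneLift_snd]
      exact ⟨ha, by rw [hy]; simp⟩)
    refine ⟨T', π, hπ, -(x ≫ coneFst f (n + 1)), ?_⟩
    rw [Preadditive.neg_comp, ← comp_cone_d_fst, ← hx, Category.assoc, coneLift_fst]
  have : Epi (homologyMap f n) := by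
    rw [epi_homologyMap_iff_up_to_refinements f _ _ _ (ChainComplex.prev ℕ _) rfl]
    intro T y hy
    obtain ⟨T', π, hπ, x, hx⟩ := h' n (y ≫ coneInr f n) (by
      refine (Category.assoc _ _ _).trans ((congrArg (y ≫ ·) (inrX_d f n _)).trans ?_)
      exact (Category.assoc _ _ _).symm.trans ((congrArg (· ≫ _) hy).trans zero_comp))
    refine ⟨T', π, hπ, x ≫ coneFst f n, ?_, x ≫ coneSnd f (n + 1), ?_⟩
    · cases n with
      | zero => exact comp_d_next_zero _
      | succ n =>
        rw [ChainComplex.next_nat_succ]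
        refine neg_eq_zero.1 ((comp_cone_d_fst f x).symm.trans ?_)
        rw [← hx]
        simp
    · rw [← comp_cone_d_snd, ← hx]
      simp
  exact isIso_of_mono_of_epi _

lemma acyclic_homotopyCofiber_iff : (homotopyCofiber f).Acyclic ↔ QuasiIso f :=
  ⟨quasiIso_of_acyclic_homotopyCofiber f, fun _ => acyclic_homotopyCofiber_of_quasiIso f⟩

end cone

end ChainComplex

namespace CategoryTheory.Functor

/-- The chain complex of values of an additive functor. -/
abbrev mapChain {C D : Type*} [Category* C] [Category* D] [Preadditive C] [Preadditive D]
    (Φ : C ⥤ D) [Φ.PreservesZeroMorphisms] : ChainComplex C ℕ ⥤ ChainComplex D ℕ :=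
  Φ.mapHomologicalComplex (ComplexShape.down ℕ)

end CategoryTheory.Functor

/-- A complex that is spliced together from sequences which an additive functor sends to short exact
ones is sent to an acyclic complex. -/
lemma acyclic_of_splice {C A : Type*} [Category* C] [Preadditive C] [Category* A] [Abelian A]
    (Φ : C ⥤ A) [Φ.Additive] {V : ChainComplex C ℕ} (Z : ℕ → C) (i : ∀ n, Z n ⟶ V.X n)
    (p : ∀ n, V.X (n + 1) ⟶ Z n) (w : ∀ n, i (n + 1) ≫ p n = 0) [IsIso (i 0)]
    (hd : ∀ n, p n ≫ i n = V.d (n + 1) n)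
    (h : ∀ n, ((ShortComplex.mk (i (n + 1)) (p n) (w n)).map Φ).ShortExact) :
    (Φ.mapChain.obj V).Acyclic := by
  have hm : ∀ n, Mono (Φ.map (i n)) := fun n => by
    cases n with
    | zero => infer_instance
    | succ n => exact (h n).mono_f
  have he : ∀ n, Epi (Φ.map (p n)) := fun n => (h n).epi_g
  have hd' : ∀ n, (Φ.mapChain.obj V).d (n + 1) n = Φ.map (p n) ≫ Φ.map (i n) := fun n => by
    rw [← Φ.map_comp, hd]
    rfl
  have hl : ∀ n {T : A} (x : T ⟶ Φ.obj (V.X n)),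
      x ≫ (Φ.mapChain.obj V).d n ((ComplexShape.down ℕ).next n) = 0 →
        ∃ l : T ⟶ Φ.obj (Z n), l ≫ Φ.map (i n) = x := by
    intro n T x hx
    cases n with
    | zero => exact ⟨x ≫ inv (Φ.map (i 0)), by simp⟩
    | succ n =>
      rw [ChainComplex.next_nat_succ, hd'] at hx
      have hx : x ≫ Φ.map (p n) = 0 :=
        (cancel_mono (Φ.map (i n))).1 ((Category.assoc _ _ _).trans (hx.trans zero_comp.symm))
      have := (h n).mono_f
      exact ⟨(h n).exact.lift x hx, (h n).exact.lift_f x hx⟩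
  intro n
  rw [HomologicalComplex.exactAt_iff_exact_up_to_refinements _ (n + 1) n _
    (ChainComplex.prev ℕ _) rfl]
  intro T x hx
  obtain ⟨l, hl⟩ := hl n x hx
  obtain ⟨T', π, hπ, y, hy⟩ := surjective_up_to_refinements_of_epi (Φ.map (p n)) l
  refine ⟨T', π, hπ, y, ?_⟩
  rw [hd']
  exact (congrArg (π ≫ ·) hl.symm).trans ((Category.assoc _ _ _).symm.trans
    ((congrArg (· ≫ Φ.map (i n)) hy).trans (Category.assoc _ _ _)))

/-- Additive functors commute with mapping cones. -/
lemma quasiIso_mapChain_iff {C A : Type*} [Category* C] [Preadditive C] [HasBinaryBiproducts C]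
    [Category* A] [Abelian A] (Φ : C ⥤ A) [Φ.Additive] {V W : ChainComplex C ℕ} (f : V ⟶ W) :
    QuasiIso (Φ.mapChain.map f) ↔
      (Φ.mapChain.obj (HomologicalComplex.homotopyCofiber f)).Acyclic := by
  rw [← ChainComplex.acyclic_homotopyCofiber_iff]
  let e := HomologicalComplex.homotopyCofiber.mapHomologicalComplexObjIso f Φ
  exact ⟨fun h n => (h n).of_iso e.symm, fun h n => (h n).of_iso e⟩

/-! ### Detecting acyclicity by functors to an abelian category -/

namespace ExactDatum

/-- A family of additive functors to an abelian category that detects the short exact sequences of an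
exact category, together with closure properties of its objects. -/
structure Evaluation (E : ExactDatum.{v, u}) (A : Type*) [Category* A] [Abelian A] where
  /-- the indices of the functors -/
  ι : Type
  /-- the functors -/
  ev : ι → E.C ⥤ A
  [additive : ∀ i, (ev i).Additive]
  conflation_iff : ∀ S : ShortComplex E.C, E.conflation S ↔ ∀ i, (S.map (ev i)).ShortExact
  -- The ambient category is merely additive and idempotent complete, so kernels are demanded only
  -- for morphisms that all evaluations make epi.
  exists_kernel : ∀ {P Q : E.C} (p : P ⟶ Q), (∀ i, Epi ((ev i).map p)) →
    ∃ (K : E.C) (k : K ⟶ P) (w : k ≫ p = 0), E.conflation (ShortComplex.mk k p w)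
  mono_f : ∀ S : ShortComplex E.C, E.conflation S → Mono S.f
  exists_lift : ∀ S : ShortComplex E.C, E.conflation S → ∀ {T : E.C} (t : T ⟶ S.X₂),
    t ≫ S.g = 0 → ∃ l : T ⟶ S.X₁, l ≫ S.f = t
  -- The relation makes `P` a retract of the finite sum of the `B j`. This single closure property
  -- serves for cones, for `Γ` and for normalized parts.
  mem_of_total : ∀ {J : Type} [Fintype J] {P : E.C} (B : J → E.C) (a : ∀ j, P ⟶ B j)
    (b : ∀ j, B j ⟶ P), ∑ j, a j ≫ b j = 𝟙 P → (∀ j, E.mem (B j)) → E.mem P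
  mem_ker : ∀ S : ShortComplex E.C, E.conflation S → E.mem S.X₂ → E.mem S.X₃ → E.mem S.X₁

attribute [instance] Evaluation.additive

namespace Evaluation

variable {E : ExactDatum.{v, u}} {A : Type*} [Category* A] [Abelian A] (ℰ : E.Evaluation A)

include ℰ in
lemma mem_of_retract {P Q : E.C} (r : Retract P Q) (hQ : E.mem Q) : E.mem P :=
  ℰ.mem_of_total (J := Unit) (fun _ => Q) (fun _ => r.i) (fun _ => r.r) (by simp) fun _ => hQ

lemma acyclic_of_isAcyclic {V : ChainComplex E.C ℕ} (h : E.IsAcyclic V) (j : ℰ.ι) :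
    ((ℰ.ev j).mapChain.obj V).Acyclic := by
  obtain ⟨Z, i, p, w, -, hi, hd, hS⟩ := h
  exact acyclic_of_splice (ℰ.ev j) Z i p w hd fun n => (ℰ.conflation_iff _).1 (hS n) j

/-- The cycles of degree `n` of a complex in an exact category, as a subobject that the evaluation
functors preserve. -/
structure Cycles (V : ChainComplex E.C ℕ) (n : ℕ) where
  /-- the object of cycles -/
  Z : E.C
  /-- the inclusion -/
  i : Z ⟶ V.X n
  mem : E.mem Z
  mono : Mono i
  w : i ≫ V.d n ((ComplexShape.down ℕ).next n) = 0
  lift : ∀ {T : E.C} (t : T ⟶ V.X n), t ≫ V.d n ((ComplexShape.down ℕ).next n) = 0 →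
    ∃ l : T ⟶ Z, l ≫ i = t
  mono_ev : ∀ j, Mono ((ℰ.ev j).map i)

/-- The differential lands in the cycles already found, and acyclicity of the evaluations makes the
lift epi after evaluation. Its kernel exists, belongs to `E`, and is the next object of cycles
because the inclusion of the old one is mono. -/
lemma Cycles.exists_succ {V : ChainComplex E.C ℕ} (hV : ∀ n, E.mem (V.X n))
    (h : ∀ j, ((ℰ.ev j).mapChain.obj V).Acyclic) {n : ℕ} (s : ℰ.Cycles V n) :
    ∃ (s' : ℰ.Cycles V (n + 1)) (p : V.X (n + 1) ⟶ s.Z) (w : s'.i ≫ p = 0),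
      p ≫ s.i = V.d (n + 1) n ∧ E.conflation (ShortComplex.mk s'.i p w) := by
  have := s.mono
  have := s.mono_ev
  obtain ⟨p, hp⟩ := s.lift (V.d (n + 1) n) (V.d_comp_d _ _ _)
  have hp' : ∀ j, Epi ((ℰ.ev j).map p) := fun j => by
    rw [epi_iff_surjective_up_to_refinements]
    intro T t
    obtain ⟨T', π, hπ, y, hy⟩ := (HomologicalComplex.exactAt_iff_exact_up_to_refinements _ (n + 1) n
      _ (ChainComplex.prev ℕ _) rfl).1 (h j n) (t ≫ (ℰ.ev j).map s.i) (by
        refine (Category.assoc _ _ _).trans ((congrArg (t ≫ ·) ?_).trans comp_zero)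
        exact ((ℰ.ev j).map_comp _ _).symm.trans
          ((congrArg (ℰ.ev j).map s.w).trans ((ℰ.ev j).map_zero _ _)))
    refine ⟨T', π, hπ, y, (cancel_mono ((ℰ.ev j).map s.i)).1 ?_⟩
    have hp' := (Functor.map_comp (ℰ.ev j) p s.i).symm.trans (congrArg (ℰ.ev j).map hp)
    exact (Category.assoc _ _ _).trans (hy.trans ((congrArg (y ≫ ·) hp'.symm).trans
      (Category.assoc _ _ _).symm))
  obtain ⟨K, k, w, hS⟩ := ℰ.exists_kernel p hp'
  have hm : Mono k := ℰ.mono_f _ hS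
  refine ⟨⟨K, k, ℰ.mem_ker _ hS (hV _) s.mem, hm, ?_, ?_, fun j =>
    ((ℰ.conflation_iff _).1 hS j).mono_f⟩, p, w, hp, hS⟩
  · rw [ChainComplex.next_nat_succ, ← hp, reassoc_of% w, zero_comp]
  · intro T t ht
    rw [ChainComplex.next_nat_succ, ← hp, ← Category.assoc] at ht
    exact ℰ.exists_lift _ hS t ((cancel_mono s.i).1 (ht.trans zero_comp.symm))

/-- For the converse, the splicing is built upwards from degree `0`, where everything is a cycle
because the complex is supported in non-negative degrees. -/
lemma isAcyclic_iff {V : ChainComplex E.C ℕ} (hV : ∀ n, E.mem (V.X n)) :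
    E.IsAcyclic V ↔ ∀ j, ((ℰ.ev j).mapChain.obj V).Acyclic := by
  refine ⟨fun h j => ℰ.acyclic_of_isAcyclic h j, fun h => ?_⟩
  have hd : V.d 0 ((ComplexShape.down ℕ).next 0) = 0 := V.shape _ _ (by simp)
  let s₀ : ℰ.Cycles V 0 :=
    { Z := V.X 0
      i := 𝟙 _
      mem := hV 0
      mono := inferInstance
      w := by rw [hd, comp_zero]
      lift := fun t _ => ⟨t, Category.comp_id t⟩
      mono_ev := fun j => inferInstance }
  choose next p w hp hS using fun n (s : ℰ.Cycles V n) => s.exists_succ ℰ hV h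
  let s : ∀ n, ℰ.Cycles V n := fun n => Nat.rec s₀ next n
  exact ⟨fun n => (s n).Z, fun n => (s n).i, fun n => p n (s n), fun n => w n (s n),
    fun n => (s n).mem, inferInstanceAs (IsIso (𝟙 _)), fun n => hp n (s n), fun n => hS n (s n)⟩

open HomologicalComplex in
include ℰ in
lemma mem_homotopyCofiber {V W : ChainComplex E.C ℕ} (f : V ⟶ W) (hV : ∀ n, E.mem (V.X n))
    (hW : ∀ n, E.mem (W.X n)) (n : ℕ) : E.mem ((homotopyCofiber f).X n) := by
  cases n with
  | zero =>
    exact ℰ.mem_of_retract ⟨ChainComplex.coneSnd f 0, ChainComplex.coneInr f 0,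
      ChainComplex.cone_total_zero f⟩ (hW 0)
  | succ n =>
    exact ℰ.mem_of_total (J := Bool) (fun j => bif j then V.X n else W.X (n + 1))
      (fun | true => ChainComplex.coneFst f n | false => ChainComplex.coneSnd f (n + 1))
      (fun | true => ChainComplex.coneInl f n | false => ChainComplex.coneInr f (n + 1))
      (by
        rw [Fintype.sum_bool]
        exact ChainComplex.cone_total_succ f n)
      (fun | true => hV n | false => hW (n + 1))

lemma isQuasiIso_iff {V W : ChainComplex E.C ℕ} (f : V ⟶ W) (hV : ∀ n, E.mem (V.X n))
    (hW : ∀ n, E.mem (W.X n)) :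
    E.IsQuasiIso f ↔ ∀ j, QuasiIso ((ℰ.ev j).mapChain.map f) := by
  unfold IsQuasiIso
  rw [ℰ.isAcyclic_iff (ℰ.mem_homotopyCofiber f hV hW)]
  exact forall_congr' fun j => (quasiIso_mapChain_iff (ℰ.ev j) f).symm

end Evaluation

end ExactDatum

/-! ### Exactness of binary complexes -/

lemma map_total {C D : Type*} [Category* C] [Preadditive C] [Category* D] [Preadditive D]
    {P : C} {J : Type*} [Fintype J] {B : J → C} (a : ∀ j, P ⟶ B j) (b : ∀ j, B j ⟶ P)
    (h : ∑ j, a j ≫ b j = 𝟙 P) (Φ : C ⥤ D) [Φ.Additive] :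
    ∑ j, Φ.map (a j) ≫ Φ.map (b j) = 𝟙 (Φ.obj P) := by
  have := congrArg Φ.map h
  rw [Φ.map_sum, Φ.map_id] at this
  simpa only [Φ.map_comp] using this

lemma isZero_of_total {C : Type*} [Category* C] [Preadditive C] {P : C} {J : Type*} [Fintype J]
    {B : J → C} (a : ∀ j, P ⟶ B j) (b : ∀ j, B j ⟶ P) (h : ∑ j, a j ≫ b j = 𝟙 P)
    (hB : ∀ j, IsZero (B j)) : IsZero P := by
  rw [IsZero.iff_id_eq_zero, ← h]
  exact Finset.sum_eq_zero fun j _ => by rw [(hB j).eq_of_tgt (a j) 0, zero_comp]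

lemma acyclic_of_total {A : Type*} [Category* A] [Abelian A] {P : ChainComplex A ℕ} {J : Type*}
    [Fintype J] {B : J → ChainComplex A ℕ} (a : ∀ j, P ⟶ B j) (b : ∀ j, B j ⟶ P)
    (h : ∑ j, a j ≫ b j = 𝟙 P) (hB : ∀ j, (B j).Acyclic) : P.Acyclic := fun n => by
  let H := HomologicalComplex.homologyFunctor A (ComplexShape.down ℕ) n
  rw [HomologicalComplex.exactAt_iff_isZero_homology]
  refine isZero_of_total (fun j => H.map (a j)) (fun j => H.map (b j)) ?_ fun j =>
    (HomologicalComplex.exactAt_iff_isZero_homology _ n).1 (hB j n)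
  exact map_total a b h H

/-- A map between acyclic complexes is a quasi-isomorphism, and the long exact sequence then kills
the homology of the kernel. -/
lemma acyclic_of_shortExact {A : Type*} [Category* A] [Abelian A]
    {S : ShortComplex (ChainComplex A ℕ)}
    (h : ∀ n, (S.map (HomologicalComplex.eval A _ n)).ShortExact)
    (h₂ : S.X₂.Acyclic) (h₃ : S.X₃.Acyclic) : S.X₁.Acyclic :=
  (HomologicalComplex.shortExact_of_degreewise_shortExact S h).acyclic_X₁ ⟨fun n =>
    (quasiIsoAt_iff_exactAt _ n (h₂ n)).2 (h₃ n)⟩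

namespace BinaryComplex

variable {C : Type u} [Category.{v} C] [Preadditive C]

instance (n : ℕ) : (eval (C := C) n).Additive where
  map_add := rfl

variable (C) in
/-- The chain complex given by the first differential, as a functor. -/
def topFunctor : BinaryComplex C ⥤ ChainComplex C ℕ where
  obj := top
  map := topMap

variable (C) in
/-- The chain complex given by the second differential, as a functor. -/
def botFunctor : BinaryComplex C ⥤ ChainComplex C ℕ where
  obj := bot
  map := botMap

instance : (topFunctor C).Additive where
  map_add := rfl

instance : (botFunctor C).Additive where
  map_add := rfl

lemma mono_of_forall_mono {V W : BinaryComplex C} (f : V ⟶ W) (h : ∀ n, Mono (Hom.f f n)) :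
    Mono f where
  right_cancellation _ _ hg := hom_ext fun n =>
    (cancel_mono (Hom.f f n)).1 (congrArg (fun z => Hom.f z n) hg)

end BinaryComplex

namespace ExactDatum

open BinaryComplex

variable {E : ExactDatum.{v, u}} {A : Type*} [Category* A] [Abelian A]

namespace Evaluation

variable (ℰ : E.Evaluation A)

/-- Once acyclicity is read off in the abelian category, closure of binary complexes under retracts
and kernels becomes a question about homology. -/
lemma binary_mem_iff (V : BinaryComplex E.C) : E.binary.mem V ↔
    (∃ N : ℕ, ∀ n, N ≤ n → IsZero (V.X n)) ∧ (∀ n, E.mem (V.X n)) ∧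
      (∀ j, ((topFunctor E.C ⋙ (ℰ.ev j).mapChain).obj V).Acyclic) ∧
      ∀ j, ((botFunctor E.C ⋙ (ℰ.ev j).mapChain).obj V).Acyclic := by
  constructor
  · rintro ⟨h₁, -, h₂, h₃⟩
    exact ⟨h₁.1, h₁.2, (ℰ.isAcyclic_iff (V := V.top) h₁.2).1 h₂,
      (ℰ.isAcyclic_iff (V := V.bot) h₁.2).1 h₃⟩
  · rintro ⟨h₁, h₂, h₃, h₄⟩
    exact ⟨⟨h₁, h₂⟩, ⟨h₁, h₂⟩, (ℰ.isAcyclic_iff (V := V.top) h₂).2 h₃,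
      (ℰ.isAcyclic_iff (V := V.bot) h₂).2 h₄⟩

lemma binary_conflation_iff (S : ShortComplex (BinaryComplex E.C)) : E.binary.conflation S ↔
    ∀ i : ℕ × ℰ.ι, (S.map (eval i.1 ⋙ ℰ.ev i.2)).ShortExact :=
  ⟨fun h i => (ℰ.conflation_iff _).1 (h i.1) i.2,
    fun h n => (ℰ.conflation_iff _).2 fun j => h (n, j)⟩

/-- Kernels are taken degreewise. Both differentials lift to them, and all relations hold because
they hold after the degreewise monomorphisms `k n`. -/
lemma binary_exists_kernel {P Q : BinaryComplex E.C} (p : P ⟶ Q)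
    (hp : ∀ i : ℕ × ℰ.ι, Epi ((eval i.1 ⋙ ℰ.ev i.2).map p)) :
    ∃ (K : BinaryComplex E.C) (k : K ⟶ P) (w : k ≫ p = 0),
      E.binary.conflation (ShortComplex.mk k p w) := by
  choose K k w hS using fun n => ℰ.exists_kernel (Hom.f p n) fun j => hp (n, j)
  have hm : ∀ n, Mono (k n) := fun n => ℰ.mono_f _ (hS n)
  choose d hd using fun m n => ℰ.exists_lift _ (hS n) (k m ≫ P.d m n) (by
    refine (Category.assoc _ _ _).trans ((congrArg (k m ≫ ·) (Hom.comm p m n).symm).trans ?_)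
    rw [reassoc_of% (w m), zero_comp])
  choose d' hd' using fun m n => ℰ.exists_lift _ (hS n) (k m ≫ P.d' m n) (by
    refine (Category.assoc _ _ _).trans ((congrArg (k m ≫ ·) (Hom.comm' p m n).symm).trans ?_)
    rw [reassoc_of% (w m), zero_comp])
  change ∀ m n, d m n ≫ k n = k m ≫ P.d m n at hd
  change ∀ m n, d' m n ≫ k n = k m ≫ P.d' m n at hd'
  exact ⟨⟨K, d, d',
    fun m n h => (cancel_mono (k n)).1 (by rw [hd, P.shape _ _ h, comp_zero, zero_comp]),
    fun m n h => (cancel_mono (k n)).1 (by rw [hd', P.shape' _ _ h, comp_zero, zero_comp]),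
    fun l m n => (cancel_mono (k n)).1 (by
      rw [Category.assoc, hd, reassoc_of% (hd l m), P.d_comp_d, comp_zero, zero_comp]),
    fun l m n => (cancel_mono (k n)).1 (by
      rw [Category.assoc, hd', reassoc_of% (hd' l m), P.d'_comp_d', comp_zero, zero_comp])⟩,
    ⟨k, fun m n => (hd m n).symm, fun m n => (hd' m n).symm⟩, hom_ext w, hS⟩

include ℰ in
lemma binary_mono_f (S : ShortComplex (BinaryComplex E.C)) (h : E.binary.conflation S) :
    Mono S.f :=
  mono_of_forall_mono _ fun n => ℰ.mono_f _ (h n)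

include ℰ in
lemma binary_exists_lift (S : ShortComplex (BinaryComplex E.C)) (h : E.binary.conflation S)
    {T : BinaryComplex E.C} (t : T ⟶ S.X₂) (ht : t ≫ S.g = 0) : ∃ l : T ⟶ S.X₁, l ≫ S.f = t := by
  have hm : ∀ n, Mono (Hom.f S.f n) := fun n => ℰ.mono_f _ (h n)
  have hl : ∀ n, ∃ l : T.X n ⟶ S.X₁.X n, l ≫ Hom.f S.f n = Hom.f t n := fun n =>
    ℰ.exists_lift _ (h n) (Hom.f t n) (congrArg (fun z => Hom.f z n) ht)
  choose l hl using hl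
  refine ⟨⟨l, fun i j => (cancel_mono (Hom.f S.f j)).1 ?_,
    fun i j => (cancel_mono (Hom.f S.f j)).1 ?_⟩, hom_ext hl⟩
  · rw [Category.assoc, Category.assoc, hl, ← S.f.comm, reassoc_of% (hl i)]
    exact Hom.comm t i j
  · rw [Category.assoc, Category.assoc, hl, ← S.f.comm', reassoc_of% (hl i)]
    exact Hom.comm' t i j

include ℰ in
lemma binary_mem_of_total {J : Type} [Fintype J] {P : BinaryComplex E.C}
    (B : J → BinaryComplex E.C) (a : ∀ j, P ⟶ B j) (b : ∀ j, B j ⟶ P) (h : ∑ j, a j ≫ b j = 𝟙 P)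
    (hB : ∀ j, E.binary.mem (B j)) : E.binary.mem P := by
  simp only [ℰ.binary_mem_iff] at hB ⊢
  choose N hN using fun j => (hB j).1
  refine ⟨⟨Finset.univ.sup N, fun n hn => ?_⟩, fun n => ?_, fun i => ?_, fun i => ?_⟩
  · exact isZero_of_total _ _ (map_total _ _ h (eval n)) fun j =>
      hN j n ((Finset.le_sup (Finset.mem_univ j)).trans hn)
  · exact ℰ.mem_of_total _ _ _ (map_total _ _ h (eval n)) fun j => (hB j).2.1 n
  · exact acyclic_of_total _ _ (map_total _ _ h (topFunctor E.C ⋙ (ℰ.ev i).mapChain)) fun j =>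
      (hB j).2.2.1 i
  · exact acyclic_of_total _ _ (map_total _ _ h (botFunctor E.C ⋙ (ℰ.ev i).mapChain)) fun j =>
      (hB j).2.2.2 i

include ℰ in
lemma binary_mem_ker (S : ShortComplex (BinaryComplex E.C)) (h : E.binary.conflation S)
    (h₂ : E.binary.mem S.X₂) (h₃ : E.binary.mem S.X₃) : E.binary.mem S.X₁ := by
  rw [ℰ.binary_mem_iff] at h₂ h₃ ⊢
  have hS := (ℰ.binary_conflation_iff S).1 h
  obtain ⟨N, hN⟩ := h₂.1
  refine ⟨⟨N, fun n hn => ?_⟩, fun n => ℰ.mem_ker _ (h n) (h₂.2.1 n) (h₃.2.1 n),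
    fun j => ?_, fun j => ?_⟩
  · have : Mono (Hom.f S.f n) := ℰ.mono_f _ (h n)
    exact IsZero.of_mono (Hom.f S.f n) (hN n hn)
  · exact acyclic_of_shortExact (S := S.map (topFunctor E.C ⋙ (ℰ.ev j).mapChain))
      (fun n => hS (n, j)) (h₂.2.2.1 j) (h₃.2.2.1 j)
  · exact acyclic_of_shortExact (S := S.map (botFunctor E.C ⋙ (ℰ.ev j).mapChain))
      (fun n => hS (n, j)) (h₂.2.2.2 j) (h₃.2.2.2 j)

/-- The evaluation functors of the exact category of acyclic binary complexes. -/
def binary : E.binary.Evaluation A where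
  ι := ℕ × ℰ.ι
  ev i := eval i.1 ⋙ ℰ.ev i.2
  additive i := inferInstanceAs (eval i.1 ⋙ ℰ.ev i.2).Additive
  conflation_iff := ℰ.binary_conflation_iff
  exists_kernel := ℰ.binary_exists_kernel
  mono_f := ℰ.binary_mono_f
  exists_lift := ℰ.binary_exists_lift
  mem_of_total := ℰ.binary_mem_of_total
  mem_ker := ℰ.binary_mem_ker

end Evaluation

end ExactDatum

/-- A map that is diagonal for the two decompositions has the inverse assembled from the inverses of
its diagonal entries. -/
lemma isIso_of_total {C : Type*} [Category* C] [Preadditive C] {P Q : C} (f : P ⟶ Q) {J : Type*}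
    [Fintype J] {B B' : J → C} (g : ∀ j, B j ⟶ B' j) [∀ j, IsIso (g j)] (a : ∀ j, P ⟶ B j)
    (b : ∀ j, B j ⟶ P) (a' : ∀ j, Q ⟶ B' j) (b' : ∀ j, B' j ⟶ Q) (h : ∑ j, a j ≫ b j = 𝟙 P)
    (h' : ∑ j, a' j ≫ b' j = 𝟙 Q) (ha : ∀ j, f ≫ a' j = a j ≫ g j)
    (hb : ∀ j, g j ≫ b' j = b j ≫ f) : IsIso f := by
  refine ⟨∑ j, a' j ≫ inv (g j) ≫ b j, ?_, ?_⟩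
  · rw [Preadditive.comp_sum, ← h]
    exact Finset.sum_congr rfl fun j _ => by
      rw [← Category.assoc, ha, Category.assoc, IsIso.hom_inv_id_assoc]
  · rw [Preadditive.sum_comp, ← h']
    exact Finset.sum_congr rfl fun j _ => by
      rw [Category.assoc, Category.assoc, ← hb, IsIso.inv_hom_id_assoc]

lemma quasiIso_of_total {A : Type*} [Category* A] [Abelian A] {P Q : ChainComplex A ℕ} (f : P ⟶ Q)
    {J : Type*} [Fintype J] {B B' : J → ChainComplex A ℕ} (g : ∀ j, B j ⟶ B' j)
    (hg : ∀ j, QuasiIso (g j)) (a : ∀ j, P ⟶ B j)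
    (b : ∀ j, B j ⟶ P) (a' : ∀ j, Q ⟶ B' j) (b' : ∀ j, B' j ⟶ Q) (h : ∑ j, a j ≫ b j = 𝟙 P)
    (h' : ∑ j, a' j ≫ b' j = 𝟙 Q) (ha : ∀ j, f ≫ a' j = a j ≫ g j)
    (hb : ∀ j, g j ≫ b' j = b j ≫ f) : QuasiIso f := by
  rw [quasiIso_iff]
  intro n
  rw [quasiIsoAt_iff_isIso_homologyMap]
  let H := HomologicalComplex.homologyFunctor A (ComplexShape.down ℕ) n
  have : ∀ j, IsIso (H.map (g j)) := fun j =>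
    inferInstanceAs (IsIso (HomologicalComplex.homologyMap (g j) n))
  exact isIso_of_total (H.map f) (fun j => H.map (g j)) (fun j => H.map (a j))
    (fun j => H.map (b j)) (fun j => H.map (a' j)) (fun j => H.map (b' j)) (map_total a b h H)
    (map_total a' b' h' H) (fun j => by rw [← H.map_comp, ha, H.map_comp])
    (fun j => by rw [← H.map_comp, hb, H.map_comp])

/-- This makes preservation of acyclic complexes a special case of preservation of
quasi-isomorphisms. -/
lemma quasiIso_zero_iff {A : Type*} [Category* A] [Abelian A] {P : ChainComplex A ℕ} :
    QuasiIso (0 : P ⟶ P) ↔ P.Acyclic := by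
  rw [quasiIso_iff]
  refine forall_congr' fun n => ⟨fun h => ?_, fun h => (quasiIsoAt_iff_exactAt _ n h).2 h⟩
  rw [quasiIsoAt_iff_isIso_homologyMap, HomologicalComplex.homologyMap_zero] at h
  rw [HomologicalComplex.exactAt_iff_isZero_homology, IsZero.iff_id_eq_zero]
  exact (IsIso.hom_inv_id (0 : P.homology n ⟶ P.homology n)).symm.trans zero_comp

/-! ### Degree parts of the Dold–Puppe extension -/

namespace DoldPuppe

open Simplicial

variable {C : Type u} [Category.{v} C] [Preadditive C] [HasFiniteCoproducts C]

lemma gamma_map_zero (K L : ChainComplex C ℕ) (n : ℕ) :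
    (DoldKan.Γ₀.map (0 : K ⟶ L)).app (op ⦋n⦌) = 0 :=
  gamma_hom_ext' fun A => by
    rw [inj_gamma_map, HomologicalComplex.zero_f, zero_comp, comp_zero]

lemma gamma_map_add {K L : ChainComplex C ℕ} (f g : K ⟶ L) (n : ℕ) :
    (DoldKan.Γ₀.map (f + g)).app (op ⦋n⦌) =
      (DoldKan.Γ₀.map f).app (op ⦋n⦌) + (DoldKan.Γ₀.map g).app (op ⦋n⦌) :=
  gamma_hom_ext' fun A => by
    rw [Preadditive.comp_add, inj_gamma_map, inj_gamma_map, inj_gamma_map,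
      HomologicalComplex.add_f_apply, Preadditive.add_comp]

lemma unnormalized_map_zero {D : Type*} [Category* D] [Preadditive D] (F : C ⥤ D)
    (hF : ∀ P Q : C, F.map (0 : P ⟶ Q) = 0) (K L : ChainComplex C ℕ) :
    (unnormalized F).map (0 : K ⟶ L) = 0 := by
  ext n
  exact (congrArg F.map (gamma_map_zero K L n)).trans (hF _ _)

lemma functor_map_zero [IsIdempotentComplete C] (F : C ⥤ C)
    (hF : ∀ P Q : C, F.map (0 : P ⟶ Q) = 0) (K L : ChainComplex C ℕ) :
    (functor F).map (0 : K ⟶ L) = 0 := by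
  have h := congrArg (fun z => z.app L) (functorRetract F).retract
  rw [← Category.comp_id ((functor F).map _)]
  refine (congrArg ((functor F).map _ ≫ ·) h.symm).trans ?_
  refine ((functorRetract F).i.naturality_assoc _ _).trans ?_
  rw [unnormalized_map_zero F hF, zero_comp, comp_zero]

end DoldPuppe

namespace BinaryComplex

open Simplicial DoldPuppe

variable {C : Type u} [Category.{v} C] [Preadditive C] [HasFiniteCoproducts C]

/-- The degree `n` part of the simplicial object of the first differential. -/
def gammaTop (n : ℕ) : BinaryComplex C ⥤ C :=
  topFunctor C ⋙ DoldKan.Γ₀ ⋙ (evaluation _ _).obj (op ⦋n⦌)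

instance (n : ℕ) : (gammaTop (C := C) n).Additive where
  map_add {_ _ f g} := gamma_map_add (topMap f) (topMap g) n

/-- The inclusion of a summand of `gammaTop n`. -/
def gammaTopInj {n : ℕ} (A : Index n) : eval (C := C) A.deg ⟶ gammaTop n where
  app V := inj V.top A
  naturality _ _ f := (inj_gamma_map (topMap f) A).symm

/-- The projection onto a summand of `gammaTop n`. -/
def gammaTopProj {n : ℕ} (A : Index n) : gammaTop (C := C) n ⟶ eval A.deg where
  app V := π V.top A
  naturality _ _ f := gamma_map_π (topMap f) A

/-- Since the decomposition is natural, it passes to complexes of binary complexes: `gammaTop n` is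
a finite sum of evaluations there, so it inherits quasi-isomorphisms from them. -/
lemma gammaTop_total (n : ℕ) (V : ChainComplex (BinaryComplex C) ℕ) :
    ∑ A : Index n, (NatTrans.mapHomologicalComplex (gammaTopProj A) (ComplexShape.down ℕ)).app V ≫
      (NatTrans.mapHomologicalComplex (gammaTopInj A) (ComplexShape.down ℕ)).app V =
        𝟙 ((gammaTop n).mapChain.obj V) := by
  ext m
  exact ((HomologicalComplex.eval C _ m).map_sum _ _).trans (sum_π_inj (K := (V.X m).top) n)

/-- The Dold–Puppe extension of `F` to binary complexes is, in each degree, a retract of the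
composition of `F` with an additive functor. -/
def doldPuppeRetract [IsIdempotentComplete C] (F : C ⥤ C) (n : ℕ) :
    Retract (doldPuppe F ⋙ eval n) (gammaTop n ⋙ F) where
  i :=
    { app := fun V => ((functorRetract F).i.app V.top).f n
      naturality := fun _ _ f =>
        congrArg (fun z => HomologicalComplex.Hom.f z n)
          ((functorRetract F).i.naturality (topMap f)) }
  r :=
    { app := fun V => ((functorRetract F).r.app V.top).f n
      naturality := fun _ _ f =>
        congrArg (fun z => HomologicalComplex.Hom.f z n)
          ((functorRetract F).r.naturality (topMap f)) }
  retract := by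
    ext V
    exact congrArg (fun z => HomologicalComplex.Hom.f (z.app V.top) n) (functorRetract F).retract

/-- The complex of the second differential of the Dold–Puppe extension. -/
def doldPuppeBotIso [IsIdempotentComplete C] (F : C ⥤ C) (V : BinaryComplex C) :
    ((doldPuppe F).obj V).bot ≅ (functor F).obj V.bot :=
  HomologicalComplex.Hom.isoOfComponents
    (fun n => ⟨compare F V n, compareInv F V n, compare_compareInv F V n,
      compareInv_compare F V n⟩) fun i j _ => by
    change compare F V i ≫ _ = (compare F V i ≫ _ ≫ compareInv F V j) ≫ compare F V j
    rw [Category.assoc, Category.assoc, compareInv_compare, Category.comp_id]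

end BinaryComplex

/-! ### The inductive step: admissible functors -/

namespace ExactDatum.Evaluation

open DoldPuppe BinaryComplex Simplicial

variable {E : ExactDatum.{v, u}} {A : Type*} [Category* A] [Abelian A] (ℰ : E.Evaluation A)

/-- The properties of a polynomial functor on an exact category which ensure that its Dold–Puppe
extension preserves quasi-isomorphisms, and which pass to binary complexes. -/
structure Admissible (F : E.C ⥤ E.C) (k : ℕ) : Prop where
  degree : HasDegreeLE F k
  map_zero : ∀ P Q : E.C, F.map (0 : P ⟶ Q) = 0
  mem : ∀ P, E.mem P → E.mem (F.obj P)
  -- The unnormalized extension is used because it makes sense for functors between different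
  -- categories and is compatible with additive functors on either side and with retracts of
  -- functors. The normalized one is recovered as a retract.
  quasiIso : ∀ {V W : ChainComplex E.C ℕ} (f : V ⟶ W), E.boundedComplexes V →
    E.boundedComplexes W → (∀ j, QuasiIso ((ℰ.ev j).mapChain.map f)) →
      ∀ j, QuasiIso ((unnormalized (F ⋙ ℰ.ev j)).map f)

variable {ℰ}

include ℰ in
lemma mem_gamma {V : ChainComplex E.C ℕ} (hV : ∀ n, E.mem (V.X n)) (n : ℕ) :
    E.mem ((DoldKan.Γ₀.obj V) _⦋n⦌) :=
  ℰ.mem_of_total (J := Index n) _ _ _ (sum_π_inj n) fun A => hV A.deg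

namespace Admissible

variable {F : E.C ⥤ E.C} {k : ℕ} (h : ℰ.Admissible F k)

include h

lemma boundedComplexes_functor {V : ChainComplex E.C ℕ} (hV : E.boundedComplexes V) :
    E.boundedComplexes ((functor F).obj V) := by
  obtain ⟨⟨N, hN⟩, hV⟩ := hV
  exact ⟨⟨k * N + 1, fun n hn => isZero_functor_X h.degree V hN (Nat.lt_of_succ_le hn)⟩, fun n =>
    ℰ.mem_of_retract ⟨incl (gammaF F V) n, proj (gammaF F V) n, incl_proj _ n⟩
      (h.mem _ (ℰ.mem_gamma hV n))⟩

lemma quasiIso_functor {V W : ChainComplex E.C ℕ} (f : V ⟶ W) (hV : E.boundedComplexes V)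
    (hW : E.boundedComplexes W) (hf : ∀ j, QuasiIso ((ℰ.ev j).mapChain.map f)) (j : ℰ.ι) :
    QuasiIso ((ℰ.ev j).mapChain.map ((functor F).map f)) := by
  have := h.quasiIso f hV hW hf j
  have := quasiIso_of_arrow_mk_iso _ _ (arrowIsoOfNatIso (unnormalizedCompIso F (ℰ.ev j)) f)
  have h' : QuasiIso ((ℰ.ev j).mapChain.map ((unnormalized F).map f)) := this
  exact quasiIso_of_retractArrow (((functorRetract F).retractArrow f).map (ℰ.ev j).mapChain)

lemma isQuasiIso_functor {V W : ChainComplex E.C ℕ} (f : V ⟶ W) (hV : E.boundedComplexes V)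
    (hW : E.boundedComplexes W) (hf : E.IsQuasiIso f) : E.IsQuasiIso ((functor F).map f) := by
  rw [ℰ.isQuasiIso_iff _ (h.boundedComplexes_functor hV).2 (h.boundedComplexes_functor hW).2]
  rw [ℰ.isQuasiIso_iff _ hV.2 hW.2] at hf
  exact h.quasiIso_functor f hV hW hf

/-- Apply preservation of quasi-isomorphisms to the zero endomorphism, which the extension sends to
zero. -/
lemma acyclic_functor {V : ChainComplex E.C ℕ} (hV : E.boundedComplexes V)
    (hV' : ∀ j, ((ℰ.ev j).mapChain.obj V).Acyclic) (j : ℰ.ι) :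
    ((ℰ.ev j).mapChain.obj ((functor F).obj V)).Acyclic := by
  have h' := h.quasiIso_functor (0 : V ⟶ V) hV hV (fun j => by
    rw [Functor.map_zero, quasiIso_zero_iff]
    exact hV' j) j
  rw [functor_map_zero F h.map_zero, Functor.map_zero] at h'
  exact quasiIso_zero_iff.1 h'

/-- Degree at most `k` is stable under precomposition with additive functors and under retracts, so
the same `k` works for every number of binary directions. -/
lemma binary_degree : HasDegreeLE (doldPuppe F) k := fun f => by
  ext n
  have h' := HasDegreeLE.retract (HasDegreeLE.precomp h.degree (gammaTop n)) (doldPuppeRetract F n) f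
  refine Eq.trans ?_ h'
  refine ((eval n).map_sum _ _).trans (Finset.sum_congr rfl fun T _ => ?_)
  exact (eval n).map_zsmul

lemma binary_map_zero (P Q : BinaryComplex E.C) : (doldPuppe F).map (0 : P ⟶ Q) = 0 := by
  ext n
  exact congrArg (fun z => HomologicalComplex.Hom.f z n)
    (functor_map_zero F h.map_zero P.top Q.top)

lemma binary_mem (P : BinaryComplex E.C) (hP : E.binary.mem P) :
    E.binary.mem ((doldPuppe F).obj P) := by
  obtain ⟨-, -, h₃, h₄⟩ := (ℰ.binary_mem_iff P).1 hP
  obtain ⟨h₁, h₂, -, -⟩ := hP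
  have := h.boundedComplexes_functor h₁
  refine (ℰ.binary_mem_iff _).2 ⟨this.1, this.2, h.acyclic_functor h₁ h₃, fun j n => ?_⟩
  -- The second differential was transported to the graded object of the first; undoing this gives
  -- the extension of the second complex.
  exact (h.acyclic_functor h₂ h₄ j n).of_iso
    ((ℰ.ev j).mapChain.mapIso (doldPuppeBotIso F P)).symm

/-- Heart of the induction. After evaluation in degree `n`, the extended functor is a retract of
`gammaTop n ⋙ F`. The additive functor `gammaTop n` can be applied to the complexes first; it sends
`f` to a quasi-isomorphism of bounded complexes one level down, to which the hypothesis on `F`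
applies. -/
lemma binary_quasiIso {V W : ChainComplex (BinaryComplex E.C) ℕ} (f : V ⟶ W)
    (hV : E.binary.boundedComplexes V) (hW : E.binary.boundedComplexes W)
    (hf : ∀ i, QuasiIso ((ℰ.binary.ev i).mapChain.map f)) (i : ℕ × ℰ.ι) :
    QuasiIso ((unnormalized (doldPuppe F ⋙ ℰ.binary.ev i)).map f) := by
  obtain ⟨n, j⟩ := i
  have hb : ∀ {V : ChainComplex (BinaryComplex E.C) ℕ}, E.binary.boundedComplexes V →
      E.boundedComplexes ((gammaTop n).mapChain.obj V) := by
    rintro V ⟨⟨N, hN⟩, hV⟩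
    exact ⟨⟨N, fun m hm => (gammaTop n).map_isZero (hN m hm)⟩, fun m => ℰ.mem_gamma (hV m).1.2 n⟩
  have h' : QuasiIso ((unnormalized (gammaTop n ⋙ F ⋙ ℰ.ev j)).map f) := by
    have : QuasiIso (((gammaTop n).mapChain ⋙ unnormalized (F ⋙ ℰ.ev j)).map f) :=
      h.quasiIso ((gammaTop n).mapChain.map f) (hb hV) (hb hW) (fun j =>
      quasiIso_of_total ((ℰ.ev j).mapChain.map ((gammaTop n).mapChain.map f))
        (fun A : Index n => (ℰ.ev j).mapChain.map ((eval A.deg).mapChain.map f))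
        (fun A => hf (A.deg, j)) _ _ _ _
        (map_total _ _ (gammaTop_total n V) (ℰ.ev j).mapChain)
        (map_total _ _ (gammaTop_total n W) (ℰ.ev j).mapChain)
        (fun A => by rw [← Functor.map_comp, ← Functor.map_comp, NatTrans.naturality])
        (fun A => by rw [← Functor.map_comp, ← Functor.map_comp, NatTrans.naturality])) j
    exact quasiIso_of_arrow_mk_iso _ _
      (arrowIsoOfNatIso (unnormalizedPrecompIso (gammaTop n) (F ⋙ ℰ.ev j)) f).symm
  let r : Retract (doldPuppe F ⋙ eval n ⋙ ℰ.ev j) (gammaTop n ⋙ F ⋙ ℰ.ev j) :=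
    (doldPuppeRetract F n).map ((Functor.whiskeringRight _ _ _).obj (ℰ.ev j))
  exact quasiIso_of_retractArrow ((unnormalizedRetract r).retractArrow f)

lemma binary : ℰ.binary.Admissible (doldPuppe F) k where
  degree := h.binary_degree
  map_zero := h.binary_map_zero
  mem := h.binary_mem
  quasiIso := h.binary_quasiIso

end Admissible

end ExactDatum.Evaluation

/-! ### Frames of presheaves of modules and idempotent matrices -/

namespace LocalFrame

variable {X : Scheme.{u}}

/-- The restriction of functions. -/
def resRing {U V : X.Opens} (h : V ≤ U) : Γ(X, U) →+* Γ(X, V) :=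
  (X.presheaf.map (homOfLE h).op).hom

lemma resRing_resRing {U V W : X.Opens} (h : V ≤ U) (h' : W ≤ V) (a : Γ(X, U)) :
    resRing h' (resRing h a) = resRing (h'.trans h) a :=
  (congrArg (fun z => z.hom a) (X.presheaf.map_comp (homOfLE h).op (homOfLE h').op)).symm

lemma resRing_self {U : X.Opens} (h : U ≤ U) (a : Γ(X, U)) : resRing h a = a :=
  congrArg (fun z => z.hom a) (X.presheaf.map_id (op U))

/-- The sections of a presheaf of modules over an open subset. -/
def Sec (P : X.PresheafOfModules) (U : X.Opens) : Type u := P.obj (op U)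

instance (P : X.PresheafOfModules) (U : X.Opens) : AddCommGroup (Sec P U) :=
  inferInstanceAs (AddCommGroup (P.obj (op U)))

instance (P : X.PresheafOfModules) (U : X.Opens) : Module Γ(X, U) (Sec P U) :=
  (P.obj (op U)).isModule

variable {P Q : X.PresheafOfModules}

/-- The restriction of sections. -/
def res {U V : X.Opens} (h : V ≤ U) : Sec P U →+ Sec P V :=
  ((P.map (homOfLE h).op).hom : P.obj (op U) →ₗ[_] _).toAddMonoidHom

lemma res_smul {U V : X.Opens} (h : V ≤ U) (a : Γ(X, U)) (s : Sec P U) :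
    res h (a • s) = resRing h a • res h s :=
  P.map_smul _ _ _

lemma res_res {U V W : X.Opens} (h : V ≤ U) (h' : W ≤ V) (s : Sec P U) :
    res h' (res h s) = res (h'.trans h) s :=
  (P.map_comp_apply (homOfLE h).op (homOfLE h').op s).symm

lemma res_self {U : X.Opens} (h : U ≤ U) (s : Sec P U) : res h s = s :=
  (congrArg (fun z => z.hom s) (P.map_id (op U)) : _)

/-- The action of a morphism on sections. -/
def appl (f : P ⟶ Q) (U : X.Opens) : Sec P U →ₗ[Γ(X, U)] Sec Q U :=
  (f.app (op U)).hom

lemma appl_res (f : P ⟶ Q) {U V : X.Opens} (h : V ≤ U) (s : Sec P U) :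
    appl f V (res h s) = res h (appl f U s) :=
  PresheafOfModules.naturality_apply f _ _

/-- The linear combination of restrictions of sections. -/
def comb {I : Type*} [Fintype I] {U V : X.Opens} (e : I → Sec P U) (h : V ≤ U)
    (c : I → Γ(X, V)) : Sec P V :=
  ∑ i, c i • res h (e i)

section

variable {I : Type*} [Fintype I] {U V W : X.Opens} (e : I → Sec P U)

lemma res_comb (h : V ≤ U) (h' : W ≤ V) (c : I → Γ(X, V)) :
    res h' (comb e h c) = comb e (h'.trans h) fun i => resRing h' (c i) := by
  simp only [comb, map_sum, res_smul, res_res]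

lemma comb_res (h : V ≤ U) (h' : W ≤ V) (c : I → Γ(X, W)) :
    comb (fun i => res h (e i)) h' c = comb e (h'.trans h) c := by
  simp only [comb, res_res]

lemma appl_comb (f : P ⟶ Q) (h : V ≤ U) (c : I → Γ(X, V)) :
    appl f V (comb e h c) = comb (fun i => appl f U (e i)) h c := by
  simp only [comb, map_sum, map_smul, appl_res]

lemma comb_add (h : V ≤ U) (c c' : I → Γ(X, V)) : comb e h (c + c') = comb e h c + comb e h c' := by
  simp only [comb, Pi.add_apply, add_smul, Finset.sum_add_distrib]

lemma comb_sub (h : V ≤ U) (c c' : I → Γ(X, V)) : comb e h (c - c') = comb e h c - comb e h c' := by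
  simp only [comb, Pi.sub_apply, sub_smul, Finset.sum_sub_distrib]

lemma comb_smul (h : V ≤ U) (a : Γ(X, V)) (c : I → Γ(X, V)) :
    comb e h (a • c) = a • comb e h c := by
  simp only [comb, Pi.smul_apply, smul_eq_mul, mul_smul, Finset.smul_sum]

lemma comb_sum {J : Type*} (s : Finset J) (h : V ≤ U) (c : J → I → Γ(X, V)) :
    comb e h (∑ j ∈ s, c j) = ∑ j ∈ s, comb e h (c j) := by
  simp only [comb, Finset.sum_apply, Finset.sum_smul]
  exact Finset.sum_comm

lemma comb_zero (h : V ≤ U) : comb e h 0 = 0 := by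
  simp [comb]

lemma comb_single [DecidableEq I] (h : V ≤ U) (i : I) : comb e h (Pi.single i 1) = res h (e i) := by
  rw [comb, Finset.sum_eq_single i]
  · simp
  · intro j _ hj
    simp [Pi.single_eq_of_ne hj]
  · simp

/-- Sections over `U` form a frame if all their restrictions are bases. -/
def IsFrame : Prop := ∀ (V : X.Opens) (h : V ≤ U), Function.Bijective (comb e h)

variable {e}

lemma IsFrame.res (he : IsFrame e) (h : V ≤ U) : IsFrame fun i => res h (e i) := fun W h' => by
  have : comb (fun i => LocalFrame.res h (e i)) h' = comb e (h'.trans h) :=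
    funext fun c => comb_res e h h' c
  rw [this]
  exact he W _

lemma IsFrame.reindex {J : Type*} [Fintype J] (he : IsFrame e) (σ : J ≃ I) :
    IsFrame fun j => e (σ j) := fun W h' => by
  have : comb (fun j => e (σ j)) h' = comb e h' ∘ (σ.arrowCongr (Equiv.refl _)) := by
    funext c
    exact Fintype.sum_equiv σ _ _ fun j => by simp
  rw [this]
  exact (he W h').comp (Equiv.bijective _)

end

variable (P) in
/-- A presheaf of modules is locally free of finite rank at `x` if it has a finite frame over some
neighbourhood. -/
def IsLocallyFreeAt (x : X) : Prop :=
  ∃ (U : X.Opens) (_ : x ∈ U) (n : ℕ) (e : Fin n → Sec P U), IsFrame e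

lemma IsFrame.isLocallyFreeAt {I : Type*} [Fintype I] {U : X.Opens} {e : I → Sec P U}
    (he : IsFrame e) {x : X} (hx : x ∈ U) : IsLocallyFreeAt P x :=
  ⟨U, hx, _, _, he.reindex (Fintype.equivFin I).symm⟩

/-- A finite neighbourhood on which finitely many properties hold. -/
lemma exists_common_nbhd {J : Type*} (s : Finset J) (x : X) (p : J → X.Opens → Prop)
    (hp : ∀ j U V, V ≤ U → p j U → p j V) (h : ∀ j ∈ s, ∃ U, x ∈ U ∧ p j U) :
    ∃ U, x ∈ U ∧ ∀ j ∈ s, p j U := by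
  classical
  induction s using Finset.induction_on with
  | empty => exact ⟨⊤, trivial, by simp⟩
  | insert j s _ ih =>
    obtain ⟨U, hU, hU'⟩ := ih fun j hj => h j (Finset.mem_insert_of_mem hj)
    obtain ⟨V, hV, hV'⟩ := h j (Finset.mem_insert_self _ _)
    refine ⟨U ⊓ V, ⟨hU, hV⟩, fun i hi => ?_⟩
    rcases Finset.mem_insert.1 hi with rfl | hi
    · exact hp _ _ _ inf_le_right hV'
    · exact hp _ _ _ inf_le_left (hU' i hi)

lemma exists_isFrame_of_le {U : X.Opens} {n : ℕ} {e : Fin n → Sec P U} (he : IsFrame e)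
    {V : X.Opens} (h : V ≤ U) : ∃ (n : ℕ) (e : Fin n → Sec P V), IsFrame e :=
  ⟨n, _, he.res h⟩

open Matrix in
/-- Among the columns of a matrix that span the fibre at `x` one finds a square submatrix that is
invertible near `x`. -/
lemma exists_isUnit_det {I J : Type} [Fintype I] [DecidableEq I] [Finite J] {U : X.Opens} {x : X}
    (hx : x ∈ U) (C : Matrix I J Γ(X, U)) (D : Matrix J I Γ(X, U)) [Fintype J] (hCD : C * D = 1) :
    ∃ (V : X.Opens) (h : V ≤ U) (a : I → J), x ∈ V ∧
      IsUnit ((C.submatrix id a).map (resRing h)).det := by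
  let ev : Γ(X, U) →+* X.residueField x := (X.evaluation U x hx).hom
  let v : J → I → X.residueField x := fun j i => ev (C i j)
  obtain ⟨κ, a, ha, hspan, hli⟩ := exists_linearIndependent' (X.residueField x) v
  have htop : ⊤ ≤ Submodule.span (X.residueField x) (Set.range (v ∘ a)) := by
    rw [hspan]
    -- A right inverse of `C` at `x` shows that the columns span the fibre. A basis chosen among
    -- them has as many elements as `I`, and its determinant, nonzero at `x`, is a unit on its basic
    -- open set.
    have h1 : C.map ev * D.map ev = 1 := by
      rw [← Matrix.map_mul, hCD, Matrix.map_one _ (map_zero _) (map_one _)]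
    intro y _
    have h2 : y = ∑ j, (D.map ev *ᵥ y) j • v j := by
      conv_lhs => rw [← Matrix.one_mulVec y, ← h1, ← Matrix.mulVec_mulVec]
      ext i
      simp [Matrix.mulVec, dotProduct, v, mul_comm]
    rw [h2]
    exact Submodule.sum_mem _ fun j _ => Submodule.smul_mem _ _ (Submodule.subset_span ⟨j, rfl⟩)
  have : Finite κ := Finite.of_injective a ha
  have := Fintype.ofFinite κ
  let b := Module.Basis.mk hli htop
  let σ : I ≃ κ := (Pi.basisFun (X.residueField x) I).indexEquiv b
  let M : Matrix I I Γ(X, U) := C.submatrix id (a ∘ σ)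
  have hdet : ev M.det ≠ 0 := by
    rw [RingHom.map_det]
    have : (ev.mapMatrix M) = (Pi.basisFun (X.residueField x) I).toMatrix (b.reindex σ.symm) := by
      ext i j
      simp [M, Module.Basis.toMatrix_apply, b, v]
    rw [this]
    have := (Pi.basisFun (X.residueField x) I).invertibleToMatrix (b.reindex σ.symm)
    exact (Matrix.isUnit_det_of_invertible _).ne_zero
  have hmem := (X.evaluation_ne_zero_iff_mem_basicOpen x hx M.det).1 hdet
  refine ⟨X.basicOpen M.det, X.basicOpen_le _, a ∘ σ, hmem, ?_⟩
  have : (M.map (resRing (X.basicOpen_le M.det))).det = resRing (X.basicOpen_le _) M.det :=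
    (RingHom.map_det _ _).symm
  change IsUnit (M.map _).det
  rw [this]
  exact X.toRingedSpace.isUnit_res_basicOpen M.det

end LocalFrame

namespace LocalFrame

variable {X : Scheme.{u}} {P Q : X.PresheafOfModules}

lemma sum_subtype_of_eq_zero {I : Type*} [Fintype I] {G : Type*} [AddCommMonoid G] (p : I → Prop)
    [DecidablePred p] (f : I → G) (hf : ∀ i, ¬ p i → f i = 0) :
    ∑ j : {i // p i}, f j = ∑ i, f i := by
  rw [← Finset.sum_subtype (Finset.univ.filter p) (by simp) f]
  exact Finset.sum_subset (Finset.filter_subset _ _) fun i _ hi => hf i fun hp =>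
    hi (Finset.mem_filter.2 ⟨Finset.mem_univ i, hp⟩)

lemma isFrame_of_comb_eq_zero {I : Type*} [Fintype I] {U : X.Opens} {e : I → Sec P U}
    (h₁ : ∀ (V : X.Opens) (h : V ≤ U), Function.Surjective (comb e h))
    (h₂ : ∀ (V : X.Opens) (h : V ≤ U) c, comb e h c = 0 → c = 0) : IsFrame e := fun V h =>
  ⟨fun c c' hc => sub_eq_zero.1 (h₂ V h _ (by rw [comb_sub, hc, sub_self])), h₁ V h⟩

open Matrix in
/-- A presheaf of modules that is the image of an idempotent matrix is locally free. -/
lemma isLocallyFreeAt_of_matrix {I : Type} [Fintype I] [DecidableEq I] {U : X.Opens}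
    (s : I → Sec P U) (A : Matrix I I Γ(X, U))
    (h₁ : ∀ (V : X.Opens) (h : V ≤ U), Function.Surjective (comb s h))
    (h₂ : ∀ i, comb s le_rfl (fun j => A j i) = s i)
    (h₃ : ∀ (V : X.Opens) (h : V ≤ U) c, comb s h c = 0 → A.map (resRing h) *ᵥ c = 0)
    {x : X} (hx : x ∈ U) : IsLocallyFreeAt P x := by
  -- The columns of `A` and of `1 - A` together span, since `A + (1 - A) = 1`. The former represent
  -- the sections `s j`, the latter represent zero.
  let C : Matrix I (I ⊕ I) Γ(X, U) := fromCols A (1 - A)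
  let t : I ⊕ I → Sec P U := Sum.elim s 0
  have ht : ∀ j, comb s le_rfl (fun i => C i j) = t j := by
    rintro (j | j)
    · exact h₂ j
    · have : (fun i => C i (Sum.inr j)) = Pi.single j 1 - fun i => A i j := by
        funext i
        simp [C, Matrix.one_apply, Pi.single_apply]
      rw [this, comb_sub, h₂, comb_single, res_self, sub_self]
      rfl
  -- The column `e_j - A e_j` is a relation among the `s i`, hence is killed by `A`.
  have hAA : A * A = A := by
    ext i j
    have h := congrFun (h₃ U le_rfl (Pi.single j 1 - fun i => A i j)
      (by rw [comb_sub, h₂, comb_single, res_self, sub_self])) i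
    have hA : A.map (resRing (le_refl U)) = A := by ext; simp [resRing_self]
    rw [hA, Matrix.mulVec_sub, Pi.sub_apply, Pi.zero_apply, sub_eq_zero,
      Matrix.mulVec_single_one] at h
    exact h.symm
  obtain ⟨V, hV, a, hxV, hdet⟩ := exists_isUnit_det hx C (fromRows 1 1) (by
    simp [C, fromCols_mul_fromRows])
  -- Of the columns forming a basis near `x`, those taken from `A` give the frame; the others
  -- represent zero.
  refine IsFrame.isLocallyFreeAt (I := {i // (a i).isLeft = true})
    (e := fun j => res hV (t (a j))) (U := V) ?_ hxV
  have key : ∀ (W : X.Opens) (h : W ≤ V) (b : I → Γ(X, W)),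
      comb s (h.trans hV) (((C.submatrix id a).map (resRing (h.trans hV))) *ᵥ b) =
        ∑ i, b i • res (h.trans hV) (t (a i)) := fun W h b => by
    have : ((C.submatrix id a).map (resRing (h.trans hV))) *ᵥ b =
        ∑ i, b i • fun r => resRing (h.trans hV) (C r (a i)) := by
      ext r
      simp [Matrix.mulVec, dotProduct, mul_comm]
    rw [this, comb_sum]
    refine Finset.sum_congr rfl fun i _ => ?_
    rw [comb_smul, ← ht, res_comb]
  have hunit : ∀ (W : X.Opens) (h : W ≤ V),
      IsUnit ((C.submatrix id a).map (resRing (h.trans hV))).det := fun W h => by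
    have := hdet.map (resRing h)
    rw [RingHom.map_det] at this
    convert this using 2
    ext i j
    exact (resRing_resRing hV h _).symm
  have hzero : ∀ (W : X.Opens) (h : W ≤ V) (i : I), ¬ (a i).isLeft = true →
      res (h.trans hV) (t (a i)) = 0 := fun W h i hi => by
    rcases hai : a i with j | j
    · simp [hai] at hi
    · exact map_zero _
  refine isFrame_of_comb_eq_zero (fun W h y => ?_) (fun W h c hc => ?_)
  · obtain ⟨c, rfl⟩ := h₁ W (h.trans hV) y
    refine ⟨fun j => (((C.submatrix id a).map (resRing (h.trans hV)))⁻¹ *ᵥ c) j, ?_⟩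
    have hk := key W h (((C.submatrix id a).map (resRing (h.trans hV)))⁻¹ *ᵥ c)
    rw [Matrix.mulVec_mulVec, Matrix.mul_nonsing_inv _ (hunit W h), Matrix.one_mulVec] at hk
    rw [hk]
    simp only [comb, res_res]
    exact sum_subtype_of_eq_zero (fun i => (a i).isLeft = true)
      (fun i => (((C.submatrix id a).map (resRing (h.trans hV)))⁻¹ *ᵥ c) i •
        res (h.trans hV) (t (a i))) fun i hi => by rw [hzero W h i hi, smul_zero]
  -- Extend the coefficients by zero to all chosen columns. The resulting vector is a combination of
  -- columns of `A`, so `A` fixes it; being a relation, it is also killed by `A`. Thus it is zero,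
  -- and invertibility gives `b = 0`.
  · let b : I → Γ(X, W) := fun i => if hi : (a i).isLeft = true then c ⟨i, hi⟩ else 0
    have hb : ∀ j : {i // (a i).isLeft = true}, b j = c j := fun j => dif_pos j.2
    have h0 : comb s (h.trans hV) (((C.submatrix id a).map (resRing (h.trans hV))) *ᵥ b) = 0 := by
      rw [key W h b, ← sum_subtype_of_eq_zero (fun i => (a i).isLeft = true) _
        fun i hi => by rw [hzero W h i hi, smul_zero]]
      simp only [comb, res_res] at hc
      simpa only [hb] using hc
    have h4 := h₃ W _ _ h0
    have h5 : A.map (resRing (h.trans hV)) *ᵥ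
        (((C.submatrix id a).map (resRing (h.trans hV))) *ᵥ b) =
        ((C.submatrix id a).map (resRing (h.trans hV))) *ᵥ b := by
      rw [Matrix.mulVec_mulVec, ← Matrix.map_mul]
      ext r
      refine Finset.sum_congr rfl fun i _ => ?_
      by_cases hi : (a i).isLeft = true
      · congr 1
        obtain ⟨j, hj⟩ := Sum.isLeft_iff.1 hi
        simp only [Matrix.map_apply, Matrix.mul_apply, Matrix.submatrix_apply, hj, id]
        exact congrArg (fun Z => resRing (h.trans hV) (Z r j)) hAA
      · have : b i = 0 := dif_neg hi
        rw [this, mul_zero, mul_zero]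
    rw [h5] at h4
    have h6 : b = 0 := by
      have := congrArg (((C.submatrix id a).map (resRing (h.trans hV)))⁻¹ *ᵥ ·) h4
      simp only [Matrix.mulVec_mulVec, Matrix.nonsing_inv_mul _ (hunit W h), Matrix.one_mulVec,
        Matrix.mulVec_zero] at this
      exact this
    ext j
    rw [← hb, h6]
    rfl

end LocalFrame

/-! ### Vector bundles through local frames -/

namespace LocalFrame

variable {X : Scheme.{u}} {P Q R : X.PresheafOfModules}

variable (X) in
/-- The functor of sections over an open subset. -/
def secFunctor (U : X.Opens) : X.Modules ⥤ ModuleCat.{u} Γ(X, U) :=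
  Scheme.Modules.toPresheafOfModules X ⋙ PresheafOfModules.evaluation _ (op U)

instance (U : X.Opens) : (secFunctor X U).Additive where
  map_add := rfl

/-- The sections of a sheaf of modules. -/
abbrev MSec (M : X.Modules) (U : X.Opens) : Type u := Sec M.val U

/-- The action of a morphism of sheaves of modules on sections. -/
def mappl {M N : X.Modules} (f : M ⟶ N) (U : X.Opens) : MSec M U →ₗ[Γ(X, U)] MSec N U :=
  appl f.val U

section

variable {M N K : X.Modules} {U V : X.Opens}

lemma mappl_comp (f : M ⟶ N) (g : N ⟶ K) (s : MSec M U) :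
    mappl (f ≫ g) U s = mappl g U (mappl f U s) := rfl

lemma mappl_id (s : MSec M U) : mappl (𝟙 M) U s = s := rfl

lemma mappl_sum {J : Type*} (t : Finset J) (f : J → (M ⟶ N)) (s : MSec M U) :
    mappl (∑ j ∈ t, f j) U s = ∑ j ∈ t, mappl (f j) U s := by
  let φ : (M ⟶ N) →+ MSec N U :=
    { toFun := fun g => mappl g U s
      map_zero' := rfl
      map_add' := fun _ _ => rfl }
  exact map_sum φ f t

lemma mappl_zero (s : MSec M U) : mappl (0 : M ⟶ N) U s = 0 := rfl

lemma mappl_res (f : M ⟶ N) (h : V ≤ U) (s : MSec M U) :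
    mappl f V (res h s) = res h (mappl f U s) := appl_res _ _ _

lemma mappl_comb {I : Type*} [Fintype I] (e : I → MSec M U) (f : M ⟶ N) (h : V ≤ U)
    (c : I → Γ(X, V)) : mappl f V (comb e h c) = comb (fun i => mappl f U (e i)) h c :=
  appl_comb _ _ _ _

lemma isIso_of_bijective (f : M ⟶ N) (h : ∀ U, Function.Bijective (mappl f U)) : IsIso f := by
  rw [Scheme.Modules.Hom.isIso_iff_isIso_app]
  intro U
  rw [ConcreteCategory.isIso_iff_bijective]
  exact h U

lemma bijective_of_isIso (f : M ⟶ N) [IsIso f] (U : X.Opens) : Function.Bijective (mappl f U) := by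
  refine Function.bijective_iff_has_inverse.2 ⟨mappl (inv f) U, fun s => ?_, fun s => ?_⟩
  · rw [← mappl_comp, IsIso.hom_inv_id, mappl_id]
  · rw [← mappl_comp, IsIso.inv_hom_id, mappl_id]

lemma IsFrame.mappl {I : Type*} [Fintype I] {e : I → MSec M U} (he : IsFrame e) (f : M ⟶ N)
    [IsIso f] : IsFrame fun i => mappl f U (e i) := fun V h => by
  have : comb (fun i => LocalFrame.mappl f U (e i)) h = LocalFrame.mappl f V ∘ comb e h :=
    funext fun c => (mappl_comb e f h c).symm
  rw [this]
  exact (bijective_of_isIso f V).comp (he V h)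

end

section free

variable (X) in
/-- The free sheaf of modules. -/
abbrev freeModule (I : Type u) : X.Modules := SheafOfModules.free (R := X.ringCatSheaf) I

variable (X) in
/-- The structure sheaf as a module. -/
abbrev unitModule : X.Modules := SheafOfModules.unit X.ringCatSheaf

/-- A summand of a free sheaf of modules. -/
def freeι {I : Type u} (i : I) : unitModule X ⟶ freeModule X I :=
  SheafOfModules.ιFree (R := X.ringCatSheaf) i

/-- The morphism from a free sheaf of modules given by its restrictions to the summands. -/
def freeDesc {I : Type u} {M : X.Modules} (f : I → (unitModule X ⟶ M)) : freeModule X I ⟶ M :=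
  Cofan.IsColimit.desc (SheafOfModules.isColimitFreeCofan (R := X.ringCatSheaf) I) f

lemma freeι_desc {I : Type u} {M : X.Modules} (f : I → (unitModule X ⟶ M)) (i : I) :
    freeι i ≫ freeDesc f = f i :=
  Cofan.IsColimit.fac (SheafOfModules.isColimitFreeCofan (R := X.ringCatSheaf) I) f i

lemma free_hom_ext {I : Type u} {M : X.Modules} {f g : freeModule X I ⟶ M}
    (h : ∀ i, freeι i ≫ f = freeι i ≫ g) : f = g :=
  Cofan.IsColimit.hom_ext (SheafOfModules.isColimitFreeCofan (R := X.ringCatSheaf) I) _ _ h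

open Classical in
/-- The projection onto a summand of a free sheaf of modules. -/
def freeπ {I : Type u} (i : I) : freeModule X I ⟶ unitModule X :=
  freeDesc fun j => if j = i then 𝟙 _ else 0

lemma freeι_π_self {I : Type u} (i : I) : freeι i ≫ freeπ (X := X) i = 𝟙 _ := by
  rw [freeπ, freeι_desc, if_pos rfl]

lemma freeι_π_ne {I : Type u} {i j : I} (h : i ≠ j) : freeι i ≫ freeπ (X := X) j = 0 := by
  rw [freeπ, freeι_desc, if_neg h]

lemma free_total (I : Type u) [Fintype I] : ∑ i : I, freeπ i ≫ freeι i = 𝟙 (freeModule X I) := by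
  apply free_hom_ext
  intro j
  rw [Preadditive.comp_sum, Finset.sum_eq_single j]
  · rw [← Category.assoc, freeι_π_self, Category.id_comp, Category.comp_id]
  · intro i _ hi
    rw [← Category.assoc, freeι_π_ne hi.symm, zero_comp]
  · simp

/-- The section `1` of the structure sheaf. -/
def oneSec (U : X.Opens) : MSec (unitModule X) U := (1 : Γ(X, U))

lemma res_oneSec {U V : X.Opens} (h : V ≤ U) : res h (oneSec U) = oneSec V :=
  (X.presheaf.map (homOfLE h).op).hom.map_one

/-- The sections of the structure sheaf are functions. -/
def unitSec {U : X.Opens} (s : MSec (unitModule X) U) : Γ(X, U) := s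

lemma unitSec_smul_one {U : X.Opens} (s : MSec (unitModule X) U) : unitSec s • oneSec U = s :=
  mul_one (unitSec s)

lemma unitSec_smul_one' {U : X.Opens} (a : Γ(X, U)) : unitSec (a • oneSec U) = a :=
  mul_one a

/-- The standard frame of a free sheaf of modules. -/
def freeFrame {I : Type u} (i : I) : MSec (freeModule X I) ⊤ := mappl (freeι i) ⊤ (oneSec ⊤)

lemma isFrame_freeFrame (I : Type u) [Fintype I] : IsFrame (freeFrame (X := X) (I := I)) := by
  have key : ∀ {V : X.Opens} (i : I) (a : Γ(X, V)),
      a • res le_top (freeFrame (X := X) i) = mappl (freeι i) V (a • oneSec V) := fun i a => by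
    rw [freeFrame, ← mappl_res, res_oneSec, map_smul]
  refine isFrame_of_comb_eq_zero (fun V h y => ?_) (fun V h c hc => ?_)
  · refine ⟨fun i => unitSec (mappl (freeπ i) V y), ?_⟩
    have := congrArg (fun z => mappl z V y) (free_total (X := X) I)
    simp only [mappl_sum, mappl_id, mappl_comp] at this
    refine Eq.trans (Finset.sum_congr rfl fun i _ => ?_) this
    rw [key, unitSec_smul_one]
  · ext i
    have h1 := congrArg (mappl (freeπ i) V) hc
    rw [comb, map_sum, Finset.sum_eq_single i] at h1
    · rw [key, ← mappl_comp, freeι_π_self, mappl_id, map_zero] at h1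
      have := congrArg unitSec h1
      rw [unitSec_smul_one'] at this
      exact this
    · intro j _ hj
      rw [key, ← mappl_comp, freeι_π_ne hj]
      rfl
    · simp

/-- The morphism from the structure sheaf given by a global section. -/
def unitDesc {M : X.Modules} (s : MSec M ⊤) : unitModule X ⟶ M :=
  (SheafOfModules.unitHomEquiv (R := X.ringCatSheaf) M).symm
    (PresheafOfModules.sectionsMk (fun U => res (P := M.val) (le_top (a := U.unop)) s)
      (fun _ _ f => res_res (P := M.val) _ (leOfHom f.unop) s))

lemma mappl_unitDesc {M : X.Modules} (s : MSec M ⊤) : mappl (unitDesc s) ⊤ (oneSec ⊤) = s := by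
  have h := (SheafOfModules.unitHomEquiv (R := X.ringCatSheaf) M).apply_symm_apply
    (PresheafOfModules.sectionsMk (fun U => res (P := M.val) (le_top (a := U.unop)) s)
      (fun _ _ f => res_res (P := M.val) _ (leOfHom f.unop) s))
  have h' := congrArg (fun z => z.val (op ⊤)) h
  exact h'.trans (res_self (P := M.val) _ s)

lemma exists_iso_of_isFrame {M : X.Modules} {I : Type u} [Fintype I] {e : I → MSec M ⊤}
    (he : IsFrame e) : Nonempty (M ≅ freeModule X I) := by
  let φ : freeModule X I ⟶ M := freeDesc fun i => unitDesc (e i)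
  have hφ : ∀ i, mappl φ ⊤ (freeFrame i) = e i := fun i => by
    rw [freeFrame, ← mappl_comp, freeι_desc, mappl_unitDesc]
  have : IsIso φ := isIso_of_bijective φ fun V => by
    have h := he V le_top
    have h' : comb e le_top = mappl φ V ∘ comb freeFrame le_top := by
      funext c
      rw [Function.comp_apply, mappl_comb]
      simp only [hφ]
    rw [h'] at h
    exact (Function.Bijective.of_comp_iff _ (isFrame_freeFrame I V le_top)).1 h
  exact ⟨(asIso φ).symm⟩

end free

section restrict

variable {Y : Scheme.{u}} (f : Y ⟶ X) [IsOpenImmersion f] {M : X.Modules}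

/-- The sections of a restriction as sections of the original sheaf. -/
def ofRestrict {V : Y.Opens} (s : MSec (M.restrict f) V) : MSec M (f ''ᵁ V) := s

/-- Sections as sections of the restriction. -/
def toRestrict {V : Y.Opens} (s : MSec M (f ''ᵁ V)) : MSec (M.restrict f) V := s

lemma comb_ofRestrict {I : Type*} [Fintype I] {V W : Y.Opens} (e : I → MSec (M.restrict f) V)
    (h : W ≤ V) (c : I → Γ(Y, W)) : ofRestrict f (comb e h c) =
      comb (fun i => ofRestrict f (e i)) (f.image_mono h) fun i => (f.appIso W).inv (c i) := by
  rfl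

/-- Every open subset of the image of `V` is the image of its preimage, and functions on
corresponding open sets are identified by `appIso`. -/
lemma isFrame_ofRestrict_iff {I : Type*} [Fintype I] {V : Y.Opens}
    (e : I → MSec (M.restrict f) V) : IsFrame (fun i => ofRestrict f (e i)) ↔ IsFrame e := by
  have key : ∀ (W : Y.Opens) (h : W ≤ V),
      Function.Bijective (comb (fun i => ofRestrict f (e i)) (f.image_mono h)) ↔
        Function.Bijective (comb e h) := fun W h => by
    have hb : Function.Bijective fun (c : I → Γ(Y, W)) i => (f.appIso W).inv (c i) :=
      Function.Bijective.piMap fun _ => ConcreteCategory.bijective_of_isIso (f.appIso W).inv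
    have h1 : comb e h = comb (fun i => ofRestrict f (e i)) (f.image_mono h) ∘
        fun (c : I → Γ(Y, W)) i => (f.appIso W).inv (c i) := by
      funext c
      exact comb_ofRestrict f e h c
    have h2 : Function.Bijective (comb e h) ↔ Function.Bijective
        (comb (fun i => ofRestrict f (e i)) (f.image_mono h) ∘
        fun (c : I → Γ(Y, W)) i => (f.appIso W).inv (c i)) := by rw [← h1]; rfl
    rw [h2, Function.Bijective.of_comp_iff _ hb]
  refine ⟨fun he W h => (key W h).1 (he _ _), fun he W h => ?_⟩
  have hW : f ''ᵁ (f ⁻¹ᵁ W) = W := by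
    rw [f.image_preimage_eq_opensRange_inf, inf_eq_right]
    exact h.trans (f.image_le_opensRange V)
  have h' : f ⁻¹ᵁ W ≤ V := by
    have := f.preimage_mono h
    rwa [f.preimage_image_eq] at this
  have := (key _ h').2 (he _ _)
  -- The open set occurs in the types of sections and in the proof of inclusion, so both have to be
  -- generalized before rewriting it.
  revert this
  generalize_proofs p1
  revert p1
  rw [hW]
  exact fun _ h => h

end restrict

/-- Vector bundles are the sheaves of modules with local frames. -/
lemma isVectorBundle_iff (M : X.Modules) :
    IsVectorBundle X M ↔ ∀ x, IsLocallyFreeAt M.val x := by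
  refine forall_congr' fun x => ⟨?_, ?_⟩
  · rintro ⟨U, n, hx, ⟨φ⟩⟩
    have h1 := (isFrame_freeFrame (X := (U : Scheme.{u})) (ULift.{u} (Fin n))).mappl φ.inv
    have h2 := (isFrame_ofRestrict_iff U.ι _).2 h1
    exact h2.isLocallyFreeAt (by rwa [U.ι_image_top])
  · rintro ⟨U, hx, n, e, he⟩
    refine ⟨U, n, hx, ?_⟩
    have hU : U.ι ''ᵁ ⊤ ≤ U := U.ι_image_top.le
    have h1 := (he.reindex Equiv.ulift.{u}).res hU
    exact exists_iso_of_isFrame ((isFrame_ofRestrict_iff U.ι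
      (fun i => toRestrict U.ι (res hU (e (Equiv.ulift i))))).1 h1)

end LocalFrame

/-! ### Sheafification and local sections -/

namespace LocalFrame

variable {X : Scheme.{u}}

variable (X) in
/-- The sheafification of presheaves of modules. -/
def shf : X.PresheafOfModules ⥤ X.Modules :=
  PresheafOfModules.sheafification (𝟙 X.ringCatSheaf.obj)

instance : (shf X).IsLeftAdjoint :=
  inferInstanceAs (PresheafOfModules.sheafification (𝟙 X.ringCatSheaf.obj)).IsLeftAdjoint

instance : PreservesFiniteLimits (shf X) :=
  inferInstanceAs (PreservesFiniteLimits (PresheafOfModules.sheafification (𝟙 X.ringCatSheaf.obj)))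

instance : (shf X).Additive :=
  Functor.additive_of_preserves_binary_products _

/-- The unit of sheafification. -/
def toShf (P : X.PresheafOfModules) : P ⟶ ((shf X).obj P).val :=
  (PresheafOfModules.sheafificationAdjunction (𝟙 X.ringCatSheaf.obj)).unit.app P

lemma toShf_isLocallyBijective (P : X.PresheafOfModules) :
    Presheaf.IsLocallyInjective (Opens.grothendieckTopology X)
      ((PresheafOfModules.toPresheaf _).map (toShf P)) ∧
    Presheaf.IsLocallySurjective (Opens.grothendieckTopology X)
      ((PresheafOfModules.toPresheaf _).map (toShf P)) :=
  (GrothendieckTopology.W_iff_isLocallyBijective _ _).1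
    (GrothendieckTopology.W_toSheafify (Opens.grothendieckTopology X) P.presheaf)

lemma exists_res_eq_zero {P : X.PresheafOfModules} {U : X.Opens} (s : Sec P U)
    (h : appl (toShf P) U s = 0) {x : X} (hx : x ∈ U) :
    ∃ (V : X.Opens) (hV : V ≤ U), x ∈ V ∧ res hV s = 0 := by
  have := (toShf_isLocallyBijective P).1
  obtain ⟨V, i, hi, hxV⟩ := Presheaf.equalizerSieve_mem (Opens.grothendieckTopology X)
    ((PresheafOfModules.toPresheaf _).map (toShf P)) (X := op U) s (0 : Sec P U)
    (h.trans (map_zero (appl (toShf P) U)).symm) x hx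
  exact ⟨V, i.le, hxV, Eq.trans hi (map_zero (res (P := P) i.le))⟩

lemma exists_toShf_eq {P : X.PresheafOfModules} {U : X.Opens} (t : MSec ((shf X).obj P) U) {x : X}
    (hx : x ∈ U) : ∃ (V : X.Opens) (hV : V ≤ U) (s : Sec P V), x ∈ V ∧
      appl (toShf P) V s = res hV t := by
  have := (toShf_isLocallyBijective P).2
  obtain ⟨V, i, ⟨s, hs⟩, hxV⟩ := Presheaf.imageSieve_mem (Opens.grothendieckTopology X)
    ((PresheafOfModules.toPresheaf _).map (toShf P)) (U := op U) t x hx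
  exact ⟨V, i.le, s, hxV, hs⟩

lemma eq_of_locally_eq {M : X.Modules} {U : X.Opens} (s t : MSec M U)
    (h : ∀ x ∈ U, ∃ (V : X.Opens) (hV : V ≤ U), x ∈ V ∧ res hV s = res hV t) : s = t := by
  choose V hV hx hs using h
  exact TopCat.Sheaf.eq_of_locally_eq' (⟨M.presheaf, M.isSheaf⟩ : TopCat.Sheaf Ab.{u} X)
    (fun x : U => V x x.2) U (fun x => homOfLE (hV _ _))
    (fun x hxU => TopologicalSpace.Opens.mem_iSup.2 ⟨⟨x, hxU⟩, hx _ _⟩) s t fun x => hs _ _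

lemma ring_eq_of_locally_eq {U : X.Opens} (s t : Γ(X, U))
    (h : ∀ x ∈ U, ∃ (V : X.Opens) (hV : V ≤ U), x ∈ V ∧ resRing hV s = resRing hV t) : s = t := by
  choose V hV hx hs using h
  exact TopCat.Sheaf.eq_of_locally_eq' X.sheaf
    (fun x : U => V x x.2) U (fun x => homOfLE (hV _ _))
    (fun x hxU => TopologicalSpace.Opens.mem_iSup.2 ⟨⟨x, hxU⟩, hx _ _⟩) s t fun x => hs _ _

/-- Functions that agree on overlaps glue. -/
lemma exists_ring_glue {J : Type u} {U : X.Opens} (V : J → X.Opens) (hV : ∀ j, V j ≤ U)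
    (hU : ∀ x ∈ U, ∃ j, x ∈ V j) (s : ∀ j, Γ(X, V j))
    (hs : ∀ (i j : J) (W : X.Opens) (hi : W ≤ V i) (hj : W ≤ V j),
      resRing hi (s i) = resRing hj (s j)) :
    ∃ t : Γ(X, U), ∀ j, resRing (hV j) t = s j := by
  obtain ⟨t, ht, -⟩ := TopCat.Sheaf.existsUnique_gluing' X.sheaf V U (fun j => homOfLE (hV j))
    (fun x hx => TopologicalSpace.Opens.mem_iSup.2 (hU x hx)) s fun i j => hs i j _ _ _
  exact ⟨t, ht⟩

/-- The sheafification of a presheaf of modules vanishes iff its sections vanish locally. -/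
lemma isZero_shf_iff (P : X.PresheafOfModules) : IsZero ((shf X).obj P) ↔
    ∀ (U : X.Opens) (s : Sec P U), ∀ x ∈ U, ∃ (V : X.Opens) (hV : V ≤ U), x ∈ V ∧
      res hV s = 0 := by
  refine ⟨fun h U s x hx => exists_res_eq_zero s ?_ hx, fun h => ?_⟩
  · have := congrArg (fun z => mappl z U (appl (toShf P) U s)) (h.eq_of_src (𝟙 _) 0)
    exact this
  · rw [IsZero.iff_id_eq_zero]
    have key : ∀ (U : X.Opens) (t : MSec ((shf X).obj P) U), t = 0 := fun U t => by
      refine eq_of_locally_eq _ _ fun x hx => ?_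
      obtain ⟨V, hV, s, hxV, hs⟩ := exists_toShf_eq t hx
      obtain ⟨W, hW, hxW, hsW⟩ := h V s x hxV
      refine ⟨W, hW.trans hV, hxW, ?_⟩
      rw [← res_res hV hW, ← hs, ← appl_res, hsW, map_zero, map_zero]
    apply SheafOfModules.hom_ext
    ext U t
    exact key U.unop t

/-- The counit of sheafification. -/
def shfIso : Scheme.Modules.toPresheafOfModules X ⋙ shf X ≅ 𝟭 X.Modules :=
  (asIso (PresheafOfModules.sheafificationAdjunction (𝟙 X.ringCatSheaf.obj)).counit :
    (SheafOfModules.forget X.ringCatSheaf ⋙ PresheafOfModules.restrictScalars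
      (𝟙 X.ringCatSheaf.obj)) ⋙ PresheafOfModules.sheafification (𝟙 X.ringCatSheaf.obj) ≅
        𝟭 (SheafOfModules X.ringCatSheaf))

instance (U : X.Opens) : PreservesFiniteLimits (secFunctor X U) :=
  inferInstanceAs (PreservesFiniteLimits (SheafOfModules.evaluation X.ringCatSheaf (op U)))

lemma exists_appl_eq {P Q R : X.PresheafOfModules} {f : P ⟶ Q} {g : Q ⟶ R} {w : f ≫ g = 0}
    (h : (ShortComplex.mk f g w).Exact) {U : X.Opens} (s : Sec Q U) (hs : appl g U s = 0) :
    ∃ t, appl f U t = s :=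
  (ShortComplex.moduleCat_exact_iff _).1 (h.map (PresheafOfModules.evaluation _ (op U))) s hs

/-- Epimorphisms of sheaves of modules are locally surjective. -/
lemma exists_mappl_eq_res {M N : X.Modules} (g : M ⟶ N) [Epi g] {U : X.Opens} (t : MSec N U)
    {x : X} (hx : x ∈ U) : ∃ (V : X.Opens) (hV : V ≤ U) (s : MSec M V), x ∈ V ∧
      mappl g V s = res hV t := by
  let g' : M.val ⟶ N.val := g.val
  -- The cokernel is formed in presheaves. Since `g` is epi its sheafification vanishes, so the
  -- class of `t` dies near `x`, and exactness of presheaves on sections yields a lift there.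
  let c := cokernel.π g'
  have h1 : Epi ((shf X).map g') := by
    let e (K : X.Modules) : (shf X).obj K.val ≅ K := shfIso.app K
    have h2 : (shf X).map g' = (e M).hom ≫ g ≫ (e N).inv := by
      rw [← Category.assoc]
      exact (Iso.eq_comp_inv (e N)).2 (shfIso.hom.naturality g)
    rw [h2]
    infer_instance
  have h2 : (shf X).map c = 0 := by
    rw [← cancel_epi ((shf X).map g'), ← Functor.map_comp, cokernel.condition, comp_zero,
      Functor.map_zero]
  have h3 : IsZero ((shf X).obj (cokernel g')) := by
    rw [IsZero.iff_id_eq_zero, ← cancel_epi ((shf X).map c), h2, zero_comp, zero_comp]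
  obtain ⟨V, hV, hxV, h4⟩ := (isZero_shf_iff _).1 h3 U (appl c U t) x hx
  rw [← appl_res] at h4
  obtain ⟨s, hs⟩ := exists_appl_eq (ShortComplex.exact_cokernel g') _ h4
  exact ⟨V, hV, s, hxV, hs⟩

lemma secFunctor_exact {S : ShortComplex X.Modules} (h : S.ShortExact) (U : X.Opens) :
    (S.map (secFunctor X U)).Exact := by
  have := h.mono_f
  exact h.exact.map_of_mono_of_preservesKernel (secFunctor X U) this inferInstance

lemma mappl_injective {S : ShortComplex X.Modules} (h : S.ShortExact) (U : X.Opens) :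
    Function.Injective (mappl S.f U) := by
  have := h.mono_f
  exact (ModuleCat.mono_iff_injective ((secFunctor X U).map S.f)).1 inferInstance

lemma exists_mappl_eq {S : ShortComplex X.Modules} (h : S.ShortExact) {U : X.Opens}
    (s : MSec S.X₂ U) (hs : mappl S.g U s = 0) : ∃ t, mappl S.f U t = s :=
  (ShortComplex.moduleCat_exact_iff _).1 (secFunctor_exact h U) s hs

end LocalFrame

/-! ### Closure properties of vector bundles -/

namespace LocalFrame

variable {X : Scheme.{u}} {P Q : X.PresheafOfModules}

section

variable {I : Type*} [Fintype I] {U V W : X.Opens} {e : I → Sec P U}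

variable (e) in
/-- Linear combinations as a linear map. -/
def combLin (h : V ≤ U) : (I → Γ(X, V)) →ₗ[Γ(X, V)] Sec P V where
  toFun := comb e h
  map_add' := comb_add e h
  map_smul' := comb_smul e h

/-- A frame identifies the sections with tuples of functions. -/
def IsFrame.equiv (he : IsFrame e) (h : V ≤ U) : (I → Γ(X, V)) ≃ₗ[Γ(X, V)] Sec P V :=
  LinearEquiv.ofBijective (combLin e h) (he V h)

/-- The coordinates with respect to a frame. -/
def IsFrame.coord (he : IsFrame e) (h : V ≤ U) : Sec P V →ₗ[Γ(X, V)] I → Γ(X, V) :=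
  (he.equiv h).symm

lemma IsFrame.comb_coord (he : IsFrame e) (h : V ≤ U) (s : Sec P V) :
    comb e h (he.coord h s) = s :=
  (he.equiv h).apply_symm_apply s

lemma IsFrame.coord_comb (he : IsFrame e) (h : V ≤ U) (c : I → Γ(X, V)) :
    he.coord h (comb e h c) = c :=
  (he.equiv h).symm_apply_apply c

lemma IsFrame.coord_res (he : IsFrame e) (h : V ≤ U) (h' : W ≤ V) (s : Sec P V) :
    he.coord (h'.trans h) (LocalFrame.res h' s) = fun i => resRing h' (he.coord h s i) := by
  conv_lhs => rw [← he.comb_coord h s, res_comb, he.coord_comb]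

end

open Matrix in
/-- A presheaf of modules whose sections are naturally a retract of tuples of functions is locally
free. -/
lemma isLocallyFreeAt_of_retract {I : Type} [Fintype I] {U : X.Opens}
    (s : I → Sec P U) (α : ∀ (V : X.Opens), V ≤ U → (Sec P V →ₗ[Γ(X, V)] I → Γ(X, V)))
    (h₁ : ∀ (V W : X.Opens) (h : V ≤ U) (h' : W ≤ V) (y : Sec P V),
      α W (h'.trans h) (res h' y) = fun i => resRing h' (α V h y i))
    (h₂ : ∀ (V : X.Opens) (h : V ≤ U) (y : Sec P V), comb s h (α V h y) = y)
    {x : X} (hx : x ∈ U) : IsLocallyFreeAt P x := by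
  classical
  refine isLocallyFreeAt_of_matrix s (Matrix.of fun i j => α U le_rfl (s j) i)
    (fun V h y => ⟨_, h₂ V h y⟩) (fun i => h₂ U le_rfl (s i)) (fun V h c hc => ?_) hx
  have h3 : ((Matrix.of fun i j => α U le_rfl (s j) i).map (resRing h)) *ᵥ c =
      α V h (comb s h c) := by
    ext i
    simp only [comb, map_sum, map_smul, Finset.sum_apply, Pi.smul_apply, Matrix.mulVec, dotProduct,
      Matrix.map_apply, Matrix.of_apply, smul_eq_mul]
    refine Finset.sum_congr rfl fun j _ => ?_
    rw [h₁ U V le_rfl h, mul_comm]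
  rw [h3, hc, map_zero]

/-- Frames of all `B j` over a common neighbourhood make the sections of `M` a natural retract of
tuples of functions. -/
lemma isVectorBundle_of_total {J : Type} [Fintype J] {M : X.Modules} (B : J → X.Modules)
    (a : ∀ j, M ⟶ B j) (b : ∀ j, B j ⟶ M) (h : ∑ j, a j ≫ b j = 𝟙 M)
    (hB : ∀ j, IsVectorBundle X (B j)) : IsVectorBundle X M := by
  rw [isVectorBundle_iff]
  intro x
  obtain ⟨U, hx, hU⟩ := exists_common_nbhd Finset.univ x
    (fun j U => ∃ (n : ℕ) (e : Fin n → MSec (B j) U), IsFrame e)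
    (fun j U V hVU ⟨n, e, he⟩ => exists_isFrame_of_le he hVU)
    (fun j _ => by
      obtain ⟨U, hx, n, e, he⟩ := (isVectorBundle_iff _).1 (hB j) x
      exact ⟨U, hx, n, e, he⟩)
  choose n e he using fun j => hU j (Finset.mem_univ j)
  refine isLocallyFreeAt_of_retract (I := Σ j, Fin (n j))
    (fun i => mappl (b i.1) U (e i.1 i.2))
    (fun V hV => LinearMap.pi fun i => LinearMap.proj i.2 ∘ₗ (he i.1).coord hV ∘ₗ mappl (a i.1) V)
    (fun V W hV hW y => ?_) (fun V hV y => ?_) hx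
  · funext i
    change (he i.1).coord _ (mappl (a i.1) W (res hW y)) i.2 = _
    rw [mappl_res, (he i.1).coord_res hV hW]
    rfl
  · have h1 := congrArg (fun z => mappl z V y) h
    simp only [mappl_sum, mappl_id, mappl_comp] at h1
    refine Eq.trans ?_ h1
    rw [comb, Fintype.sum_sigma]
    refine Finset.sum_congr rfl fun j _ => ?_
    conv_rhs => rw [← (he j).comb_coord hV (mappl (a j) V y), mappl_comb]
    rfl

lemma exists_lift_frame {M N : X.Modules} (g : M ⟶ N) [Epi g] {n : ℕ} {U : X.Opens}
    (q : Fin n → MSec N U) {x : X} (hx : x ∈ U) :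
    ∃ (V : X.Opens) (hV : V ≤ U) (t : Fin n → MSec M V), x ∈ V ∧
      ∀ i, mappl g V (t i) = res hV (q i) := by
  obtain ⟨V, hxV, hV⟩ := exists_common_nbhd Finset.univ x
    (fun i V => ∃ (hV : V ≤ U) (s : MSec M V), mappl g V s = res hV (q i))
    (fun i V W hWV ⟨hV, s, hs⟩ => ⟨hWV.trans hV, res hWV s, by rw [mappl_res, hs, res_res]⟩)
    (fun i _ => by
      obtain ⟨V, hV, s, hxV, hs⟩ := exists_mappl_eq_res g (q i) hx
      exact ⟨V, hxV, hV, s, hs⟩)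
  have hVU : ∀ i, ∃ t : MSec M (V ⊓ U), mappl g (V ⊓ U) t = res inf_le_right (q i) := fun i => by
    obtain ⟨hV, t, ht⟩ := hV i (Finset.mem_univ i)
    exact ⟨res inf_le_left t, by rw [mappl_res, ht, res_res]⟩
  choose t ht using hVU
  exact ⟨V ⊓ U, inf_le_right, t, ⟨hxV, hx⟩, ht⟩

/-- Lifting a local frame of the quotient splits the sequence locally, so the kernel is locally a
retract of the middle term. -/
lemma isVectorBundle_of_shortExact {S : ShortComplex X.Modules} (h : S.ShortExact)
    (h₂ : IsVectorBundle X S.X₂) (h₃ : IsVectorBundle X S.X₃) : IsVectorBundle X S.X₁ := by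
  rw [isVectorBundle_iff] at h₂ h₃ ⊢
  have := h.epi_g
  intro x
  obtain ⟨U₃, hx₃, n, q', hq'⟩ := h₃ x
  obtain ⟨U₂, hx₂, m, p', hp'⟩ := h₂ x
  obtain ⟨V, hV, t', hxV, ht'⟩ := exists_lift_frame S.g q' hx₃
  let U := V ⊓ U₂
  have hU₂ : U ≤ U₂ := inf_le_right
  have hU₃ : U ≤ U₃ := inf_le_left.trans hV
  have hp := hp'.res hU₂
  have hq := hq'.res hU₃
  let t (i) : MSec S.X₂ U := res inf_le_left (t' i)
  have ht : ∀ i, mappl S.g U (t i) = res hU₃ (q' i) := fun i => by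
    rw [mappl_res, ht', res_res]
  -- This is `g` followed by the local section given by the lifts `t`; `1 - T` is the projection
  -- onto the kernel, and its values on the frame of `S.X₂` give generators of `S.X₁`.
  let T (V : X.Opens) (hV : V ≤ U) : MSec S.X₂ V →ₗ[Γ(X, V)] MSec S.X₂ V :=
    combLin t hV ∘ₗ hq.coord hV ∘ₗ mappl S.g V
  have hT : ∀ (V : X.Opens) (hV : V ≤ U) (y : MSec S.X₂ V),
      mappl S.g V (T V hV y) = mappl S.g V y := fun V hV y => by
    refine (mappl_comb t S.g hV _).trans ?_
    simp only [ht]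
    exact hq.comb_coord hV _
  have hTres : ∀ (V : X.Opens) (hV : V ≤ U) (y : MSec S.X₂ U),
      T V hV (res hV y) = res hV (T U le_rfl y) := fun V hV y => by
    change comb t hV (hq.coord hV (mappl S.g V (res hV y))) =
      res hV (comb t le_rfl (hq.coord le_rfl (mappl S.g U y)))
    rw [mappl_res, hq.coord_res le_rfl hV, res_comb]
  have hs : ∀ i, ∃ s : MSec S.X₁ U, mappl S.f U s =
      res hU₂ (p' i) - T U le_rfl (res hU₂ (p' i)) := fun i =>
    exists_mappl_eq h _ (by rw [map_sub, hT, sub_self])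
  choose s hs using hs
  refine isLocallyFreeAt_of_retract (I := Fin m) s
    (fun V hV => hp.coord hV ∘ₗ mappl S.f V) (fun V W hV hW y => ?_) (fun V hV y => ?_)
    (U := U) ⟨hxV, hx₂⟩
  · change hp.coord _ (mappl S.f W (res hW y)) = _
    rw [mappl_res, hp.coord_res hV hW]
    rfl
  · apply mappl_injective h V
    have hg : mappl S.g V (mappl S.f V y) = 0 := by
      rw [← mappl_comp, S.zero, mappl_zero]
    rw [mappl_comb]
    have h1 : ∀ c : Fin m → Γ(X, V), comb (fun i => mappl S.f U (s i)) hV c =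
        comb (fun i => res hU₂ (p' i)) hV c -
          T V hV (comb (fun i => res hU₂ (p' i)) hV c) := fun c => by
      simp only [comb, hs, map_sub, map_sum, map_smul, smul_sub, Finset.sum_sub_distrib, hTres]
    rw [h1]
    change comb _ hV (hp.coord hV _) - T V hV (comb _ hV (hp.coord hV _)) = _
    rw [hp.comb_coord hV]
    have h2 : T V hV (mappl S.f V y) = 0 := by
      change comb t hV (hq.coord hV (mappl S.g V (mappl S.f V y))) = 0
      rw [hg, map_zero, comb_zero]
    rw [h2, sub_zero]

end LocalFrame

lemma exists_shortExact_of_epi {A : Type*} [Category* A] [Abelian A] {P Q : A} (p : P ⟶ Q)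
    (hp : Epi p) : ∃ (K : A) (k : K ⟶ P) (w : k ≫ p = 0), (ShortComplex.mk k p w).ShortExact :=
  ⟨kernel p, kernel.ι p, kernel.condition p,
    { exact := ShortComplex.exact_kernel p, mono_f := inferInstance, epi_g := hp }⟩

lemma exists_lift_of_shortExact {A : Type*} [Category* A] [Abelian A] (S : ShortComplex A)
    (h : S.ShortExact) {T : A} (t : T ⟶ S.X₂) (ht : t ≫ S.g = 0) :
    ∃ l : T ⟶ S.X₁, l ≫ S.f = t :=
  have := h.mono_f
  ⟨h.exact.lift t ht, h.exact.lift_f t ht⟩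

/-- The evaluation of the exact category of vector bundles in the category of sheaves of modules. -/
def vectorBundlesEvaluation (X : Scheme.{u}) : (vectorBundles X).Evaluation X.Modules where
  ι := Unit
  ev _ := 𝟭 X.Modules
  additive _ := inferInstanceAs (𝟭 X.Modules).Additive
  conflation_iff _ := ⟨fun h _ => h, fun h => h ()⟩
  exists_kernel p hp := @exists_shortExact_of_epi X.Modules inferInstance inferInstance _ _ p (hp ())
  mono_f _ h := ShortComplex.ShortExact.mono_f h
  exists_lift S h _ t ht := @exists_lift_of_shortExact X.Modules inferInstance inferInstance S h _ t ht
  mem_of_total B a b h hB := LocalFrame.isVectorBundle_of_total B a b h hB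
  mem_ker _ h := LocalFrame.isVectorBundle_of_shortExact h

/-! ### Exterior powers: degree and local freeness -/

lemma sum_neg_one_pow_card_eq_zero {J : Type*} [Fintype J] [DecidableEq J] {k : ℕ} (r : Fin k → J)
    (h : k < Fintype.card J) :
    ∑ T : Finset J with ∀ i, r i ∈ T, (-1 : ℤ) ^ T.card = 0 := by
  obtain ⟨j, hj⟩ : ∃ j, ∀ i, r i ≠ j := by
    by_contra! hr
    have := Fintype.card_le_of_surjective r hr
    simp at this
    omega
  refine Finset.sum_involution (fun T _ => if j ∈ T then T.erase j else insert j T) ?_ ?_ ?_ ?_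
  · intro T _
    split_ifs with h
    · rw [← Finset.card_erase_add_one h, pow_succ]
      ring
    · rw [Finset.card_insert_of_notMem h, pow_succ]
      ring
  · intro T _ _ hT
    split_ifs at hT with h
    · exact (Finset.erase_ne_self.2 h) hT
    · exact h (Finset.insert_eq_self.1 hT)
  · intro T hT
    simp only [Finset.mem_filter, Finset.mem_univ, true_and] at hT ⊢
    intro i
    split_ifs
    · exact Finset.mem_erase.2 ⟨hj i, hT i⟩
    · exact Finset.mem_insert_of_mem (hT i)
  · intro T _
    by_cases h : j ∈ T
    · simp [h]
    · simp [h]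

/-- After expansion, the term of an index function `r` occurs with the signed count of the sets
containing its image. Some element lies outside that image, and toggling it cancels the sets in
pairs. -/
lemma MultilinearMap.sum_neg_one_pow_card_smul {R M N : Type*} [CommRing R] [AddCommGroup M]
    [AddCommGroup N] [Module R M] [Module R N] {J : Type*} [Fintype J] [DecidableEq J] {k : ℕ}
    (f : MultilinearMap R (fun _ : Fin k => M) N) (m : Fin k → J → M) (h : k < Fintype.card J) :
    ∑ T : Finset J, (-1 : ℤ) ^ T.card • f (fun i => ∑ j ∈ T, m i j) = 0 := by
  simp only [MultilinearMap.map_sum_finset, Finset.smul_sum]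
  rw [Finset.sum_comm' (t' := Finset.univ) (s' := fun r => {T : Finset J | ∀ i, r i ∈ T})
    (by simp)]
  refine Finset.sum_eq_zero fun r _ => ?_
  rw [← Finset.sum_smul, sum_neg_one_pow_card_eq_zero r h, zero_smul]

open DoldPuppe in
lemma ModuleCat.exteriorPower.hasDegreeLE (R : Type u) [CommRing R] (k : ℕ) :
    HasDegreeLE (ModuleCat.exteriorPower.functor.{u} R k) k := fun {A B} f => by
  refine ModuleCat.exteriorPower.hom_ext (ModuleCat.AlternatingMap.ext fun m => ?_)
  have := (_root_.exteriorPower.ιMulti R k (M := B)).toMultilinearMap.sum_neg_one_pow_card_smul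
    (fun i (j : Fin (k + 1)) => f j (m i)) (by simp)
  refine Eq.trans ?_ this
  let ev : (A.exteriorPower k ⟶ B.exteriorPower k) →+ B.exteriorPower k :=
    { toFun := fun g => g (mk m)
      map_zero' := rfl
      map_add' := fun _ _ => rfl }
  have h1 : ∀ T : Finset (Fin (k + 1)), ev (map (∑ j ∈ T, f j) k) =
      _root_.exteriorPower.ιMulti R k (M := B) fun i => ∑ j ∈ T, f j (m i) := fun T => by
    refine (map_mk _ m).trans (congrArg (_root_.exteriorPower.ιMulti R k (M := B)) ?_)
    funext i
    simp
  refine (map_sum ev _ _).trans (Finset.sum_congr rfl fun T _ => ?_)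
  exact (map_zsmul ev _ _).trans (congrArg _ (h1 T))

namespace LocalFrame

variable {X : Scheme.{u}} {P Q : X.PresheafOfModules}

variable (X) in
/-- The exterior power of presheaves of modules. -/
def extPow (k : ℕ) : X.PresheafOfModules ⥤ X.PresheafOfModules :=
  PresheafOfModules.exteriorPower (R := X.presheaf) k

variable (X) in
/-- The functor of sections of presheaves over an open subset. -/
def psec (U : X.Opens) : X.PresheafOfModules ⥤ ModuleCat.{u} Γ(X, U) :=
  PresheafOfModules.evaluation _ (op U)

instance (U : X.Opens) : (psec X U).Additive where
  map_add := rfl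

lemma presheaf_hom_ext {f g : P ⟶ Q} (h : ∀ U, (psec X U).map f = (psec X U).map g) : f = g :=
  PresheafOfModules.hom_ext fun U => h U.unop

open DoldPuppe in
lemma extPow_hasDegreeLE (k : ℕ) : HasDegreeLE (extPow X k) k := fun {A B} f => by
  refine presheaf_hom_ext fun U => ?_
  have := HasDegreeLE.precomp (ModuleCat.exteriorPower.hasDegreeLE Γ(X, U) k) (psec X U) f
  rw [Functor.map_zero, Functor.map_sum]
  simp only [Functor.map_zsmul]
  exact this

open DoldPuppe in
lemma modulesExteriorPower_hasDegreeLE (k : ℕ) : HasDegreeLE (modulesExteriorPower X k) k :=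
  have : (Scheme.Modules.toPresheafOfModules X).Additive := { map_add := rfl }
  HasDegreeLE.precomp (HasDegreeLE.comp (extPow_hasDegreeLE k) (shf X))
    (Scheme.Modules.toPresheafOfModules X)

lemma ModuleCat.exteriorPower_map_zero (R : Type u) [CommRing R] {k : ℕ} (hk : 1 ≤ k)
    (A B : ModuleCat.{u} R) : (ModuleCat.exteriorPower.functor R k).map (0 : A ⟶ B) = 0 := by
  refine ModuleCat.exteriorPower.hom_ext (ModuleCat.AlternatingMap.ext fun m => ?_)
  refine (ModuleCat.exteriorPower.map_mk _ m).trans ?_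
  -- A zero entry in position `0`, which exists because `k ≥ 1`, kills the wedge.
  exact (_root_.exteriorPower.ιMulti R k (M := B)).map_coord_zero (m := (0 : A ⟶ B) ∘ m) ⟨0, hk⟩ rfl

lemma modulesExteriorPower_map_zero {k : ℕ} (hk : 1 ≤ k) (M N : X.Modules) :
    (modulesExteriorPower X k).map (0 : M ⟶ N) = 0 := by
  have h : (extPow X k).map (0 : M.val ⟶ N.val) = 0 := presheaf_hom_ext fun U =>
    ModuleCat.exteriorPower_map_zero _ hk _ _
  exact (congrArg (shf X).map h).trans (Functor.map_zero _ _ _)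

section

variable {U : X.Opens}

/-- The exterior power of sections. -/
def wedge {k : ℕ} (m : Fin k → Sec P U) : Sec ((extPow X k).obj P) U :=
  exteriorPower.ιMulti Γ(X, U) k m

lemma res_wedge {k : ℕ} {V : X.Opens} (h : V ≤ U) (m : Fin k → Sec P U) :
    res h (wedge m) = wedge fun i => res h (m i) :=
  PresheafOfModules.exteriorPowerMap_mk (R := X.presheaf) P k (homOfLE h).op m

lemma bijective_sum_wedge {R M : Type*} [CommRing R] [AddCommGroup M] [Module R M] {n : ℕ}
    (b : Module.Basis (Fin n) R M) (k : ℕ) :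
    Function.Bijective fun c : Set.powersetCard (Fin n) k → R =>
      ∑ S, c S • exteriorPower.ιMulti R k fun i => b (Set.powersetCard.ofFinEmbEquiv.symm S i) := by
  have h1 := (b.exteriorPower (n := k)).equivFun.symm.bijective
  have h2 : (fun c : Set.powersetCard (Fin n) k → R =>
      ∑ S, c S • exteriorPower.ιMulti R k fun i => b (Set.powersetCard.ofFinEmbEquiv.symm S i)) =
      (b.exteriorPower (n := k)).equivFun.symm := by
    funext c
    rw [Module.Basis.equivFun_symm_apply]
    refine Finset.sum_congr rfl fun S _ => congrArg (c S • ·) ?_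
    exact (exteriorPower.basis_apply R k b S).symm
  rw [h2]
  exact h1

lemma IsFrame.wedge {n : ℕ} {e : Fin n → Sec P U} (he : IsFrame e) (k : ℕ) :
    IsFrame fun S : Set.powersetCard (Fin n) k =>
      LocalFrame.wedge fun i => e (Set.powersetCard.ofFinEmbEquiv.symm S i) := fun V h => by
  let b : Module.Basis (Fin n) Γ(X, V) (Sec P V) := Module.Basis.ofEquivFun (he.equiv h).symm
  have hb : ∀ i, LocalFrame.res h (e i) = b i := fun i => by
    rw [← comb_single]
    simp only [b, Module.Basis.coe_ofEquivFun]
    rfl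
  have h2 : comb (P := (extPow X k).obj P) (fun S : Set.powersetCard (Fin n) k =>
      LocalFrame.wedge fun i => e (Set.powersetCard.ofFinEmbEquiv.symm S i)) h =
      fun c => ∑ S, c S • LocalFrame.wedge fun i => b (Set.powersetCard.ofFinEmbEquiv.symm S i) := by
    funext c
    simp only [comb, res_wedge, hb]
  rw [h2]
  exact bijective_sum_wedge b k

/-- Over `U` the presheaf is free, hence already a sheaf. Concretely, uniqueness of coordinates may
be checked locally; local coordinates of a section of the sheafification then agree on overlaps and
glue. -/
lemma IsFrame.toShf {I : Type*} [Fintype I] {e : I → Sec P U} (he : IsFrame e) :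
    IsFrame (P := ((shf X).obj P).val) fun i => appl (toShf P) U (e i) := by
  have hinj : ∀ (V : X.Opens) (h : V ≤ U) (c : I → Γ(X, V)),
      appl (LocalFrame.toShf P) V (comb e h c) = 0 → c = 0 := fun V h c hc => by
    funext i
    refine ring_eq_of_locally_eq _ _ fun x hx => ?_
    obtain ⟨W, hW, hxW, h0⟩ := exists_res_eq_zero _ hc hx
    refine ⟨W, hW, hxW, ?_⟩
    rw [res_comb] at h0
    have := congrFun ((he W _).1 (h0.trans (comb_zero e _).symm)) i
    exact this.trans (map_zero _).symm
  refine isFrame_of_comb_eq_zero (fun V h t => ?_) (fun V h c hc => hinj V h c ?_)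
  · choose W hW s hxW hs using fun x : V => exists_toShf_eq t x.2
    have hc : ∀ x : V, ∃ c, comb e ((hW x).trans h) c = s x := fun x => (he _ _).2 _
    choose c hc using hc
    have key : ∀ i, ∃ d : Γ(X, V), ∀ x, resRing (hW x) d = c x i := fun i => by
      refine exists_ring_glue W hW (fun x hx => ⟨⟨x, hx⟩, hxW _⟩) (fun x => c x i)
        fun x y W' hx hy => ?_
      have : (fun i => resRing hx (c x i)) - (fun i => resRing hy (c y i)) = 0 := by
        apply hinj W' (hx.trans ((hW x).trans h))
        rw [comb_sub, map_sub, ← res_comb e ((hW x).trans h) hx,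
          ← res_comb e ((hW y).trans h) hy, hc, hc, appl_res, appl_res, hs, hs, res_res, res_res,
          sub_self]
      exact sub_eq_zero.1 (congrFun this i)
    choose d hd using key
    refine ⟨d, eq_of_locally_eq _ _ fun x hx => ⟨W ⟨x, hx⟩, hW _, hxW ⟨x, hx⟩, ?_⟩⟩
    rw [← hs, ← hc, res_comb, appl_comb]
    simp only [hd]
  · rw [appl_comb]
    exact hc

end

lemma isVectorBundle_modulesExteriorPower (k : ℕ) {M : X.Modules} (hM : IsVectorBundle X M) :
    IsVectorBundle X ((modulesExteriorPower X k).obj M) := by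
  rw [isVectorBundle_iff] at hM ⊢
  intro x
  obtain ⟨U, hx, n, e, he⟩ := hM x
  exact (he.wedge k).toShf.isLocallyFreeAt hx

end LocalFrame

lemma ChainComplex.isZero_homotopyCofiber_X {C : Type*} [Category* C] [Preadditive C]
    [HasBinaryBiproducts C] {V W : ChainComplex C ℕ} (f : V ⟶ W) {n : ℕ} (hV : IsZero (V.X n))
    (hW : IsZero (W.X (n + 1))) : IsZero ((HomologicalComplex.homotopyCofiber f).X (n + 1)) := by
  rw [IsZero.iff_id_eq_zero, ← cone_total_succ, hV.eq_of_tgt (coneFst f n) 0,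
    hW.eq_of_tgt (coneSnd f (n + 1)) 0, zero_comp, zero_comp, add_zero]

/-! ### From local homotopy equivalences to global quasi-isomorphisms -/

namespace LocalFrame

variable {X : Scheme.{u}}

/-- One lift of a frame of the target works for all smaller open sets at once, because arbitrary
sections are combinations of the frame. -/
lemma exists_nbhd_surjective {M N : X.Modules} (g : M ⟶ N) [Epi g] {x : X}
    (hN : IsLocallyFreeAt N.val x) :
    ∃ U : X.Opens, x ∈ U ∧ ∀ V ≤ U, Function.Surjective (mappl g V) := by
  obtain ⟨U, hx, n, q, hq⟩ := hN
  obtain ⟨V, hV, t, hxV, ht⟩ := exists_lift_frame g q hx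
  refine ⟨V, hxV, fun W hW y => ?_⟩
  obtain ⟨c, rfl⟩ := (hq W (hW.trans hV)).2 y
  refine ⟨comb t hW c, ?_⟩
  rw [mappl_comb]
  simp only [ht]
  exact comb_res q hV hW c

lemma exists_nbhd_shortExact {S : ShortComplex X.Modules} (h : S.ShortExact) {x : X}
    (hS : IsLocallyFreeAt S.X₃.val x) :
    ∃ U : X.Opens, x ∈ U ∧ ∀ V ≤ U, (S.map (secFunctor X V)).ShortExact := by
  have := h.epi_g
  have := h.mono_f
  obtain ⟨U, hx, hU⟩ := exists_nbhd_surjective S.g hS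
  exact ⟨U, hx, fun V hV =>
    { exact := secFunctor_exact h V
      mono_f := inferInstanceAs (Mono ((secFunctor X V).map S.f))
      epi_g := (ModuleCat.epi_iff_surjective _).2 (hU V hV) }⟩

/-- The sections of a bounded acyclic complex of vector bundles are locally acyclic. -/
lemma exists_nbhd_acyclic {V : ChainComplex X.Modules ℕ} (hV : ∀ n, IsVectorBundle X (V.X n))
    {N : ℕ} (hN : ∀ n, N ≤ n → IsZero (V.X n)) (h : V.Acyclic) (x : X) :
    ∃ U : X.Opens, x ∈ U ∧ ∀ U' ≤ U, ((secFunctor X U').mapChain.obj V).Acyclic := by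
  have hac : ∃ (Z : ℕ → X.Modules) (i : ∀ n, Z n ⟶ V.X n) (p : ∀ n, V.X (n + 1) ⟶ Z n)
      (w : ∀ n, i (n + 1) ≫ p n = 0), (∀ n, IsVectorBundle X (Z n)) ∧ IsIso (i 0) ∧
      (∀ n, p n ≫ i n = V.d (n + 1) n) ∧
      ∀ n, (ShortComplex.mk (i (n + 1)) (p n) (w n)).ShortExact :=
    ((vectorBundlesEvaluation X).isAcyclic_iff hV).2 fun _ n => h n
  obtain ⟨Z, i, p, w, hZ, hi, hd, hS⟩ := hac
  -- Only the sequences with `n < N` impose a condition, so finitely many neighbourhoods are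
  -- intersected.
  obtain ⟨U, hx, hU⟩ := exists_common_nbhd (Finset.range N) x
    (fun n U => ∀ U' ≤ U,
      ((ShortComplex.mk (C := X.Modules) (i (n + 1)) (p n) (w n)).map (secFunctor X U')).ShortExact)
    (fun n U V hVU hU U' hU' => hU U' (hU'.trans hVU))
    (fun n _ => exists_nbhd_shortExact (hS n) ((isVectorBundle_iff _).1 (hZ n) x))
  refine ⟨U, hx, fun U' hU' => acyclic_of_splice (secFunctor X U') Z i p w hd fun n => ?_⟩
  by_cases hn : n < N
  · exact hU n (Finset.mem_range.2 hn) U' hU'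
  · have h0 : IsZero (V.X (n + 1)) := hN _ (by omega)
    have hS' : (ShortComplex.mk (C := X.Modules) (i (n + 1)) (p n) (w n)).ShortExact := hS n
    have := hS'.mono_f
    have := hS'.epi_g
    -- From degree `N` on, the cycles are a quotient of the zero object.
    have hZ0 : IsZero (C := X.Modules) (Z n) := by
      rw [IsZero.iff_id_eq_zero]
      exact (cancel_epi (C := X.Modules) (p n)).1 (h0.eq_of_src _ _)
    exact
      { exact := secFunctor_exact hS' U'
        mono_f := inferInstanceAs (Mono ((secFunctor X U').map _))
        epi_g := ((secFunctor X U').map_isZero hZ0).epi _ }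

lemma exists_nbhd_quasiIso {V W : ChainComplex X.Modules ℕ} (f : V ⟶ W)
    (hV : (vectorBundles X).boundedComplexes V) (hW : (vectorBundles X).boundedComplexes W)
    (hf : QuasiIso f) (x : X) :
    ∃ U : X.Opens, x ∈ U ∧ ∀ U' ≤ U, QuasiIso ((secFunctor X U').mapChain.map f) := by
  obtain ⟨⟨N, hN⟩, hV⟩ := hV
  obtain ⟨⟨N', hN'⟩, hW⟩ := hW
  simp only [quasiIso_mapChain_iff]
  refine exists_nbhd_acyclic
    -- The cone contains `V` shifted by one, hence the `+ 1` in its bound.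
    ((vectorBundlesEvaluation X).mem_homotopyCofiber f hV hW) (N := max N N' + 1) ?_
    ((ChainComplex.acyclic_homotopyCofiber_iff f).2 hf) x
  rintro (_ | n) hn
  · omega
  · exact ChainComplex.isZero_homotopyCofiber_X f (hN n (by omega)) (hN' (n + 1) (by omega))

lemma projective_of_isFrame {M : X.Modules} {U : X.Opens} {n : ℕ} {e : Fin n → MSec M U}
    (he : IsFrame e) {V : X.Opens} (hV : V ≤ U) : Projective ((secFunctor X V).obj M) :=
  ModuleCat.projective_of_free (Module.Basis.ofEquivFun (he.equiv hV).symm)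

lemma exists_nbhd_projective {V : ChainComplex X.Modules ℕ}
    (hV : (vectorBundles X).boundedComplexes V) (x : X) :
    ∃ U : X.Opens, x ∈ U ∧ ∀ U' ≤ U, ∀ n,
      Projective (((secFunctor X U').mapChain.obj V).X n) := by
  obtain ⟨⟨N, hN⟩, hV⟩ := hV
  obtain ⟨U, hx, hU⟩ := exists_common_nbhd (Finset.range N) x
    (fun n U => ∃ (m : ℕ) (e : Fin m → MSec (V.X n) U), IsFrame e)
    (fun n U V hVU ⟨m, e, he⟩ => exists_isFrame_of_le he hVU)
    (fun n _ => by
      obtain ⟨U, hx, n, e, he⟩ := (isVectorBundle_iff _).1 (hV n) x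
      exact ⟨U, hx, n, e, he⟩)
  refine ⟨U, hx, fun U' hU' n => ?_⟩
  by_cases hn : n < N
  · obtain ⟨m, e, he⟩ := hU n (Finset.mem_range.2 hn)
    exact projective_of_isFrame he hU'
  · have h0 := (secFunctor X U').map_isZero (hN n (by omega))
    exact ⟨fun _ _ _ => ⟨0, h0.eq_of_src _ _⟩⟩

open DoldPuppe

/-- Between non-negative complexes of projectives a quasi-isomorphism is a homotopy equivalence, and
these are preserved for every functor `F`. -/
lemma quasiIso_unnormalized_of_projective {A B : Type*} [Category* A] [Abelian A] [Category* B]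
    [Abelian B] {V W : ChainComplex A ℕ} (hV : ∀ n, Projective (V.X n))
    (hW : ∀ n, Projective (W.X n)) (f : V ⟶ W) (hf : QuasiIso f) (F : A ⥤ B) :
    QuasiIso ((unnormalized F).map f) := by
  obtain ⟨e, he⟩ := (ChainComplex.quasiIso_iff_of_projective f).1 hf
  rw [← he]
  exact (unnormalizedHomotopyEquiv F e).quasiIso_hom

/-- Sections of the presheaf exterior power are the exterior power of the module of sections, so the
claim is the one for modules over a single ring. -/
lemma quasiIso_psec_unnormalized {V W : ChainComplex X.Modules ℕ} (f : V ⟶ W) (k : ℕ)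
    (U : X.Opens) (hV : ∀ n, Projective (((secFunctor X U).mapChain.obj V).X n))
    (hW : ∀ n, Projective (((secFunctor X U).mapChain.obj W).X n))
    (hf : QuasiIso ((secFunctor X U).mapChain.map f)) :
    QuasiIso ((psec X U).mapChain.map
      ((unnormalized (Scheme.Modules.toPresheafOfModules X ⋙ extPow X k)).map f)) := by
  have h1 : QuasiIso (((secFunctor X U).mapChain ⋙
      unnormalized (ModuleCat.exteriorPower.functor.{u} Γ(X, U) k)).map f) :=
    quasiIso_unnormalized_of_projective hV hW _ hf _
  have h2 : QuasiIso ((unnormalized (secFunctor X U ⋙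
      ModuleCat.exteriorPower.functor.{u} Γ(X, U) k)).map f) :=
    quasiIso_of_arrow_mk_iso _ _ (arrowIsoOfNatIso (unnormalizedPrecompIso _ _) f).symm
  have h3 : QuasiIso ((unnormalized ((Scheme.Modules.toPresheafOfModules X ⋙ extPow X k) ⋙
      psec X U)).map f) := h2
  exact quasiIso_of_arrow_mk_iso _ _ (arrowIsoOfNatIso (unnormalizedCompIso
    (Scheme.Modules.toPresheafOfModules X ⋙ extPow X k) (psec X U)) f)

instance (U : X.Opens) : (psec X U).PreservesHomology :=
  inferInstanceAs (PresheafOfModules.evaluation _ (op U)).PreservesHomology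

/-- Sheafification is exact, so the homology of the sheafified complex is the sheafified homology
presheaf. Sections of the latter vanish near every point. -/
lemma shf_acyclic {C : ChainComplex X.PresheafOfModules ℕ}
    (h : ∀ x : X, ∃ U : X.Opens, x ∈ U ∧ ∀ U' ≤ U, ((psec X U').mapChain.obj C).Acyclic) :
    ((shf X).mapChain.obj C).Acyclic := fun n => by
  have h0 : IsZero ((shf X).obj (C.sc n).homology) := by
    rw [isZero_shf_iff]
    intro U s x hx
    obtain ⟨V, hxV, hV⟩ := h x
    refine ⟨U ⊓ V, inf_le_left, ⟨hx, hxV⟩, ?_⟩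
    have h1 : ((C.sc n).map (psec X (U ⊓ V))).Exact := hV _ inf_le_right n
    have h2 : IsZero ((psec X (U ⊓ V)).obj (C.sc n).homology) :=
      ((ShortComplex.exact_iff_isZero_homology _).1 h1).of_iso
        ((C.sc n).mapHomologyIso (psec X (U ⊓ V))).symm
    have := ModuleCat.subsingleton_of_isZero h2
    exact this.elim _ _
  have h1 : ((C.sc n).map (shf X)).Exact :=
    (ShortComplex.exact_iff_isZero_homology _).2 (h0.of_iso ((C.sc n).mapHomologyIso (shf X)))
  exact h1

/-- Near a point, `f` is a quasi-isomorphism on sections and all terms have projective sections. The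
cone of the presheaf-level map is thus acyclic on small open sets, and sheafifying gives the claim.
-/
lemma quasiIso_modulesExteriorPower {V W : ChainComplex X.Modules ℕ} (f : V ⟶ W) (k : ℕ)
    (hV : (vectorBundles X).boundedComplexes V) (hW : (vectorBundles X).boundedComplexes W)
    (hf : QuasiIso f) : QuasiIso ((unnormalized (modulesExteriorPower X k)).map f) := by
  let G := Scheme.Modules.toPresheafOfModules X ⋙ extPow X k
  have h1 : QuasiIso ((shf X).mapChain.map ((unnormalized G).map f)) := by
    rw [quasiIso_mapChain_iff]
    refine shf_acyclic fun x => ?_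
    obtain ⟨U₁, hx₁, h₁⟩ := exists_nbhd_quasiIso f hV hW hf x
    obtain ⟨U₂, hx₂, h₂⟩ := exists_nbhd_projective hV x
    obtain ⟨U₃, hx₃, h₃⟩ := exists_nbhd_projective hW x
    refine ⟨U₁ ⊓ (U₂ ⊓ U₃), ⟨hx₁, hx₂, hx₃⟩, fun U hU => ?_⟩
    rw [← quasiIso_mapChain_iff]
    exact quasiIso_psec_unnormalized f k U (h₂ U (hU.trans (inf_le_right.trans inf_le_left)))
      (h₃ U (hU.trans (inf_le_right.trans inf_le_right))) (h₁ U (hU.trans inf_le_left))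
  have h1' : QuasiIso ((unnormalized G ⋙ (shf X).mapChain).map f) := h1
  have h2 : QuasiIso ((unnormalized (G ⋙ shf X)).map f) :=
    quasiIso_of_arrow_mk_iso _ _ (arrowIsoOfNatIso (unnormalizedCompIso G (shf X)) f).symm
  exact h2

end LocalFrame

/-! ### Induction on the number of binary directions -/

open ExactDatum

lemma vectorBundles_admissible (X : Scheme.{u}) {k : ℕ} (hk : 1 ≤ k) :
    (vectorBundlesEvaluation X).Admissible (modulesExteriorPower X k) k where
  degree := LocalFrame.modulesExteriorPower_hasDegreeLE k
  map_zero := LocalFrame.modulesExteriorPower_map_zero hk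
  mem _ hP := LocalFrame.isVectorBundle_modulesExteriorPower k hP
  quasiIso f hV hW hf _ :=
    LocalFrame.quasiIso_modulesExteriorPower f k hV hW (hf ())

/-- The evaluation of the exact category of binary multi-complexes. -/
def binaryMultiComplexesEvaluation (X : Scheme.{u}) :
    ∀ s : ℕ, (binaryMultiComplexes X s).Evaluation X.Modules
  | 0 => vectorBundlesEvaluation X
  | s + 1 => (binaryMultiComplexesEvaluation X s).binary

lemma binaryMultiComplexes_admissible (X : Scheme.{u}) {k : ℕ} (hk : 1 ≤ k) :
    ∀ s : ℕ, (binaryMultiComplexesEvaluation X s).Admissible (multiExteriorPower X k s) k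
  | 0 => vectorBundles_admissible X hk
  | s + 1 => (binaryMultiComplexes_admissible X hk s).binary

end

theorem mainTheorem6 (X : AlgebraicGeometry.Scheme.{u}) [CompactSpace X] (k : ℕ) (hk : 1 ≤ k) :
    (∀ (s : ℕ) (V W : ChainComplex (binaryMultiComplexes X s).C ℕ) (f : V ⟶ W),
      (binaryMultiComplexes X s).boundedComplexes V →
      (binaryMultiComplexes X s).boundedComplexes W →
      (binaryMultiComplexes X s).IsQuasiIso f →
        (binaryMultiComplexes X s).boundedComplexes ((complexExteriorPower X k s).obj V) ∧
        (binaryMultiComplexes X s).boundedComplexes ((complexExteriorPower X k s).obj W) ∧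
        (binaryMultiComplexes X s).IsQuasiIso ((complexExteriorPower X k s).map f)) ∧
    (∀ (V W : ChainComplex X.Modules ℕ) (f : V ⟶ W),
      (vectorBundles X).boundedComplexes V → (vectorBundles X).boundedComplexes W →
      QuasiIso f → QuasiIso ((DoldPuppe.functor (modulesExteriorPower X k)).map f)) := by
  refine ⟨fun s V W f hV hW hf => ?_, fun V W f hV hW hf => ?_⟩
  · have h := binaryMultiComplexes_admissible X hk s
    exact ⟨h.boundedComplexes_functor hV, h.boundedComplexes_functor hW,
      h.isQuasiIso_functor f hV hW hf⟩
  · exact (vectorBundles_admissible X hk).quasiIso_functor f hV hW (fun _ => hf) ()
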